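/- Let $q,t\in\mathbb{C}$ with $|q|<1$ and $|t|<1$. Let $\Lambda=\mathbb{C}[p_1,p_2,\ldots]$ be the ring of symmetric functions, where $p_k$ is the $k$-th power sum, let $m_\lambda$ be the monomial symmetric functions, and let $\langle\cdot,\cdot\rangle_{q,t}$ be the bilinear form on $\Lambda$ with $$\langle p_\lambda,p_\mu\rangle_{q,t}=\mathbf 1(\lambda=\mu)\prod_{i=1}^{\ell(\lambda)}\frac{1-q^{\lambda_i}}{1-t^{\lambda_i}}\prod_{i\ge1}i^{m_i(\lambda)}\,m_i(\lambda)!,\qquad p_\lambda=\prod_{i=1}^{\ell(\lambda)} p_{\lambda_i},$$ where $\ell(\lambda)$ is the number of nonzero parts of the partition $\lambda$ and $m_i(\lambda)$ is the number of its parts equal to $i$. The Macdonald symmetric functions $P_\lambda(\mathbf x;q,t)$ are the family in $\Lambda$, indexed by partitions, that is pairwise orthogonal for $\langle\cdot,\cdot\rangle_{q,t}$ and satisfies $P_\lambda\in m_\lambda+\operatorname{span}_{\mathbb C}\{m_\mu:|\mu|=|\lambda|,\ \mu<\lambda\}$, where $<$ is the lexicographic order; put $Q_\lambda=P_\lambda/\langle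 P_\lambda,P_\lambda\rangle_{q,t}$. The skew functions $P_{\lambda/\mu}(\mathbf x;q,t)\in\Lambda$ are defined by requiring, for all $n,k\ge 0$, $$P_\lambda(x_1,\ldots,x_n,y_1,\ldots,y_k;q,t)=\sum_{\mu:\,\ell(\mu)\le n}P_{\lambda/\mu}(y_1,\ldots,y_k;q,t)\,P_\mu(x_1,\ldots,x_n;q,t),$$ and $Q_{\lambda/\mu}(\mathbf x;q,t)$ are defined in the same way with $Q$ in place of $P$. For complex numbers $a_1,a_2,\ldots$ with $\sum_i|a_i|<\infty$ and $f\in\Lambda$, let $f(\alpha(a_1,a_2,\ldots))$ be the image of $f$ under the algebra homomorphism $\Lambda\to\mathbb{C}$ with $p_k\mapsto\sum_{i\ge1}a_i^k$. Then for every $u\in\mathbb{C}$ and all partitions $\lambda,\mu$, $$\sum_{\nu:\ \mu\subset\nu\subset\lambda}P_{\lambda/\nu}\big(\alpha(u,ut,ut^2,\ldots);q,t\big)\;Q_{\nu'/\mu'}\big(\alpha(-u,-uq,-uq^2,\ldots);t,q\big)=\mathbf 1(\lambda=\mu),$$ where $\subset$ denotes (not necessarily strict) containment of Ferrers diagrams,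 $\nu'$ is the partition conjugate to $\nu$, and $Q_{\nu'/\mu'}(\,\cdot\,;t,q)$ is the skew function with the roles of $q$ and $t$ interchanged. -/

import Mathlib

/-! Partitions are Young diagrams, in English notation: `lam.rowLen i` is the part `λ_{i+1}`,
`lam.transpose` is the conjugate partition, `lam.card` is the size, `lam.colLen 0` is the number of
nonzero parts, and `mu ≤ lam` is containment of diagrams. -/

namespace Macdonald

open MvPolynomial

/-- The multiset of parts of a Young diagram sums to its size. -/
theorem sum_rowLens (lam : YoungDiagram) : lam.rowLens.sum = lam.card := by
  have h : lam.cells.card = ∑ i ∈ Finset.range (lam.colLen 0),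
      (lam.cells.filter (fun c => c.1 = i)).card := by
    apply Finset.card_eq_sum_card_fiberwise
    intro c hc
    have hc' : (c.1, c.2) ∈ lam := by simpa using hc
    have h0 : (c.1, 0) ∈ lam := lam.up_left_mem le_rfl (Nat.zero_le _) hc'
    simpa using YoungDiagram.mem_iff_lt_colLen.1 h0
  have h2 : lam.rowLens.sum = ∑ i ∈ Finset.range (lam.colLen 0), lam.rowLen i := rfl
  rw [YoungDiagram.card, h, h2]
  exact Finset.sum_congr rfl fun i _ => by rw [YoungDiagram.rowLen_eq_card]; rfl

/-- The partition of the integer `lam.card` whose parts are the row lengths of `lam`. -/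
def toPartition (lam : YoungDiagram) : lam.card.Partition where
  parts := lam.rowLens
  parts_pos := fun {i} hi => lam.pos_of_mem_rowLens i (by simpa using hi)
  parts_sum := by simpa using sum_rowLens lam

/-- There are finitely many partitions between two given ones. -/
theorem finite_Icc (mu lam : YoungDiagram) : (Set.Icc mu lam).Finite := by
  apply Set.Finite.of_finite_image (f := YoungDiagram.cells)
  · refine (lam.cells.powerset.finite_toSet).subset ?_
    rintro _ ⟨nu, hnu, rfl⟩
    simpa using YoungDiagram.cells_subset_iff.2 hnu.2
  · intro a _ b _ h
    exact YoungDiagram.ext h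

noncomputable instance : LocallyFiniteOrder YoungDiagram :=
  LocallyFiniteOrder.ofFiniteIcc finite_Icc

/-- The strict lexicographic order on partitions of the same size. -/
def LexLT (mu lam : YoungDiagram) : Prop :=
  mu.card = lam.card ∧
    ∃ i, (∀ j < i, mu.rowLen j = lam.rowLen j) ∧ mu.rowLen i < lam.rowLen i

/-- The ring of symmetric functions `Λ = ℂ[p₁, p₂, …]`; the indeterminate `X k` is the power sum
`p_k`, and the monomials in the `X k` are the products `p_λ`. -/
abbrev SymFun : Type := MvPolynomial ℕ+ ℂ

/-- The natural map from `Λ` to polynomials in a finite set of variables,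
`p_k ↦ ∑ i, x_i ^ k`; thus `toPoly (Fin n) f` is `f(x₁, …, x_n)`. -/
noncomputable def toPoly (σ : Type) [Fintype σ] : SymFun →ₐ[ℂ] MvPolynomial σ ℂ :=
  aeval fun k : ℕ+ => psum σ ℂ (k : ℕ)

/-- The monomial symmetric polynomial `m_λ(x₁, …, x_n)`: the sum of all distinct monomials
obtained by permuting the variables in `x₁^{λ₁} x₂^{λ₂} ⋯` (zero if `λ` has more than `n` parts). -/
noncomputable def monomialSymm (n : ℕ) (lam : YoungDiagram) : MvPolynomial (Fin n) ℂ :=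
  msymm (Fin n) ℂ (toPartition lam)

/-- The value `⟨p_λ, p_λ⟩_{q,t}`, for the partition `λ` in which the part `k` has
multiplicity `d k`. -/
noncomputable def powerSumNorm (q t : ℂ) (d : ℕ+ →₀ ℕ) : ℂ :=
  d.prod fun k m =>
    ((1 - q ^ (k : ℕ)) / (1 - t ^ (k : ℕ))) ^ m * ((k : ℂ) ^ m * (m.factorial : ℂ))

/-- The bilinear scalar product `⟨·, ·⟩_{q,t}` on `Λ` for which the products `p_λ` are orthogonal
with `⟨p_λ, p_λ⟩ = ∏ᵢ (1 - q^{λᵢ}) / (1 - t^{λᵢ}) · ∏ᵢ i^{mᵢ(λ)} mᵢ(λ)!`. -/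
noncomputable def scalarProduct (q t : ℂ) (f g : SymFun) : ℂ :=
  ∑ d ∈ f.support, f.coeff d * g.coeff d * powerSumNorm q t d

/-- The two defining properties of the family of Macdonald symmetric functions. The
expansion `P_λ = m_λ + ∑_{μ < λ} R_{λμ} m_μ` in `Λ` is an identity in every number `n` of variables,
with coefficients that do not depend on `n`. -/
structure IsMacdonaldFamily (q t : ℂ) (P : YoungDiagram → SymFun) : Prop where
  triangular : ∀ lam, ∃ R : YoungDiagram →₀ ℂ, (∀ mu ∈ R.support, LexLT mu lam) ∧
    ∀ n, toPoly (Fin n) (P lam) =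
      monomialSymm n lam + ∑ mu ∈ R.support, R mu • monomialSymm n mu
  orthogonal : ∀ lam mu, lam ≠ mu → scalarProduct q t (P lam) (P mu) = 0

/-- The Macdonald symmetric functions `P_λ(x; q, t)`: the family with the two defining
properties. -/
noncomputable def macP (q t : ℂ) : YoungDiagram → SymFun :=
  Classical.epsilon (IsMacdonaldFamily q t)

/-- The dual Macdonald symmetric functions `Q_λ = P_λ / ⟨P_λ, P_λ⟩_{q,t}`. -/
noncomputable def macQ (q t : ℂ) (lam : YoungDiagram) : SymFun :=
  (scalarProduct q t (macP q t lam) (macP q t lam))⁻¹ • macP q t lam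

/-- The branching rule that defines the skew functions `S μ = F_{λ/μ}` of a family `F`:
`F_λ(x₁, …, x_n, y₁, …, y_k) = ∑_{μ, len μ ≤ n} F_{λ/μ}(y₁, …, y_k) F_μ(x₁, …, x_n)`
for all `n` and `k`. -/
def IsSkew (F : YoungDiagram → SymFun) (lam : YoungDiagram) (S : YoungDiagram →₀ SymFun) : Prop :=
  ∀ n k : ℕ, toPoly (Fin n ⊕ Fin k) (F lam) =
    ∑ mu ∈ S.support with mu.colLen 0 ≤ n,
      rename Sum.inr (toPoly (Fin k) (S mu)) * rename Sum.inl (toPoly (Fin n) (F mu))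

/-- The skew symmetric function `F_{λ/μ}` determined by the branching rule. -/
noncomputable def skew (F : YoungDiagram → SymFun) (lam mu : YoungDiagram) : SymFun :=
  Classical.epsilon (IsSkew F lam) mu

/-- The skew Macdonald symmetric function `P_{λ/μ}(x; q, t)`. -/
noncomputable def skewP (q t : ℂ) (lam mu : YoungDiagram) : SymFun := skew (macP q t) lam mu

/-- The skew Macdonald symmetric function `Q_{λ/μ}(x; q, t)`. -/
noncomputable def skewQ (q t : ℂ) (lam mu : YoungDiagram) : SymFun := skew (macQ q t) lam mu

/-- The pure alpha specialization `α(a₀, a₁, …)` of `Λ`: the algebra homomorphism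
`p_k ↦ ∑ i, a_i ^ k`. -/
noncomputable def specAlpha (a : ℕ → ℂ) : SymFun →ₐ[ℂ] ℂ :=
  aeval fun k : ℕ+ => ∑' i, a i ^ (k : ℕ)

end Macdonald

/-! The sum is a matrix entry of a translation followed by its inverse. For a sequence ρ let τ_ρ be
the algebra automorphism p_k ↦ p_k + ρ_k of Λ. By the branching rule, P_{λ/ν} specialized at p_k ↦
ρ_k is the coefficient of P_ν in τ_ρ P_λ (`aeval_skew`). For α(u, ut, …) this means ρ_k = u^k/(1 -
t^k); for α(-u, -uq, …) the sequence is σ_k = (-u)^k/(1 - q^k). The involution ω : p_k ↦ (-1)^(k-1)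
(1 - q^k)/(1 - t^k) p_k sends P_ν(q,t) to Q_{ν'}(t,q) (`omega_macP`) and carries τ_{-ρ} to τ_σ,
because (-1)^(k-1) (1 - q^k)/(1 - t^k) σ_k = -ρ_k. So the Q-factor is the coefficient of P_μ in
τ_{-ρ} P_ν, and the sum over all ν is the coefficient of P_μ in τ_{-ρ} τ_ρ P_λ = P_λ.

That only μ ⊂ ν ⊂ λ contribute is a separate fact (`repr_shift_macP`). Translations are exponentials
of combinations of the ∂/∂p_k, and ∂/∂p_k is up to a scalar adjoint to multiplication by p_k. So it
is enough that p_k P_μ involves only P_λ with λ ⊃ μ (`form_macP_powerSum_mul`). For p_1 this follows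
from a relation between the first two Macdonald operators and p_1 (`exchange`): it kills the
coefficient unless B(q,t)^2 = B(q^2,t^2), where B is the generating function of the boxes of λ minus
that of μ, and this fails identically when both λ and μ have a box the other lacks. For p_k, the
commutator of the first Macdonald operator with p_k is proportional to its k-fold commutator with
p_1.

The family itself is constructed for qt ≠ 0 from the Macdonald operators. They are triangular on
monomial functions (`exists_eigenfunction`), self-adjoint because they act symmetrically on the two
sets of variables of the reproducing kernel, which is a consequence of the Cauchy determinant
(`cauchySum_symm`), and their eigenvalues, as polynomials in an auxiliary parameter, separate
partitions (`macEigen_injective`). On the axes q = 0 or t = 0 this separation is lost. There,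
existence and uniqueness come from Gram determinants: they are holomorphic for |q|, |t| < 1, nonzero
for qt ≠ 0 and nonzero at the origin, where the form is positive definite on real functions, so a
Hurwitz argument excludes zeros on the axes (`det_gram_ne_zero`). The coefficients of P_λ are
therefore holomorphic, and dominance triangularity and the Pieri vanishing pass to the axes by
continuity. -/

namespace Macdonald

open MvPolynomial Finset

/-! ### Partitions: dominance, lexicographic order, conjugation -/

section Diagrams

theorem rowLen_ext {a b : YoungDiagram} (h : ∀ i, a.rowLen i = b.rowLen i) : a = b := by
  apply YoungDiagram.ext
  ext ⟨i, j⟩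
  rw [YoungDiagram.mem_cells, YoungDiagram.mem_cells, YoungDiagram.mem_iff_lt_rowLen,
    YoungDiagram.mem_iff_lt_rowLen, h]

theorem rowLen_eq_zero_iff {lam : YoungDiagram} {i : ℕ} :
    lam.rowLen i = 0 ↔ lam.colLen 0 ≤ i := by
  rw [← not_iff_not, ← ne_eq, ← Nat.pos_iff_ne_zero, ← YoungDiagram.mem_iff_lt_rowLen,
    YoungDiagram.mem_iff_lt_colLen, not_le]

theorem sum_range_colLen_zero (lam : YoungDiagram) :
    ∑ i ∈ range (lam.colLen 0), lam.rowLen i = lam.card :=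
  sum_rowLens lam

theorem sum_range_rowLen {lam : YoungDiagram} {n : ℕ} (h : lam.colLen 0 ≤ n) :
    ∑ i ∈ range n, lam.rowLen i = lam.card := by
  rw [← sum_range_colLen_zero]
  symm
  apply Finset.sum_subset (by simpa using h)
  intro i _ hi
  exact rowLen_eq_zero_iff.2 (by simpa using hi)

theorem colLen_zero_le_card (lam : YoungDiagram) : lam.colLen 0 ≤ lam.card := by
  rw [YoungDiagram.colLen_eq_card]
  exact Finset.card_le_card (Finset.filter_subset _ _)

theorem sum_range_rowLen_lt {lam : YoungDiagram} {n : ℕ} (h : n < lam.colLen 0) :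
    ∑ i ∈ range n, lam.rowLen i < lam.card := by
  rw [← sum_range_colLen_zero]
  apply Finset.sum_lt_sum_of_subset (i := n) (by simpa using h.le) (by simpa using h) (by simp)
    _ (by simp)
  rw [← not_le, Nat.le_zero, rowLen_eq_zero_iff]
  omega

/-- The diagram whose row lengths are the values of an antitone function that reaches zero. -/
def ofAntitone (f : ℕ → ℕ) (hf : Antitone f) (n : ℕ) : YoungDiagram where
  cells := (range n).sigma (fun i => range (f i)) |>.map (Equiv.sigmaEquivProd ℕ ℕ).toEmbedding
  isLowerSet := by
    rintro ⟨i, j⟩ ⟨i', j'⟩ hle h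
    simp only [Prod.mk_le_mk] at hle
    simp only [coe_map, Set.mem_image, mem_coe, mem_sigma, mem_range] at h ⊢
    obtain ⟨⟨a, b⟩, ⟨h1, h2⟩, h3⟩ := h
    simp only [Equiv.coe_toEmbedding, Equiv.sigmaEquivProd_apply, Prod.mk.injEq] at h3
    obtain ⟨rfl, rfl⟩ := h3
    exact ⟨⟨i', j'⟩, ⟨hle.1.trans_lt h1, hle.2.trans_lt (h2.trans_le (hf hle.1))⟩, rfl⟩

theorem rowLen_ofAntitone (f : ℕ → ℕ) (hf : Antitone f) (n : ℕ) (hn : f n = 0) (i : ℕ) :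
    (ofAntitone f hf n).rowLen i = f i := by
  have key : ∀ j, j < (ofAntitone f hf n).rowLen i ↔ j < f i := by
    intro j
    rw [← YoungDiagram.mem_iff_lt_rowLen, ← YoungDiagram.mem_cells]
    simp only [ofAntitone, mem_map, mem_sigma, mem_range, Equiv.coe_toEmbedding,
      Equiv.sigmaEquivProd_apply, Prod.mk.injEq, Sigma.exists]
    constructor
    · rintro ⟨a, b, ⟨_, h2⟩, rfl, rfl⟩
      exact h2
    · intro h
      refine ⟨i, j, ⟨?_, h⟩, rfl, rfl⟩
      by_contra hc
      have := hf (not_lt.1 hc)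
      omega
  exact le_antisymm (not_lt.1 fun h => lt_irrefl _ ((key _).1 h))
    (not_lt.1 fun h => lt_irrefl _ ((key _).2 h))

theorem finite_card_eq (d : ℕ) : {lam : YoungDiagram | lam.card = d}.Finite := by
  apply Set.Finite.of_finite_image (f := YoungDiagram.cells)
  · refine ((range d ×ˢ range d).powerset.finite_toSet).subset ?_
    rintro _ ⟨lam, hlam, rfl⟩
    simp only [Set.mem_ofPred_eq] at hlam
    simp only [coe_powerset, Set.mem_preimage, Set.mem_powerset_iff, coe_subset]
    rintro ⟨i, j⟩ hc
    rw [YoungDiagram.mem_cells] at hc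
    have h1 : i < lam.colLen 0 :=
      YoungDiagram.mem_iff_lt_colLen.1 (lam.up_left_mem le_rfl (Nat.zero_le j) hc)
    have h2 : j < lam.transpose.colLen 0 := by
      rw [YoungDiagram.colLen_transpose]
      exact YoungDiagram.mem_iff_lt_rowLen.1 (lam.up_left_mem (Nat.zero_le i) le_rfl hc)
    have h3 := colLen_zero_le_card lam
    have h4 := colLen_zero_le_card lam.transpose
    have h5 : lam.transpose.card = lam.card := by
      simp [YoungDiagram.card, YoungDiagram.transpose]
    simp only [mem_product, mem_range]
    omega
  · intro a _ b _ h
    exact YoungDiagram.ext h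

theorem card_transpose (lam : YoungDiagram) : lam.transpose.card = lam.card := by
  simp [YoungDiagram.card, YoungDiagram.transpose]

/-- The partitions of `d`. -/
noncomputable def ofSize (d : ℕ) : Finset YoungDiagram := (finite_card_eq d).toFinset

@[simp]
theorem mem_ofSize {d : ℕ} {lam : YoungDiagram} : lam ∈ ofSize d ↔ lam.card = d := by
  simp [ofSize]

/-- Dominance of partial sums. -/
def DomLE (mu lam : YoungDiagram) : Prop :=
  ∀ k, ∑ i ∈ range k, mu.rowLen i ≤ ∑ i ∈ range k, lam.rowLen i

theorem DomLE.refl (lam : YoungDiagram) : DomLE lam lam := fun _ => le_rfl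

theorem DomLE.trans {a b c : YoungDiagram} (h : DomLE a b) (h' : DomLE b c) : DomLE a c :=
  fun k => (h k).trans (h' k)

theorem DomLE.antisymm {a b : YoungDiagram} (h : DomLE a b) (h' : DomLE b a) : a = b := by
  apply rowLen_ext
  intro i
  have h1 := (h i).antisymm (h' i)
  have h2 := (h (i + 1)).antisymm (h' (i + 1))
  rw [sum_range_succ, sum_range_succ, h1] at h2
  omega

/-- Both orders are needed: the family is defined with the lexicographic order, which is total in
each degree and suits Gram–Schmidt, while duality needs the dominance order, which conjugation
reverses. -/
theorem DomLE.lexLT {a b : YoungDiagram} (h : DomLE a b) (hc : a.card = b.card) (hne : a ≠ b) :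
    LexLT a b := by
  classical
  refine ⟨hc, ?_⟩
  have hex : ∃ i, a.rowLen i ≠ b.rowLen i := by
    by_contra! hcon
    exact hne (rowLen_ext hcon)
  have hmin : ∀ j < Nat.find hex, a.rowLen j = b.rowLen j := fun j hj => by
    simpa using Nat.find_min hex hj
  refine ⟨Nat.find hex, hmin, ?_⟩
  have h1 := h (Nat.find hex + 1)
  have h3 : ∑ i ∈ range (Nat.find hex), a.rowLen i = ∑ i ∈ range (Nat.find hex), b.rowLen i :=
    sum_congr rfl fun j hj => hmin j (mem_range.1 hj)
  rw [sum_range_succ, sum_range_succ, h3] at h1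
  have h2 := Nat.find_spec hex
  omega

theorem LexLT.irrefl (a : YoungDiagram) : ¬ LexLT a a := by
  rintro ⟨_, i, _, h⟩
  exact lt_irrefl _ h

theorem LexLT.trans {a b c : YoungDiagram} (h : LexLT a b) (h' : LexLT b c) : LexLT a c := by
  obtain ⟨h0, i, h1, h2⟩ := h
  obtain ⟨h0', i', h1', h2'⟩ := h'
  refine ⟨h0.trans h0', min i i', fun j hj => ?_, ?_⟩
  · rw [h1 j (hj.trans_le (min_le_left _ _)), h1' j (hj.trans_le (min_le_right _ _))]
  · rcases lt_trichotomy i i' with hi | hi | hi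
    · rw [min_eq_left hi.le, ← h1' i hi]; exact h2
    · subst hi; rw [min_self]; exact h2.trans h2'
    · rw [min_eq_right hi.le, h1 i' hi]; exact h2'

theorem LexLT.trichotomy {a b : YoungDiagram} (hc : a.card = b.card) :
    LexLT a b ∨ a = b ∨ LexLT b a := by
  classical
  by_cases hne : a = b
  · exact Or.inr (Or.inl hne)
  have hex : ∃ i, a.rowLen i ≠ b.rowLen i := by
    by_contra! hcon
    exact hne (rowLen_ext hcon)
  have hmin : ∀ j < Nat.find hex, a.rowLen j = b.rowLen j := fun j hj => by
    simpa using Nat.find_min hex hj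
  rcases lt_or_gt_of_ne (Nat.find_spec hex) with h | h
  · exact Or.inl ⟨hc, _, hmin, h⟩
  · exact Or.inr (Or.inr ⟨hc.symm, _, fun j hj => (hmin j hj).symm, h⟩)

theorem finite_lexLT (lam : YoungDiagram) : {mu | LexLT mu lam}.Finite :=
  (finite_card_eq lam.card).subset fun _ h => h.1

theorem wellFounded_lexLT : WellFounded LexLT := by
  refine Subrelation.wf (r := InvImage (· < ·) fun a => Set.ncard {mu | LexLT mu a}) ?_
    (InvImage.wf _ wellFounded_lt)
  intro a b h
  apply Set.ncard_lt_ncard _ (finite_lexLT b)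
  exact ⟨fun c hc => LexLT.trans hc h, fun hs => LexLT.irrefl a (hs h)⟩

theorem sum_range_colLen {lam : YoungDiagram} {n : ℕ} (hn : lam.colLen 0 ≤ n) (l : ℕ) :
    ∑ j ∈ range l, lam.colLen j = ∑ i ∈ range n, min (lam.rowLen i) l := by
  have h1 : ∀ j, lam.colLen j = ∑ i ∈ range n, if j < lam.rowLen i then 1 else 0 := by
    intro j
    rw [sum_boole, Nat.cast_id]
    have : filter (fun i => j < lam.rowLen i) (range n) = range (lam.colLen j) := by
      ext i
      simp only [mem_filter, mem_range, ← YoungDiagram.mem_iff_lt_rowLen,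
        YoungDiagram.mem_iff_lt_colLen]
      have := lam.colLen_anti 0 j (Nat.zero_le j)
      omega
    rw [this, card_range]
  simp_rw [h1]
  rw [sum_comm]
  refine sum_congr rfl fun i _ => ?_
  rw [sum_boole, Nat.cast_id]
  have : filter (fun j => j < lam.rowLen i) (range l) = range (min (lam.rowLen i) l) := by
    ext j
    simp only [mem_filter, mem_range]
    omega
  rw [this, card_range]

/-- The sum of the first l columns is Σ min(λ_i, l) = |λ| - Σ max(λ_i - l, 0), and Σ max(λ_i - l, 0)
is the maximum over k of λ_1 + ⋯ + λ_k - k l, which grows with dominance. -/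
theorem DomLE.transpose {mu lam : YoungDiagram} (h : DomLE mu lam) (hc : mu.card = lam.card) :
    DomLE lam.transpose mu.transpose := by
  intro l
  simp_rw [YoungDiagram.rowLen_transpose]
  set n := max (mu.colLen 0) (lam.colLen 0) with hn
  rw [sum_range_colLen (le_max_right (mu.colLen 0) (lam.colLen 0)),
    sum_range_colLen (le_max_left (mu.colLen 0) (lam.colLen 0)), ← hn]
  have hsum : ∀ nu : YoungDiagram, nu.colLen 0 ≤ n →
      ∑ i ∈ range n, min (nu.rowLen i) l + ∑ i ∈ range n, (nu.rowLen i - l) = nu.card := by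
    intro nu hnu
    rw [← sum_add_distrib, ← sum_range_rowLen hnu]
    exact sum_congr rfl fun i _ => by omega
  have h1 := hsum mu (le_max_left _ _)
  have h2 := hsum lam (le_max_right _ _)
  have h3 : ∑ i ∈ range n, (mu.rowLen i - l) ≤ ∑ i ∈ range n, (lam.rowLen i - l) := by
    -- These are the rows of μ longer than l, where subtracting l is exact, so k attains the maximum
    -- for μ. For λ truncated subtraction only enlarges the sum.
    set k := min n (mu.colLen l) with hk
    have e1 : ∑ i ∈ range n, (mu.rowLen i - l) = ∑ i ∈ range k, (mu.rowLen i - l) := by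
      symm
      apply sum_subset (by simp [hk])
      intro i hi hi'
      have : ¬ (i, l) ∈ mu := by
        rw [YoungDiagram.mem_iff_lt_colLen]
        simp only [mem_range] at hi hi'
        omega
      rw [YoungDiagram.mem_iff_lt_rowLen] at this
      omega
    have e2 : ∑ i ∈ range k, (mu.rowLen i - l) + k * l = ∑ i ∈ range k, mu.rowLen i := by
      rw [show k * l = ∑ i ∈ range k, l by simp, ← sum_add_distrib]
      refine sum_congr rfl fun i hi => ?_
      have : (i, l) ∈ mu := by
        rw [YoungDiagram.mem_iff_lt_colLen]
        simp only [mem_range] at hi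
        omega
      rw [YoungDiagram.mem_iff_lt_rowLen] at this
      omega
    have e3 : ∑ i ∈ range k, lam.rowLen i ≤ ∑ i ∈ range k, (lam.rowLen i - l) + k * l := by
      rw [show k * l = ∑ i ∈ range k, l by simp, ← sum_add_distrib]
      exact sum_le_sum fun i _ => by omega
    have e4 : ∑ i ∈ range k, (lam.rowLen i - l) ≤ ∑ i ∈ range n, (lam.rowLen i - l) :=
      sum_le_sum_of_subset (by simp [hk])
    have := h k
    omega
  omega

end Diagrams

end Macdonald

namespace Macdonald

open MvPolynomial Finset

/-! ### Exponential generating series -/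

section ExpSeries

variable {R : Type*} [CommRing R] [Algebra ℂ R]

/-- The coefficients of `exp (∑ k, c_k s ^ (k + 1) / (k + 1))`. -/
noncomputable def expCoeff (c : ℕ → R) : ℕ → R
  | 0 => 1
  | r + 1 => ((r : ℂ) + 1)⁻¹ • ∑ k : Fin (r + 1), c k * expCoeff c (r - k)

@[simp]
theorem expCoeff_zero (c : ℕ → R) : expCoeff c 0 = 1 := by rw [expCoeff]

theorem expCoeff_succ (c : ℕ → R) (r : ℕ) :
    ((r : ℂ) + 1) • expCoeff c (r + 1) = ∑ k ∈ range (r + 1), c k * expCoeff c (r - k) := by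
  rw [expCoeff, smul_smul, mul_inv_cancel₀ (by exact_mod_cast Nat.succ_ne_zero r), one_smul,
    Finset.sum_range]

theorem natCast_smul_expCoeff (c : ℕ → R) (m : ℕ) :
    (m : ℂ) • expCoeff c m = ∑ k ∈ range m, c k * expCoeff c (m - 1 - k) := by
  rcases m with _ | m
  · simp
  · rw [Nat.cast_succ, expCoeff_succ]
    rfl

theorem map_expCoeff {S : Type*} [CommRing S] [Algebra ℂ S] (φ : R →ₐ[ℂ] S) (c : ℕ → R) (r : ℕ) :
    φ (expCoeff c r) = expCoeff (fun k => φ (c k)) r := by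
  induction r using Nat.strong_induction_on with
  | _ r ih =>
    rcases r with _ | r
    · simp
    · have h0 : ((r : ℂ) + 1) ≠ 0 := by exact_mod_cast Nat.succ_ne_zero r
      apply smul_right_injective S h0
      simp only
      rw [expCoeff_succ, ← map_smul, expCoeff_succ, map_sum]
      refine sum_congr rfl fun k _ => ?_
      rw [map_mul, ih _ (by omega)]

/-- The generating series of `expCoeff`. -/
noncomputable def expSeries (c : ℕ → R) : PowerSeries R := PowerSeries.mk (expCoeff c)

theorem derivative_expSeries (c : ℕ → R) :
    PowerSeries.derivative R (expSeries c) = PowerSeries.mk c * expSeries c := by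
  ext r
  rw [PowerSeries.coeff_derivative, PowerSeries.coeff_mul, expSeries, PowerSeries.coeff_mk]
  simp only [PowerSeries.coeff_mk]
  rw [Nat.sum_antidiagonal_eq_sum_range_succ (fun i j => c i * expCoeff c j), ← expCoeff_succ,
    Algebra.smul_def]
  simp [mul_comm]

/-- The equation F' = c F with F(0) = 1 has a single solution, its recursion being divisible by r +
1 over ℂ. Multiplicativity and the linear factors below are all obtained by checking this equation,
so no logarithm of a series is needed. -/
theorem eq_expSeries (c : ℕ → R) (F : PowerSeries R) (h0 : PowerSeries.coeff 0 F = 1)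
    (h : PowerSeries.derivative R F = PowerSeries.mk c * F) : F = expSeries c := by
  ext r
  rw [expSeries, PowerSeries.coeff_mk]
  induction r using Nat.strong_induction_on with
  | _ r ih =>
    rcases r with _ | r
    · rw [h0, expCoeff_zero]
    · have hne : ((r : ℂ) + 1) ≠ 0 := by exact_mod_cast Nat.succ_ne_zero r
      apply smul_right_injective R hne
      simp only
      rw [expCoeff_succ]
      have h1 := congrArg (PowerSeries.coeff r) h
      rw [PowerSeries.coeff_derivative, PowerSeries.coeff_mul] at h1
      simp only [PowerSeries.coeff_mk] at h1
      rw [Nat.sum_antidiagonal_eq_sum_range_succ (fun i j => c i * PowerSeries.coeff j F)] at h1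
      rw [Algebra.smul_def, mul_comm, map_add, map_natCast, map_one, h1]
      refine sum_congr rfl fun k _ => ?_
      rw [ih _ (by omega)]

theorem expSeries_add (c c' : ℕ → R) : expSeries (c + c') = expSeries c * expSeries c' := by
  symm
  apply eq_expSeries
  · rw [PowerSeries.coeff_mul]
    simp [expSeries]
  · rw [Derivation.leibniz, derivative_expSeries, derivative_expSeries, smul_eq_mul, smul_eq_mul]
    have : PowerSeries.mk (c + c') = PowerSeries.mk c + PowerSeries.mk c' := by
      ext; simp
    rw [this]
    ring

theorem expSeries_zero : expSeries (0 : ℕ → R) = 1 := by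
  symm
  apply eq_expSeries
  · simp
  · have : PowerSeries.mk (0 : ℕ → R) = 0 := by ext; simp
    rw [this]
    simp

theorem expSeries_sum {ι : Type*} (s : Finset ι) (c : ι → ℕ → R) :
    expSeries (∑ i ∈ s, c i) = ∏ i ∈ s, expSeries (c i) := by
  classical
  induction s using Finset.induction_on with
  | empty => simp [expSeries_zero]
  | insert i s hi ih => rw [sum_insert hi, prod_insert hi, expSeries_add, ih]

theorem expSeries_neg_geom (u : R) :
    expSeries (fun k => -u ^ (k + 1)) = 1 - PowerSeries.C u * PowerSeries.X := by
  symm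
  apply eq_expSeries
  · simp
  · have h : PowerSeries.derivative R (1 - PowerSeries.C u * PowerSeries.X) = -PowerSeries.C u := by
      simp [Derivation.leibniz]
    rw [h, mul_sub, mul_one, ← mul_assoc]
    ext r
    rcases r with _ | r
    · simp
    · rw [map_sub, PowerSeries.coeff_succ_mul_X, mul_comm _ (PowerSeries.C u),
        PowerSeries.coeff_C_mul]
      simp [pow_succ']

end ExpSeries

/-! ### The scalar product and its dual pair of bases -/

section Form

/-- The power sum `p_{k+1}`. -/
noncomputable def powerSum (k : ℕ) : SymFun := X k.succPNat

/-- The ratio `(1 - q ^ k) / (1 - t ^ k)`. -/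
noncomputable def ratio (q t : ℂ) (k : ℕ) : ℂ := (1 - q ^ k) / (1 - t ^ k)

theorem one_sub_pow_ne_zero {q : ℂ} (hq : ‖q‖ < 1) {k : ℕ} (hk : k ≠ 0) : 1 - q ^ k ≠ 0 := by
  intro h
  have h1 : ‖q ^ k‖ < 1 := by
    rw [norm_pow]
    exact pow_lt_one₀ (norm_nonneg _) hq hk
  rw [← sub_eq_zero.1 h] at h1
  simp at h1

theorem ratio_ne_zero {q t : ℂ} (hq : ‖q‖ < 1) (ht : ‖t‖ < 1) {k : ℕ} (hk : k ≠ 0) :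
    ratio q t k ≠ 0 :=
  div_ne_zero (one_sub_pow_ne_zero hq hk) (one_sub_pow_ne_zero ht hk)

theorem ratio_mul_ratio {q t : ℂ} (hq : ‖q‖ < 1) (ht : ‖t‖ < 1) {k : ℕ} (hk : k ≠ 0) :
    ratio q t k * ratio t q k = 1 := by
  have h1 := one_sub_pow_ne_zero hq hk
  have h2 := one_sub_pow_ne_zero ht hk
  rw [ratio, ratio]
  field_simp

theorem powerSumNorm_zero (q t : ℂ) : powerSumNorm q t 0 = 1 := by simp [powerSumNorm]

theorem powerSumNorm_add_single (q t : ℂ) (d : ℕ+ →₀ ℕ) (k : ℕ+) :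
    powerSumNorm q t (d + Finsupp.single k 1) =
      powerSumNorm q t d * (ratio q t k * k * (d k + 1)) := by
  rw [powerSumNorm, powerSumNorm, ← Finsupp.mul_prod_erase' d k _ (by simp),
    ← Finsupp.mul_prod_erase' (d + Finsupp.single k 1) k _ (by simp)]
  have : Finsupp.erase k (d + Finsupp.single k 1) = Finsupp.erase k d := by
    simp [Finsupp.erase_add]
  rw [this]
  simp only [Finsupp.add_apply, Finsupp.single_eq_same, pow_succ, Nat.factorial_succ,
    Nat.cast_mul, Nat.cast_add, Nat.cast_one, ratio]
  ring

theorem powerSumNorm_ne_zero {q t : ℂ} (hq : ‖q‖ < 1) (ht : ‖t‖ < 1) (d : ℕ+ →₀ ℕ) :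
    powerSumNorm q t d ≠ 0 := by
  rw [powerSumNorm, Finsupp.prod, prod_ne_zero_iff]
  intro k _
  have h1 := ratio_ne_zero hq ht k.ne_zero
  rw [ratio] at h1
  have h2 : ((k : ℕ) : ℂ) ≠ 0 := by exact_mod_cast k.ne_zero
  have h3 : ((d k).factorial : ℂ) ≠ 0 := by exact_mod_cast Nat.factorial_ne_zero _
  exact mul_ne_zero (pow_ne_zero _ h1) (mul_ne_zero (pow_ne_zero _ h2) h3)

theorem scalarProduct_eq_sum (q t : ℂ) (f g : SymFun) (S : Finset (ℕ+ →₀ ℕ)) (h : f.support ⊆ S) :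
    scalarProduct q t f g = ∑ d ∈ S, f.coeff d * g.coeff d * powerSumNorm q t d := by
  rw [scalarProduct]
  apply sum_subset h
  intro d _ hd
  rw [notMem_support_iff.1 hd]
  ring

theorem scalarProduct_comm (q t : ℂ) (f g : SymFun) :
    scalarProduct q t f g = scalarProduct q t g f := by
  rw [scalarProduct_eq_sum q t f g (f.support ∪ g.support) subset_union_left,
    scalarProduct_eq_sum q t g f (f.support ∪ g.support) subset_union_right]
  exact sum_congr rfl fun d _ => by ring

/-- The scalar product as a bilinear map. -/
noncomputable def form (q t : ℂ) : SymFun →ₗ[ℂ] SymFun →ₗ[ℂ] ℂ :=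
  LinearMap.mk₂ ℂ (scalarProduct q t)
    (by
      intro f f' g
      rw [scalarProduct_eq_sum q t f g (f.support ∪ f'.support) subset_union_left,
        scalarProduct_eq_sum q t f' g (f.support ∪ f'.support) subset_union_right,
        scalarProduct_eq_sum q t (f + f') g (f.support ∪ f'.support) support_add,
        ← sum_add_distrib]
      exact sum_congr rfl fun d _ => by rw [coeff_add]; ring)
    (by
      intro c f g
      rw [scalarProduct_eq_sum q t (c • f) g f.support support_smul, scalarProduct, smul_eq_mul,
        mul_sum]
      exact sum_congr rfl fun d _ => by rw [coeff_smul, smul_eq_mul]; ring)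
    (by
      intro f g g'
      rw [scalarProduct, scalarProduct, scalarProduct, ← sum_add_distrib]
      exact sum_congr rfl fun d _ => by rw [coeff_add]; ring)
    (by
      intro c f g
      rw [scalarProduct, scalarProduct, smul_eq_mul, mul_sum]
      exact sum_congr rfl fun d _ => by rw [coeff_smul, smul_eq_mul]; ring)

theorem form_apply (q t : ℂ) (f g : SymFun) : form q t f g = scalarProduct q t f g := rfl

theorem form_comm (q t : ℂ) (f g : SymFun) : form q t f g = form q t g f :=
  scalarProduct_comm q t f g

theorem form_monomial (q t : ℂ) (d : ℕ+ →₀ ℕ) (a : ℂ) (g : SymFun) :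
    form q t (monomial d a) g = a * g.coeff d * powerSumNorm q t d := by
  rw [form_apply, scalarProduct_eq_sum q t _ g {d} support_monomial_subset]
  simp

theorem form_eq_zero {q t : ℂ} (hq : ‖q‖ < 1) (ht : ‖t‖ < 1) {f : SymFun}
    (h : ∀ g, form q t g f = 0) : f = 0 := by
  ext d
  have h1 := h (monomial d 1)
  rw [form_monomial, one_mul] at h1
  simpa [powerSumNorm_ne_zero hq ht d] using h1

/-- Raising the multiplicity m of k by one multiplies the norm of the monomial by `ratio q t k` · k
· (m + 1), and the factor m + 1 is what differentiation produces. This adjointness drives the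
duality of g and m, the reproducing kernel, and the passage from Pieri coefficients to skew
functions. -/
theorem form_X_mul (q t : ℂ) (k : ℕ+) (f g : SymFun) :
    form q t (X k * f) g = ratio q t k * k * form q t f (pderiv k g) := by
  induction f using MvPolynomial.induction_on' with
  | monomial d a =>
    have : (X k * monomial d a : SymFun) = monomial (d + Finsupp.single k 1) a := by
      rw [X, monomial_mul, one_mul, add_comm]
    rw [this, form_monomial, form_monomial, powerSumNorm_add_single, coeff_pderiv]
    ring
  | add f f' h h' =>
    rw [mul_add, map_add, map_add, LinearMap.add_apply, LinearMap.add_apply, h, h']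
    ring

/-- Differentiating exp(Σ a_j p_{j+1} s^{j+1}/(j+1)) in p_{k+1} multiplies it by a_k s^{k+1}/(k+1);
the lemma is the coefficient of s^r. -/
theorem pderiv_expCoeff (a : ℕ → ℂ) (k r : ℕ) :
    pderiv k.succPNat (expCoeff (fun j => a j • powerSum j) r) =
      if k + 1 ≤ r then (a k / (k + 1)) • expCoeff (fun j => a j • powerSum j) (r - (k + 1))
      else 0 := by
  induction r using Nat.strong_induction_on with
  | _ r ih =>
    rcases r with _ | r
    · simp
    set E := expCoeff (fun j => a j • powerSum j) with hE
    have hne : ((r : ℂ) + 1) ≠ 0 := by exact_mod_cast Nat.succ_ne_zero r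
    have hk : ((k : ℂ) + 1) ≠ 0 := by exact_mod_cast Nat.succ_ne_zero k
    apply smul_right_injective SymFun hne
    simp only
    rw [← Derivation.map_smul, expCoeff_succ, map_sum]
    simp_rw [Derivation.leibniz, smul_eq_mul]
    rw [sum_add_distrib]
    have h1 : ∑ x ∈ range (r + 1), E (r - x) * pderiv k.succPNat (a x • powerSum x) =
        if k + 1 ≤ r + 1 then a k • E (r - k) else 0 := by
      have : ∀ x, E (r - x) * pderiv k.succPNat (a x • powerSum x) =
          if x = k then a k • E (r - k) else 0 := by
        intro x
        rw [Derivation.map_smul, powerSum, pderiv_X, Pi.single_apply]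
        by_cases hx : x = k
        · subst hx; simp
        · rw [if_neg (fun h => hx (Nat.succPNat_injective h)), if_neg hx]
          simp
      simp_rw [this]
      rw [sum_ite_eq']
      simp
    have h2 : ∑ x ∈ range (r + 1), a x • powerSum x * pderiv k.succPNat (E (r - x)) =
        if k + 1 ≤ r + 1 then (a k / (k + 1) * (r - k : ℕ)) • E (r - k) else 0 := by
      split_ifs with hkr
      · rw [mul_smul, natCast_smul_expCoeff, smul_sum]
        have hsub : range (r - k) ⊆ range (r + 1) := by
          intro x; simp only [mem_range]; omega
        rw [← sum_subset hsub]
        · refine sum_congr rfl fun x hx => ?_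
          rw [mem_range] at hx
          rw [ih _ (by omega), if_pos (by omega), mul_smul_comm,
            show r - x - (k + 1) = r - k - 1 - x by omega]
        · intro x hx hx'
          simp only [mem_range] at hx hx'
          rw [ih _ (by omega), if_neg (by omega), mul_zero]
      · apply sum_eq_zero
        intro x hx
        rw [ih _ (by omega), if_neg (by omega), mul_zero]
    rw [show (∑ x ∈ range (r + 1), a x • powerSum x *
      pderiv k.succPNat (expCoeff (fun j => a j • powerSum j) (r - x))) = _ from h2, h1]
    split_ifs with hkr
    · rw [← add_smul, smul_smul, show r + 1 - (k + 1) = r - k by omega]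
      congr 1
      rw [Nat.cast_sub (by omega)]
      field_simp
      ring
    · simp

/-- The functions `g_r(q,t)`, with `∑ r, g_r s ^ r = exp (∑ k, (1 - t ^ k)/(1 - q ^ k) p_k s^k/k)`. -/
noncomputable def gFun (q t : ℂ) : ℕ → SymFun :=
  expCoeff fun k => ratio t q (k + 1) • powerSum k

theorem gFun_zero (q t : ℂ) : gFun q t 0 = 1 := expCoeff_zero _

theorem pderiv_gFun (q t : ℂ) (k : ℕ+) (r : ℕ) :
    pderiv k (gFun q t r) =
      if (k : ℕ) ≤ r then (ratio t q k / k) • gFun q t (r - k) else 0 := by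
  obtain ⟨j, rfl⟩ : ∃ j : ℕ, k = j.succPNat := ⟨k.natPred, by simp⟩
  rw [gFun, pderiv_expCoeff (fun j => ratio t q (j + 1))]
  simp

theorem coeff_zero_gFun (q t : ℂ) (r : ℕ) :
    coeff 0 (gFun q t r) = if r = 0 then 1 else 0 := by
  have h1 : coeff 0 (gFun q t r) =
      (aeval (fun _ => (0 : ℂ)) : SymFun →ₐ[ℂ] ℂ) (gFun q t r) := by
    rw [aeval_zero', constantCoeff_eq]
    rfl
  rw [h1, gFun, map_expCoeff]
  rcases r with _ | r
  · simp
  · have : ((r : ℂ) + 1) ≠ 0 := by exact_mod_cast Nat.succ_ne_zero r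
    apply smul_right_injective ℂ this
    simp only
    rw [expCoeff_succ]
    simp [powerSum]

theorem derivation_prod {A : Type*} [CommRing A] [Algebra ℂ A] (D : Derivation ℂ A A)
    {ι : Type*} [DecidableEq ι] (s : Finset ι) (f : ι → A) :
    D (∏ i ∈ s, f i) = ∑ i ∈ s, (∏ j ∈ s.erase i, f j) * D (f i) := by
  induction s using Finset.induction_on with
  | empty => simp
  | insert a s ha ih =>
    rw [prod_insert ha, Derivation.leibniz, ih, sum_insert ha, erase_insert ha, smul_eq_mul,
      smul_eq_mul, add_comm, mul_sum]
    congr 1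
    refine sum_congr rfl fun i hi => ?_
    rw [erase_insert_of_ne (by rintro rfl; exact ha hi), prod_insert (by simp [ha])]
    ring

theorem toPoly_X (σ : Type) [Fintype σ] (k : ℕ+) : toPoly σ (X k) = psum σ ℂ (k : ℕ) := by
  simp [toPoly]

/-- Duality of the g and the monomials. Moving a factor p_k across the form differentiates the
product of g's, which lowers one index by k; on the other side, multiplying f by Σ x_i^k lowers one
exponent of the coefficient by k. The two recursions agree. -/
theorem form_prod_gFun {q t : ℂ} (hq : ‖q‖ < 1) (ht : ‖t‖ < 1) {n : ℕ} (α : Fin n →₀ ℕ)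
    (f : SymFun) :
    form q t (∏ i, gFun q t (α i)) f = coeff α (toPoly (Fin n) f) := by
  induction f using MvPolynomial.induction_on generalizing α with
  | C a =>
    rw [form_comm, C_apply, form_monomial, powerSumNorm_zero, mul_one]
    have h1 : coeff 0 (∏ i, gFun q t (α i)) = if α = 0 then (1 : ℂ) else 0 := by
      rw [← constantCoeff_eq, map_prod, constantCoeff_eq]
      simp_rw [coeff_zero_gFun]
      split_ifs with h
      · simp [h]
      · obtain ⟨i, hi⟩ : ∃ i, α i ≠ 0 := by
          by_contra! hc
          exact h (Finsupp.ext hc)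
        exact prod_eq_zero (mem_univ i) (if_neg hi)
    rw [← C_apply, algHom_C, algebraMap_eq, coeff_C, h1]
    simp [eq_comm]
  | add f g hf hg => rw [map_add, map_add, coeff_add, hf, hg]
  | mul_X f k hf =>
    have hk : ((k : ℕ) : ℂ) ≠ 0 := by exact_mod_cast k.ne_zero
    have h1 : ∀ i, (∏ j ∈ univ.erase i, gFun q t (α j)) * pderiv k (gFun q t (α i)) =
        if (k : ℕ) ≤ α i then (ratio t q k / k) • ∏ j, gFun q t ((α - Finsupp.single i (k : ℕ)) j)
        else 0 := by
      intro i
      rw [pderiv_gFun]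
      split_ifs with h
      · rw [mul_smul_comm, ← prod_erase_mul univ _ (mem_univ i)]
        congr 2
        · refine prod_congr rfl fun j hj => ?_
          rw [Finsupp.tsub_apply, Finsupp.single_eq_of_ne (ne_of_mem_erase hj), Nat.sub_zero]
        · simp
      · simp
    rw [form_comm, mul_comm f, form_X_mul, form_comm, map_mul, toPoly_X, psum, sum_mul, coeff_sum,
      derivation_prod, map_sum, LinearMap.sum_apply, mul_sum]
    refine sum_congr rfl fun i _ => ?_
    rw [h1, X_pow_eq_monomial, coeff_monomial_mul']
    simp only [Finsupp.single_le_iff]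
    split_ifs with h
    · rw [map_smul, LinearMap.smul_apply, hf, smul_eq_mul, ← mul_assoc]
      congr 1
      rw [mul_div_assoc', div_eq_iff hk, mul_right_comm, ratio_mul_ratio hq ht k.ne_zero]
    · simp

end Form

end Macdonald

namespace Macdonald

open MvPolynomial Finset

/-! ### Symmetric polynomials and their coefficients at partitions -/

section Coefficients

noncomputable scoped instance : DecidableEq YoungDiagram := Classical.decEq _

/-- The exponent vector `(λ₁, …, λ_n)`. -/
noncomputable def expo (n : ℕ) (lam : YoungDiagram) : Fin n →₀ ℕ :=
  Finsupp.equivFunOnFinite.symm fun i => lam.rowLen i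

@[simp]
theorem expo_apply (n : ℕ) (lam : YoungDiagram) (i : Fin n) : expo n lam i = lam.rowLen i := rfl

theorem exists_perm_expo {n : ℕ} (α : Fin n →₀ ℕ) :
    ∃ (nu : YoungDiagram) (σ : Equiv.Perm (Fin n)), nu.colLen 0 ≤ n ∧
      α = (expo n nu).mapDomain σ := by
  set σ := Fin.revPerm.trans (Tuple.sort α) with hσ
  have hanti : Antitone (α ∘ σ) := by
    intro i j hij
    exact Tuple.monotone_sort α (Fin.rev_le_rev.2 hij)
  set f : ℕ → ℕ := fun i => if h : i < n then α (σ ⟨i, h⟩) else 0 with hf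
  have hfa : Antitone f := by
    intro i j hij
    simp only [hf]
    split_ifs with h1 h2
    · exact hanti (show (⟨i, h2⟩ : Fin n) ≤ ⟨j, h1⟩ from hij)
    · omega
    · exact Nat.zero_le _
    · exact le_rfl
  have hfn : f n = 0 := by simp [hf]
  refine ⟨ofAntitone f hfa n, σ, ?_, ?_⟩
  · rw [← rowLen_eq_zero_iff, rowLen_ofAntitone _ _ _ hfn, hfn]
  · ext i
    obtain ⟨j, rfl⟩ := σ.surjective i
    rw [Finsupp.mapDomain_apply σ.injective, expo_apply, rowLen_ofAntitone _ _ _ hfn]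
    simp [hf]

theorem isSymmetric_coeff {n : ℕ} {f : MvPolynomial (Fin n) ℂ} (hf : f.IsSymmetric)
    (α : Fin n →₀ ℕ) (σ : Equiv.Perm (Fin n)) : coeff (α.mapDomain σ) f = coeff α f := by
  conv_lhs => rw [← hf σ]
  exact coeff_rename_mapDomain _ σ.injective _ _

theorem isSymmetric_ext {n : ℕ} {f g : MvPolynomial (Fin n) ℂ} (hf : f.IsSymmetric)
    (hg : g.IsSymmetric)
    (h : ∀ nu : YoungDiagram, nu.colLen 0 ≤ n → coeff (expo n nu) f = coeff (expo n nu) g) :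
    f = g := by
  ext α
  obtain ⟨nu, σ, hnu, rfl⟩ := exists_perm_expo α
  rw [isSymmetric_coeff hf, isSymmetric_coeff hg, h nu hnu]

theorem isSymmetric_toPoly (σ : Type) [Fintype σ] (f : SymFun) : (toPoly σ f).IsSymmetric := by
  induction f using MvPolynomial.induction_on with
  | C a => rw [algHom_C]; exact IsSymmetric.C a
  | add f g hf hg => rw [map_add]; exact hf.add hg
  | mul_X f k hf => rw [map_mul, toPoly_X]; exact hf.mul (psum_isSymmetric _ _ _)

theorem isSymmetric_monomialSymm (n : ℕ) (lam : YoungDiagram) :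
    (monomialSymm n lam).IsSymmetric :=
  msymm_isSymmetric _ _ _

theorem coeff_monomialSymm {n : ℕ} (lam : YoungDiagram) (α : Fin n →₀ ℕ) :
    coeff α (monomialSymm n lam) =
      if α.support.val.map α = (lam.rowLens : Multiset ℕ) then 1 else 0 := by
  have hprod : ∀ s : Multiset (Fin n),
      (s.map (X : Fin n → MvPolynomial (Fin n) ℂ)).prod = monomial (Multiset.toFinsupp s) 1 := by
    intro s
    induction s using Multiset.induction_on with
    | empty => simp
    | cons a s ih =>
      rw [Multiset.map_cons, Multiset.prod_cons, ih, ← Multiset.singleton_add, map_add,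
        Multiset.toFinsupp_singleton, X, monomial_mul, one_mul]
  have hshape : ∀ s : Sym (Fin n) lam.card,
      (Nat.Partition.ofSym s).parts =
        (Multiset.toFinsupp s.1).support.val.map (Multiset.toFinsupp s.1) := by
    intro s
    simp only [Nat.Partition.ofSym, Multiset.toFinsupp_support, Multiset.toFinset_val]
    refine Multiset.map_congr rfl fun x _ => ?_
    simp
  rw [monomialSymm, msymm, coeff_sum]
  simp_rw [Sym.val_eq_coe, hprod, coeff_monomial]
  split_ifs with h
  · have hcard : (Finsupp.toMultiset α).card = lam.card := by
      rw [Finsupp.card_toMultiset, Finsupp.sum, Finset.sum]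
      simp only [id]
      rw [h, Multiset.sum_coe, sum_rowLens]
    have hs : Nat.Partition.ofSym (Sym.mk (Finsupp.toMultiset α) hcard) =
        toPartition lam := by
      ext1
      rw [hshape]
      have : Multiset.toFinsupp (Sym.mk (Finsupp.toMultiset α) hcard).1 = α :=
        Finsupp.toMultiset_toFinsupp α
      rw [this]
      exact h
    rw [Finset.sum_eq_single ⟨Sym.mk (Finsupp.toMultiset α) hcard, hs⟩]
    · rw [if_pos]
      exact Finsupp.toMultiset_toFinsupp α
    · rintro ⟨s, h2⟩ _ hne
      rw [if_neg]
      intro h3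
      apply hne
      apply Subtype.ext
      apply Subtype.ext
      change s.1 = Finsupp.toMultiset α
      rw [← h3]
      exact (Multiset.toFinsupp_toMultiset _).symm
    · simp
  · apply sum_eq_zero
    rintro ⟨s, h2⟩ _
    rw [if_neg]
    intro h3
    apply h
    have := hshape s
    rw [h2] at this
    rw [← h3]
    exact this.symm

theorem shape_expo {n : ℕ} {nu : YoungDiagram} (h : nu.colLen 0 ≤ n) :
    (expo n nu).support.val.map (expo n nu) = (nu.rowLens : Multiset ℕ) := by
  have h1 : (expo n nu).support.map Fin.valEmbedding = range (nu.colLen 0) := by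
    ext i
    simp only [mem_map, Finsupp.mem_support_iff, expo_apply, Fin.valEmbedding_apply, mem_range,
      ne_eq, rowLen_eq_zero_iff, not_le]
    constructor
    · rintro ⟨j, hj, rfl⟩
      exact hj
    · intro hi
      exact ⟨⟨i, by omega⟩, hi, rfl⟩
  have h2 : (expo n nu).support.val.map (expo n nu) =
      ((expo n nu).support.map Fin.valEmbedding).val.map nu.rowLen := by
    rw [Finset.map_val, Multiset.map_map]
    rfl
  rw [h2, h1]
  rfl

theorem rowLens_injective {a b : YoungDiagram}
    (h : (a.rowLens : Multiset ℕ) = (b.rowLens : Multiset ℕ)) : a = b := by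
  have h1 : a.rowLens = b.rowLens :=
    (Multiset.coe_eq_coe.1 h).eq_of_sortedGE a.rowLens_sorted b.rowLens_sorted
  apply rowLen_ext
  intro i
  have hl : a.colLen 0 = b.colLen 0 := by
    rw [← YoungDiagram.length_rowLens, ← YoungDiagram.length_rowLens, h1]
  by_cases hi : i < a.colLen 0
  · have ha : i < a.rowLens.length := by rwa [YoungDiagram.length_rowLens]
    have hb : i < b.rowLens.length := by rwa [YoungDiagram.length_rowLens, ← hl]
    have e1 := YoungDiagram.get_rowLens (h := ha)
    have e2 := YoungDiagram.get_rowLens (h := hb)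
    rw [← e1, ← e2]
    simp [h1]
  · rw [rowLen_eq_zero_iff.2 (not_lt.1 hi), rowLen_eq_zero_iff.2 (by omega)]

theorem coeff_expo_monomialSymm {n : ℕ} {nu : YoungDiagram} (h : nu.colLen 0 ≤ n)
    (lam : YoungDiagram) :
    coeff (expo n nu) (monomialSymm n lam) = if nu = lam then 1 else 0 := by
  rw [coeff_monomialSymm, shape_expo h]
  by_cases hc : nu = lam
  · subst hc; simp
  · rw [if_neg hc, if_neg fun h => hc (rowLens_injective h)]

end Coefficients

/-! ### The grading and the coefficients of monomial functions -/

section Weights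

/-- Homogeneity of symmetric functions. -/
def IsHomog (f : SymFun) (d : ℕ) : Prop := IsWeightedHomogeneous (fun k : ℕ+ => (k : ℕ)) f d

theorem isHomog_powerSum (k : ℕ) : IsHomog (powerSum k) (k + 1) := by
  have := isWeightedHomogeneous_X ℂ (fun k : ℕ+ => (k : ℕ)) k.succPNat
  exact this

theorem IsHomog.smul {f : SymFun} {d : ℕ} (h : IsHomog f d) (a : ℂ) : IsHomog (a • f) d := by
  rw [smul_eq_C_mul]
  exact IsWeightedHomogeneous.C_mul h a

theorem IsHomog.add {f g : SymFun} {d : ℕ} (h : IsHomog f d) (h' : IsHomog g d) :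
    IsHomog (f + g) d := IsWeightedHomogeneous.add h h'

theorem IsHomog.sub {f g : SymFun} {d : ℕ} (h : IsHomog f d) (h' : IsHomog g d) :
    IsHomog (f - g) d := IsWeightedHomogeneous.sub h h'

theorem IsHomog.sum {ι : Type*} {s : Finset ι} {f : ι → SymFun} {d : ℕ}
    (h : ∀ i ∈ s, IsHomog (f i) d) : IsHomog (∑ i ∈ s, f i) d :=
  IsWeightedHomogeneous.sum s f d h

theorem IsHomog.mul {f g : SymFun} {d e : ℕ} (h : IsHomog f d) (h' : IsHomog g e) :
    IsHomog (f * g) (d + e) := IsWeightedHomogeneous.mul h h'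

theorem isHomog_expCoeff (a : ℕ → ℂ) (r : ℕ) :
    IsHomog (expCoeff (fun k => a k • powerSum k) r) r := by
  induction r using Nat.strong_induction_on with
  | _ r ih =>
    rcases r with _ | r
    · rw [expCoeff_zero]; exact isWeightedHomogeneous_one _ _
    · rw [expCoeff]
      apply IsHomog.smul
      apply IsHomog.sum
      intro k _
      have h1 := ((isHomog_powerSum k).smul (a k)).mul (ih (r - k) (by omega))
      rwa [show (k : ℕ) + 1 + (r - k) = r + 1 by omega] at h1

theorem form_eq_zero_of_ne (q t : ℂ) {f g : SymFun} {d e : ℕ} (hf : IsHomog f d)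
    (hg : IsHomog g e) (h : d ≠ e) : form q t f g = 0 := by
  rw [form_apply, scalarProduct]
  apply sum_eq_zero
  intro m hm
  have h1 := hf (mem_support_iff.1 hm)
  have : coeff m g = 0 := by
    by_contra hc
    exact h (h1.symm.trans (hg hc))
  rw [this]
  ring

/-- The products `g_{λ₁} g_{λ₂} ⋯`. -/
noncomputable def gPart (q t : ℂ) (lam : YoungDiagram) : SymFun :=
  ∏ i ∈ range (lam.colLen 0), gFun q t (lam.rowLen i)

theorem prod_range_gFun (q t : ℂ) {lam : YoungDiagram} {n : ℕ} (h : lam.colLen 0 ≤ n) :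
    ∏ i ∈ range n, gFun q t (lam.rowLen i) = gPart q t lam := by
  symm
  apply prod_subset (by simpa using h)
  intro i _ hi
  rw [rowLen_eq_zero_iff.2 (by simpa using hi), gFun_zero]

theorem isHomog_gPart (q t : ℂ) (lam : YoungDiagram) : IsHomog (gPart q t lam) lam.card := by
  rw [← sum_range_colLen_zero]
  exact IsWeightedHomogeneous.prod _ _ _ fun i _ => isHomog_expCoeff _ _

/-- The coefficient of `m_ν` in a symmetric function. -/
noncomputable def mCoeff (nu : YoungDiagram) : SymFun →ₗ[ℂ] ℂ := form 0 0 (gPart 0 0 nu)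

theorem form_gPart_eq_coeff {q t : ℂ} (hq : ‖q‖ < 1) (ht : ‖t‖ < 1) {n : ℕ} {nu : YoungDiagram}
    (h : nu.colLen 0 ≤ n) (f : SymFun) :
    form q t (gPart q t nu) f = coeff (expo n nu) (toPoly (Fin n) f) := by
  rw [← form_prod_gFun hq ht, ← prod_range_gFun q t h, Finset.prod_range]
  rfl

theorem mCoeff_eq_coeff {n : ℕ} {nu : YoungDiagram} (h : nu.colLen 0 ≤ n) (f : SymFun) :
    mCoeff nu f = coeff (expo n nu) (toPoly (Fin n) f) :=
  form_gPart_eq_coeff (by simp) (by simp) h f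

/-- Both sides are the same polynomial coefficient. This is why `mCoeff` may be defined once, with
parameters 0, and used for all q and t. -/
theorem form_gPart {q t : ℂ} (hq : ‖q‖ < 1) (ht : ‖t‖ < 1) (nu : YoungDiagram) (f : SymFun) :
    form q t (gPart q t nu) f = mCoeff nu f := by
  rw [form_gPart_eq_coeff hq ht le_rfl, mCoeff_eq_coeff le_rfl]

theorem mCoeff_eq_zero {nu : YoungDiagram} {f : SymFun} {d : ℕ} (hf : IsHomog f d)
    (h : nu.card ≠ d) : mCoeff nu f = 0 :=
  form_eq_zero_of_ne _ _ (isHomog_gPart _ _ _) hf h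

end Weights

/-! ### Algebraic independence of power sums, and m_λ in Λ -/

section Injectivity

/-- The kernels of the iterates increase and hence stabilize; an element of ker f written as f^n y
puts y in ker f^(n+1) = ker f^n. -/
theorem injective_of_surjective_of_noetherian {A : Type*} [CommRing A] [IsNoetherianRing A]
    (f : A →+* A) (hf : Function.Surjective f) : Function.Injective f := by
  have hs : ∀ n, Function.Surjective (f^[n]) := fun n => hf.iterate n
  have hpow : ∀ n x, (f ^ n : A →+* A) x = f^[n] x := fun n x => by
    rw [RingHom.coe_pow]
  obtain ⟨n, hn⟩ := monotone_stabilizes_iff_noetherian.2 ‹IsNoetherianRing A›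
    ⟨fun n => RingHom.ker (f ^ n : A →+* A), monotone_nat_of_le_succ fun n x hx => by
      rw [RingHom.mem_ker, hpow] at hx ⊢
      rw [Function.iterate_succ_apply', hx, map_zero]⟩
  rw [injective_iff_map_eq_zero]
  intro x hx
  obtain ⟨y, rfl⟩ := hs n x
  have h1 : y ∈ RingHom.ker (f ^ (n + 1) : A →+* A) := by
    rw [RingHom.mem_ker, hpow, Function.iterate_succ_apply', hx]
  have h2 := hn (n + 1) (Nat.le_succ n)
  simp only [OrderHom.coe_mk] at h2
  rw [← h2, RingHom.mem_ker, hpow] at h1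
  exact h1

theorem esymm_mem_range_psum (n k : ℕ) (hk : k ≤ n) :
    esymm (Fin n) ℂ k ∈
      (aeval fun i : Fin n => psum (Fin n) ℂ ((i : ℕ) + 1) :
        MvPolynomial (Fin n) ℂ →ₐ[ℂ] MvPolynomial (Fin n) ℂ).range := by
  induction k using Nat.strong_induction_on with
  | _ k ih =>
    rcases Nat.eq_zero_or_pos k with rfl | hpos
    · rw [esymm_zero]; exact one_mem _
    · set A := (aeval fun i : Fin n => psum (Fin n) ℂ ((i : ℕ) + 1) :
        MvPolynomial (Fin n) ℂ →ₐ[ℂ] MvPolynomial (Fin n) ℂ).range with hA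
      have h1 := mul_esymm_eq_sum (Fin n) ℂ k
      have hk0 : (k : ℂ) ≠ 0 := by exact_mod_cast hpos.ne'
      have h2 : (k : ℂ) • esymm (Fin n) ℂ k ∈ A := by
        rw [show (k : ℂ) • esymm (Fin n) ℂ k = (k : MvPolynomial (Fin n) ℂ) * esymm (Fin n) ℂ k by
          rw [smul_eq_C_mul]; simp, h1]
        have hneg : (-1 : MvPolynomial (Fin n) ℂ) ∈ A := A.neg_mem A.one_mem
        refine A.mul_mem (A.pow_mem hneg _) (A.sum_mem fun a ha => ?_)
        simp only [mem_filter, HasAntidiagonal.mem_antidiagonal] at ha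
        refine A.mul_mem (A.mul_mem (A.pow_mem hneg _) (ih _ ha.2 (by omega))) ?_
        refine ⟨X ⟨a.2 - 1, by omega⟩, ?_⟩
        simp [show a.2 - 1 + 1 = a.2 by omega]
      have h3 := A.smul_mem h2 (k : ℂ)⁻¹
      rwa [smul_smul, inv_mul_cancel₀ hk0, one_smul] at h3

theorem exists_aeval_psum {n : ℕ} {f : MvPolynomial (Fin n) ℂ} (hf : f.IsSymmetric) :
    ∃ g : MvPolynomial (Fin n) ℂ, aeval (fun i : Fin n => psum (Fin n) ℂ ((i : ℕ) + 1)) g = f := by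
  obtain ⟨g, hg'⟩ : ∃ g, aeval (fun i : Fin n => esymm (Fin n) ℂ ((i : ℕ) + 1)) g = f := by
    obtain ⟨g, hg⟩ := (esymmAlgEquiv (Fin n) ℂ (Fintype.card_fin n)).surjective ⟨f, hf⟩
    have := congrArg Subtype.val hg
    rw [esymmAlgEquiv_apply, esymmAlgHom_apply] at this
    exact ⟨g, this⟩
  clear hf
  rw [← hg']
  clear hg'
  change _ ∈ (aeval _ : MvPolynomial (Fin n) ℂ →ₐ[ℂ] MvPolynomial (Fin n) ℂ).range
  induction g using MvPolynomial.induction_on with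
  | C a => rw [algHom_C]; exact Subalgebra.algebraMap_mem _ a
  | add f g hf hg => rw [map_add]; exact Subalgebra.add_mem _ hf hg
  | mul_X f i hf =>
    rw [map_mul]
    refine Subalgebra.mul_mem _ hf ?_
    rw [aeval_X]
    exact esymm_mem_range_psum n _ i.2

/-- By Newton's identities p_1, …, p_n generate the symmetric polynomials, which form a polynomial
ring in e_1, …, e_n. Substituting power sums is thus a surjective endomorphism of a Noetherian ring.
-/
theorem injective_aeval_psum (n : ℕ) :
    Function.Injective (aeval fun i : Fin n => psum (Fin n) ℂ ((i : ℕ) + 1) :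
        MvPolynomial (Fin n) ℂ →ₐ[ℂ] MvPolynomial (Fin n) ℂ) := by
  set φ := (aeval fun i : Fin n => psum (Fin n) ℂ ((i : ℕ) + 1) :
        MvPolynomial (Fin n) ℂ →ₐ[ℂ] MvPolynomial (Fin n) ℂ) with hφ
  have hsym : ∀ g, φ g ∈ symmetricSubalgebra (Fin n) ℂ := by
    intro g
    induction g using MvPolynomial.induction_on with
    | C a => rw [algHom_C]; exact IsSymmetric.C a
    | add f g hf hg => rw [map_add]; exact Subalgebra.add_mem _ hf hg
    | mul_X f i hf =>
      rw [map_mul]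
      refine Subalgebra.mul_mem _ hf ?_
      rw [hφ, aeval_X]
      exact psum_isSymmetric _ _ _
  set e := esymmAlgEquiv (Fin n) ℂ (Fintype.card_fin n) with he
  set ψ := e.symm.toAlgHom.comp (φ.codRestrict _ hsym) with hψ
  have hsurj : Function.Surjective ψ := by
    intro g
    obtain ⟨h, hh⟩ := exists_aeval_psum (e g).2
    refine ⟨h, ?_⟩
    rw [hψ]
    change e.symm (φ.codRestrict _ hsym h) = g
    rw [AlgEquiv.symm_apply_eq]
    exact Subtype.ext hh
  have hinj := injective_of_surjective_of_noetherian ψ.toRingHom hsurj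
  intro a b hab
  apply hinj
  have : φ.codRestrict _ hsym a = φ.codRestrict _ hsym b := Subtype.ext hab
  change e.symm (φ.codRestrict _ hsym a) = e.symm (φ.codRestrict _ hsym b)
  rw [this]

/-- An f involves finitely many p_k, so it can be tested in a number of variables exceeding all
these k, and also exceeding any prescribed N. -/
theorem toPoly_injective {f : SymFun} {N : ℕ} (h : ∀ n, N ≤ n → toPoly (Fin n) f = 0) : f = 0 := by
  obtain ⟨M, hM⟩ : ∃ M, ∀ k ∈ f.vars, (k : ℕ) ≤ M :=
    ⟨f.vars.sup (fun k => (k : ℕ)), fun k hk => le_sup (f := fun k : ℕ+ => (k : ℕ)) hk⟩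
  set n := max N M with hn
  set ι : Fin n → ℕ+ := fun i => (i : ℕ).succPNat with hι
  have hmem : f ∈ supported ℂ (Set.range ι) := by
    rw [mem_supported]
    intro k hk
    have h1 := hM k hk
    have h2 := k.pos
    exact ⟨⟨k.natPred, by
      have := PNat.natPred_add_one k
      omega⟩, by simp [hι]⟩
  have hιinj : Function.Injective ι := fun i j hij =>
    Fin.ext (Nat.succPNat_injective hij)
  obtain ⟨g, rfl⟩ : ∃ g, rename ι g = f := by
    rw [supported_eq_range_rename] at hmem
    obtain ⟨g, rfl⟩ := hmem
    refine ⟨rename (Equiv.ofInjective ι hιinj).symm g, ?_⟩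
    rw [rename_rename]
    have : ι ∘ (Equiv.ofInjective ι hιinj).symm = Subtype.val := by
      ext x
      simp [Equiv.apply_ofInjective_symm]
    rw [this]
    rfl
  have h1 := h n (le_max_left _ _)
  rw [toPoly, aeval_rename] at h1
  have h2 : g = 0 := by
    apply injective_aeval_psum n
    rw [map_zero]
    exact h1
  rw [h2, map_zero]

theorem mCoeff_ext {f : SymFun} (h : ∀ nu, mCoeff nu f = 0) : f = 0 := by
  apply toPoly_injective (N := 0)
  intro n _
  apply isSymmetric_ext (isSymmetric_toPoly _ _) IsSymmetric.zero
  intro nu hnu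
  rw [← mCoeff_eq_coeff hnu, h]
  simp

theorem IsHomog.eq_zero {f : SymFun} {d n : ℕ} (hf : IsHomog f d) (hn : d ≤ n)
    (h : toPoly (Fin n) f = 0) : f = 0 := by
  apply mCoeff_ext
  intro nu
  by_cases hnu : nu.card = d
  · rw [mCoeff_eq_coeff (n := n) ((colLen_zero_le_card nu).trans (by omega)), h]
    simp
  · exact mCoeff_eq_zero hf hnu

theorem exists_monomialSymm (lam : YoungDiagram) :
    ∃ f : SymFun, IsHomog f lam.card ∧ ∀ nu, mCoeff nu f = if nu = lam then 1 else 0 := by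
  set n := lam.card with hn
  obtain ⟨g, hg⟩ := exists_aeval_psum (isSymmetric_monomialSymm n lam)
  set f0 : SymFun := rename (fun i : Fin n => (i : ℕ).succPNat) g with hf0
  have h0 : toPoly (Fin n) f0 = monomialSymm n lam := by
    rw [hf0, toPoly, aeval_rename, ← hg]
    rfl
  -- A lift from n = |λ| variables is correct only up to degree n. Cutting to degree n does not
  -- affect the pairings with g_ν for |ν| = n, and all other coefficients become zero.
  set f := weightedHomogeneousComponent (fun k : ℕ+ => (k : ℕ)) n f0 with hf
  have hfh : IsHomog f n := by
    rw [hf]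
    exact weightedHomogeneousComponent_isWeightedHomogeneous (w := fun k : ℕ+ => (k : ℕ)) n f0
  refine ⟨f, hfh, fun nu => ?_⟩
  by_cases hnu : nu.card = n
  · have hlen : nu.colLen 0 ≤ n := (colLen_zero_le_card nu).trans hnu.le
    have h1 : mCoeff nu f = mCoeff nu f0 := by
      rw [mCoeff, form_apply, form_apply, scalarProduct, scalarProduct]
      refine sum_congr rfl fun m hm => ?_
      have hw := isHomog_gPart 0 0 nu (mem_support_iff.1 hm)
      rw [hf, coeff_weightedHomogeneousComponent, if_pos (hw.trans hnu)]
    rw [h1, mCoeff_eq_coeff hlen, h0, coeff_expo_monomialSymm hlen]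
  · rw [mCoeff_eq_zero hfh hnu, if_neg (fun h => hnu (by rw [h]))]

/-- The monomial symmetric function `m_λ` as an element of `Λ`. -/
noncomputable def mon (lam : YoungDiagram) : SymFun := (exists_monomialSymm lam).choose

theorem isHomog_mon (lam : YoungDiagram) : IsHomog (mon lam) lam.card :=
  (exists_monomialSymm lam).choose_spec.1

theorem mCoeff_mon (nu lam : YoungDiagram) :
    mCoeff nu (mon lam) = if nu = lam then 1 else 0 := by
  rw [mon, (exists_monomialSymm lam).choose_spec.2]

theorem toPoly_mon (n : ℕ) (lam : YoungDiagram) : toPoly (Fin n) (mon lam) = monomialSymm n lam := by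
  apply isSymmetric_ext (isSymmetric_toPoly _ _) (isSymmetric_monomialSymm _ _)
  intro nu hnu
  rw [← mCoeff_eq_coeff hnu, mCoeff_mon, coeff_expo_monomialSymm hnu]

theorem IsHomog.eq_sum_mon {f : SymFun} {d : ℕ} (hf : IsHomog f d) :
    f = ∑ nu ∈ ofSize d, mCoeff nu f • mon nu := by
  rw [← sub_eq_zero]
  apply mCoeff_ext
  intro nu
  rw [map_sub, map_sum]
  simp_rw [map_smul, mCoeff_mon, smul_eq_mul, mul_ite, mul_one, mul_zero]
  rw [sum_ite_eq]
  by_cases h : nu.card = d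
  · rw [if_pos (mem_ofSize.2 h), sub_self]
  · rw [if_neg (by simpa using h), mCoeff_eq_zero hf h, sub_zero]

end Injectivity

end Macdonald

namespace Macdonald

open MvPolynomial Finset

/-! ### Dominance of exponents and leading terms -/

section LeadingExponents

variable {n : ℕ}

/-- The partial sums of an exponent vector. -/
def partialSum (α : Fin n →₀ ℕ) (k : ℕ) : ℕ := ∑ i : Fin n, if (i : ℕ) < k then α i else 0

theorem partialSum_add (α β : Fin n →₀ ℕ) (k : ℕ) :
    partialSum (α + β) k = partialSum α k + partialSum β k := by
  rw [partialSum, partialSum, partialSum, ← sum_add_distrib]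
  exact sum_congr rfl fun i _ => by split_ifs <;> simp

theorem partialSum_injective {α β : Fin n →₀ ℕ} (h : ∀ k, partialSum α k = partialSum β k) :
    α = β := by
  have key : ∀ (γ : Fin n →₀ ℕ) (i : Fin n), partialSum γ (i + 1) = partialSum γ i + γ i := by
    intro γ i
    rw [partialSum, partialSum, ← Finset.sum_erase_add univ _ (mem_univ i),
      ← Finset.sum_erase_add univ _ (mem_univ i)]
    simp only [lt_add_one, if_true, lt_irrefl, if_false, add_zero]
    congr 1
    refine sum_congr rfl fun j hj => ?_
    have hne : (j : ℕ) ≠ i := fun h => ne_of_mem_erase hj (Fin.ext h)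
    by_cases hji : (j : ℕ) < i
    · rw [if_pos hji, if_pos (by omega)]
    · rw [if_neg hji, if_neg (by omega)]
  ext i
  have h1 := h (i + 1)
  rw [key, key, h] at h1
  omega

/-- Dominance of exponent vectors of the same degree. -/
def ExpLE (α γ : Fin n →₀ ℕ) : Prop :=
  partialSum α n = partialSum γ n ∧ ∀ k, partialSum α k ≤ partialSum γ k

theorem ExpLE.refl (α : Fin n →₀ ℕ) : ExpLE α α := ⟨rfl, fun _ => le_rfl⟩

theorem ExpLE.add {α β γ δ : Fin n →₀ ℕ} (h : ExpLE α γ) (h' : ExpLE β δ) :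
    ExpLE (α + β) (γ + δ) := by
  refine ⟨by rw [partialSum_add, partialSum_add, h.1, h'.1], fun k => ?_⟩
  rw [partialSum_add, partialSum_add]
  exact add_le_add (h.2 k) (h'.2 k)

theorem ExpLE.of_add {α γ δ : Fin n →₀ ℕ} (h : ExpLE (δ + α) (δ + γ)) : ExpLE α γ := by
  simp only [ExpLE, partialSum_add] at h ⊢
  exact ⟨by omega, fun k => by have := h.2 k; omega⟩

/-- A sum of two maximal exponents is reached only by the maximal pair. Hence leading coefficients
multiply, although dominance is only a partial order. -/
theorem ExpLE.eq_of_add_eq {α β γ δ : Fin n →₀ ℕ} (h : ExpLE α γ) (h' : ExpLE β δ)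
    (he : α + β = γ + δ) : α = γ ∧ β = δ := by
  have : ∀ k, partialSum α k + partialSum β k = partialSum γ k + partialSum δ k := fun k => by
    rw [← partialSum_add, ← partialSum_add, he]
  exact ⟨partialSum_injective fun k => by have := this k; have := h.2 k; have := h'.2 k; omega,
    partialSum_injective fun k => by have := this k; have := h.2 k; have := h'.2 k; omega⟩

/-- All exponents of `f` are dominated by `γ`. -/
def IsLead (f : MvPolynomial (Fin n) ℂ) (γ : Fin n →₀ ℕ) : Prop :=
  ∀ α, coeff α f ≠ 0 → ExpLE α γ

/-- The weight w lets one argument serve both the product of polynomials (w = 1) and the Macdonald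
operator, which weights each pair of monomials by a scalar. -/
theorem IsLead.expLE_of_sum_ne_zero {f g : MvPolynomial (Fin n) ℂ} {γ δ κ : Fin n →₀ ℕ}
    (hf : IsLead f γ) (hg : IsLead g δ) {w : (Fin n →₀ ℕ) → (Fin n →₀ ℕ) → ℂ}
    (h : ∑ p ∈ antidiagonal κ, coeff p.1 f * coeff p.2 g * w p.1 p.2 ≠ 0) : ExpLE κ (γ + δ) := by
  obtain ⟨p, hp, hne⟩ := exists_ne_zero_of_sum_ne_zero h
  rw [← HasAntidiagonal.mem_antidiagonal.1 hp]
  exact (hf _ fun h0 => hne (by rw [h0]; ring)).add (hg _ fun h0 => hne (by rw [h0]; ring))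

theorem IsLead.sum_antidiagonal {f g : MvPolynomial (Fin n) ℂ} {γ δ : Fin n →₀ ℕ}
    (hf : IsLead f γ) (hg : IsLead g δ) (w : (Fin n →₀ ℕ) → (Fin n →₀ ℕ) → ℂ) :
    ∑ p ∈ antidiagonal (γ + δ), coeff p.1 f * coeff p.2 g * w p.1 p.2 =
      coeff γ f * coeff δ g * w γ δ := by
  rw [sum_eq_single (γ, δ)]
  · rintro p hp hne
    by_contra hc
    have h1 := hf p.1 fun h0 => hc (by rw [h0]; ring)
    have h2 := hg p.2 fun h0 => hc (by rw [h0]; ring)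
    have h3 := h1.eq_of_add_eq h2 (HasAntidiagonal.mem_antidiagonal.1 hp)
    exact hne (Prod.ext h3.1 h3.2)
  · intro h
    simp at h

theorem IsLead.mul {f g : MvPolynomial (Fin n) ℂ} {γ δ : Fin n →₀ ℕ}
    (hf : IsLead f γ) (hg : IsLead g δ) : IsLead (f * g) (γ + δ) := by
  intro κ hκ
  rw [coeff_mul] at hκ
  apply hf.expLE_of_sum_ne_zero hg (w := fun _ _ => 1)
  simpa using hκ

theorem IsLead.coeff_mul {f g : MvPolynomial (Fin n) ℂ} {γ δ : Fin n →₀ ℕ}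
    (hf : IsLead f γ) (hg : IsLead g δ) : coeff (γ + δ) (f * g) = coeff γ f * coeff δ g := by
  have := hf.sum_antidiagonal hg (fun _ _ => 1)
  simp only [mul_one] at this
  rw [MvPolynomial.coeff_mul, this]

theorem IsLead.prod {ι : Type*} (s : Finset ι) (f : ι → MvPolynomial (Fin n) ℂ)
    (γ : ι → Fin n →₀ ℕ) (h : ∀ i ∈ s, IsLead (f i) (γ i) ∧ coeff (γ i) (f i) = 1) :
    IsLead (∏ i ∈ s, f i) (∑ i ∈ s, γ i) ∧ coeff (∑ i ∈ s, γ i) (∏ i ∈ s, f i) = 1 := by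
  classical
  induction s using Finset.induction_on with
  | empty =>
    refine ⟨fun α hα => ?_, by simp⟩
    rw [prod_empty, coeff_one] at hα
    rw [sum_empty]
    have : (0 : Fin n →₀ ℕ) = α := by simpa using hα
    rw [this]
    exact ExpLE.refl _
  | insert a s ha ih =>
    have h1 := h a (mem_insert_self _ _)
    have h2 := ih fun i hi => h i (mem_insert_of_mem hi)
    rw [prod_insert ha, sum_insert ha]
    exact ⟨h1.1.mul h2.1, by rw [h1.1.coeff_mul h2.1, h1.2, h2.2, one_mul]⟩

theorem sum_le_sum_range_of_antitone {f : ℕ → ℕ} (hf : Antitone f) (S : Finset ℕ) :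
    ∑ i ∈ S, f i ≤ ∑ i ∈ range (#S), f i := by
  rw [← sum_sdiff (inter_subset_left (s₁ := S) (s₂ := range (#S))),
    ← sum_sdiff (inter_subset_right (s₁ := S) (s₂ := range (#S)))]
  apply Nat.add_le_add_right
  calc ∑ i ∈ S \ (S ∩ range (#S)), f i ≤ #(S \ (S ∩ range (#S))) • f (#S) := by
        apply sum_le_card_nsmul
        intro i hi
        apply hf
        simp only [mem_sdiff, mem_inter, mem_range, not_and, not_lt] at hi
        exact hi.2 hi.1
    _ = #(range (#S) \ (S ∩ range (#S))) • f (#S) := by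
        rw [card_sdiff_of_subset inter_subset_left, card_sdiff_of_subset inter_subset_right,
          card_range]
    _ ≤ _ := by
        apply card_nsmul_le_sum
        intro i hi
        apply hf
        simp only [mem_sdiff, mem_range] at hi
        exact hi.1.le

theorem partialSum_expo (lam : YoungDiagram) (k : ℕ) :
    partialSum (expo n lam) k = ∑ i ∈ range (min k n), lam.rowLen i := by
  rw [partialSum]
  simp only [expo_apply]
  rw [Fin.sum_univ_eq_sum_range (fun i => if i < k then lam.rowLen i else 0), ← sum_filter]
  congr 1
  ext i
  simp only [mem_filter, mem_range]
  omega

theorem expLE_mapDomain (lam : YoungDiagram) (σ : Equiv.Perm (Fin n)) :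
    ExpLE ((expo n lam).mapDomain σ) (expo n lam) := by
  constructor
  · rw [partialSum, partialSum, ← Equiv.sum_comp σ]
    simp only [Finsupp.mapDomain_apply σ.injective, Fin.is_lt, if_true]
  intro k
  rw [partialSum_expo, partialSum, ← Equiv.sum_comp σ]
  simp only [Finsupp.mapDomain_apply σ.injective, expo_apply]
  rw [← sum_filter]
  set S := ({i : Fin n | (σ i : ℕ) < k} : Finset (Fin n)) with hS
  have h1 : ∑ i ∈ S, lam.rowLen i = ∑ i ∈ S.map Fin.valEmbedding, lam.rowLen i := by
    rw [sum_map]; rfl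
  have h2 : #(S.map Fin.valEmbedding) = min k n := by
    rw [card_map]
    have : S.map σ.toEmbedding = ({i : Fin n | (i : ℕ) < k} : Finset (Fin n)) := by
      ext i
      simp only [hS, mem_map, mem_filter, mem_univ, true_and, Equiv.coe_toEmbedding]
      exact ⟨fun ⟨j, hj, h⟩ => h ▸ hj, fun h => ⟨σ.symm i, by simpa using h, by simp⟩⟩
    rw [← card_map σ.toEmbedding, this, ← card_map Fin.valEmbedding]
    have : ({i : Fin n | (i : ℕ) < k} : Finset (Fin n)).map Fin.valEmbedding =
        range (min k n) := by
      ext i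
      simp only [mem_map, mem_filter, mem_univ, true_and, Fin.valEmbedding_apply, mem_range]
      constructor
      · rintro ⟨j, hj, rfl⟩
        have := j.2
        omega
      · intro h
        exact ⟨⟨i, by omega⟩, by simp only; omega, rfl⟩
    rw [this, card_range]
  rw [h1, ← h2]
  exact sum_le_sum_range_of_antitone (fun i j => lam.rowLen_anti i j) _

theorem isLead_monomialSymm (lam : YoungDiagram) : IsLead (monomialSymm n lam) (expo n lam) := by
  intro α hα
  obtain ⟨nu, σ, hnu, rfl⟩ := exists_perm_expo α
  rw [isSymmetric_coeff (isSymmetric_monomialSymm n lam), coeff_expo_monomialSymm hnu] at hα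
  have : nu = lam := by by_contra h; simp [h] at hα
  subst this
  exact expLE_mapDomain nu σ

theorem domLE_of_expLE {mu lam : YoungDiagram} (h : ExpLE (expo n mu) (expo n lam))
    (hmu : mu.colLen 0 ≤ n) : DomLE mu lam := by
  intro k
  have h1 := h.2 k
  rw [partialSum_expo, partialSum_expo] at h1
  have h2 : ∑ i ∈ range k, mu.rowLen i = ∑ i ∈ range (min k n), mu.rowLen i := by
    symm
    apply sum_subset (by simp)
    intro i hi hi'
    simp only [mem_range] at hi hi'
    exact rowLen_eq_zero_iff.2 (by omega)
  rw [h2]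
  exact h1.trans (sum_le_sum_of_subset (by simp))

theorem card_eq_of_expLE {mu lam : YoungDiagram} (h : ExpLE (expo n mu) (expo n lam))
    (hmu : mu.colLen 0 ≤ n) (hlam : lam.colLen 0 ≤ n) : mu.card = lam.card := by
  have h1 := h.1
  rwa [partialSum_expo, partialSum_expo, min_self, sum_range_rowLen hmu,
    sum_range_rowLen hlam] at h1

end LeadingExponents

/-! ### The Vandermonde polynomial and alternating polynomials -/

section Vandermonde

variable {n : ℕ} {R : Type*} [CommRing R]

/-- The Vandermonde product `∏_{i < j} (x_i - x_j)`. -/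
def vdm (x : Fin n → R) : R := ∏ i, ∏ j ∈ Ioi i, (x i - x j)

theorem vdm_eq_det (x : Fin n → R) : vdm x = (Matrix.vandermonde fun i => -x i).det := by
  rw [Matrix.det_vandermonde, vdm]
  exact prod_congr rfl fun i _ => prod_congr rfl fun j _ => by ring

theorem vdm_comp_perm (x : Fin n → R) (σ : Equiv.Perm (Fin n)) :
    vdm (x ∘ σ) = (Equiv.Perm.sign σ : ℤ) • vdm x := by
  rw [vdm_eq_det, vdm_eq_det]
  have : (Matrix.vandermonde fun i => -(x ∘ σ) i) =
      (Matrix.vandermonde fun i => -x i).submatrix σ id := by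
    ext i j
    simp [Matrix.vandermonde_apply]
  rw [this, Matrix.det_permute, zsmul_eq_mul]

theorem map_vdm {S : Type*} [CommRing S] (φ : R →+* S) (x : Fin n → R) :
    φ (vdm x) = vdm fun i => φ (x i) := by
  simp [vdm]

theorem vdm_ne_zero_iff [IsDomain R] {x : Fin n → R} : vdm x ≠ 0 ↔ Function.Injective x := by
  rw [vdm_eq_det, Matrix.det_vandermonde_ne_zero_iff]
  exact ⟨fun h i j hij => h (by simp [hij]), fun h i j hij => h (by simpa using hij)⟩

/-- The Vandermonde polynomial. -/
noncomputable def vdmPoly (n : ℕ) : MvPolynomial (Fin n) ℂ := vdm X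

/-- The staircase exponent `(n - 1, n - 2, …, 0)`. -/
noncomputable def stair (n : ℕ) : Fin n →₀ ℕ :=
  Finsupp.equivFunOnFinite.symm fun i => n - 1 - i

@[simp]
theorem stair_apply (n : ℕ) (i : Fin n) : stair n i = n - 1 - i := rfl

theorem isLead_vdmPoly (n : ℕ) :
    IsLead (vdmPoly n) (stair n) ∧ coeff (stair n) (vdmPoly n) = 1 := by
  have h1 : ∀ i j : Fin n, i < j →
      IsLead (X i - X j : MvPolynomial (Fin n) ℂ) (Finsupp.single i 1) ∧
        coeff (Finsupp.single i 1) (X i - X j : MvPolynomial (Fin n) ℂ) = 1 := by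
    intro i j hij
    constructor
    · intro α hα
      rw [coeff_sub, coeff_X, coeff_X] at hα
      by_cases h : Finsupp.single i 1 = α
      · rw [← h]; exact ExpLE.refl _
      · by_cases h' : Finsupp.single j 1 = α
        · rw [← h']
          have key : ∀ (l : Fin n) (k : ℕ),
              partialSum (Finsupp.single l 1) k = if (l : ℕ) < k then 1 else 0 := by
            intro l k
            rw [partialSum, sum_eq_single l]
            · simp
            · intro b _ hb
              rw [Finsupp.single_eq_of_ne hb]
              simp
            · simp
          have : (i : ℕ) < j := hij
          refine ⟨by rw [key, key, if_pos i.2, if_pos j.2], fun k => ?_⟩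
          rw [key, key]
          split_ifs <;> omega
        · simp [h, h'] at hα
    · rw [coeff_sub, coeff_X, coeff_X, if_pos rfl, if_neg, sub_zero]
      intro h
      have := Finsupp.single_left_injective one_ne_zero h
      exact hij.ne this.symm
  have h2 := IsLead.prod univ (fun i : Fin n => ∏ j ∈ Ioi i, (X i - X j : MvPolynomial (Fin n) ℂ))
    (fun i => ∑ j ∈ Ioi i, Finsupp.single i 1) fun i _ =>
      IsLead.prod (Ioi i) (fun j => X i - X j) _ fun j hj => h1 i j (by simpa using hj)
  have h3 : ∑ i : Fin n, ∑ j ∈ Ioi i, Finsupp.single i 1 = stair n := by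
    ext k
    rw [Finsupp.finsetSum_apply, sum_eq_single k]
    · simp
    · intro b _ hb
      rw [Finsupp.finsetSum_apply]
      exact sum_eq_zero fun j _ => Finsupp.single_eq_of_ne hb.symm
    · simp
  rw [h3] at h2
  exact h2

theorem vdmPoly_ne_zero (n : ℕ) : vdmPoly n ≠ 0 := by
  intro h
  have := (isLead_vdmPoly n).2
  rw [h] at this
  simp at this

/-- Alternating polynomials. -/
def IsAlt (g : MvPolynomial (Fin n) ℂ) : Prop :=
  ∀ σ : Equiv.Perm (Fin n), rename σ g = (Equiv.Perm.sign σ : ℤ) • g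

theorem IsAlt.coeff_mapDomain {g : MvPolynomial (Fin n) ℂ} (hg : IsAlt g) (α : Fin n →₀ ℕ)
    (σ : Equiv.Perm (Fin n)) :
    coeff α g = (Equiv.Perm.sign σ : ℤ) • coeff (α.mapDomain σ) g := by
  rw [← coeff_rename_mapDomain σ σ.injective g α, hg σ, coeff_smul]

/-- A transposition fixing an exponent with two equal entries forces its coefficient to be its own
negative. The remaining exponents, sorted, are strictly decreasing, that is, staircase plus a
partition. -/
theorem IsAlt.eq_zero {g : MvPolynomial (Fin n) ℂ} (hg : IsAlt g)
    (h : ∀ nu : YoungDiagram, nu.colLen 0 ≤ n → coeff (stair n + expo n nu) g = 0) : g = 0 := by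
  ext α
  rw [coeff_zero]
  by_contra hα
  obtain ⟨ka, σ, hka, rfl⟩ := exists_perm_expo α
  have h1 : coeff (expo n ka) g ≠ 0 := by
    rw [hg.coeff_mapDomain _ σ]
    intro h0
    rcases Int.units_eq_one_or (Equiv.Perm.sign σ) with hs | hs <;> rw [hs] at h0 <;>
      simp at h0 <;> exact hα h0
  have hstrict : ∀ i j : Fin n, i ≠ j → ka.rowLen i ≠ ka.rowLen j := by
    intro i j hij heq
    have h2 := hg.coeff_mapDomain (expo n ka) (Equiv.swap i j)
    have h3 : (expo n ka).mapDomain (Equiv.swap i j) = expo n ka := by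
      ext k
      obtain ⟨l, rfl⟩ := (Equiv.swap i j).surjective k
      rw [Finsupp.mapDomain_apply (Equiv.swap i j).injective, expo_apply, expo_apply]
      rcases eq_or_ne l i with rfl | hli
      · rw [Equiv.swap_apply_left, heq]
      · rcases eq_or_ne l j with rfl | hlj
        · rw [Equiv.swap_apply_right, heq]
        · rw [Equiv.swap_apply_of_ne_of_ne hli hlj]
    rw [h3, Equiv.Perm.sign_swap hij] at h2
    simp only [Units.val_neg, Units.val_one, neg_smul, one_smul] at h2
    exact h1 (self_eq_neg.1 h2)
  have hdec : ∀ i, i + 1 < n → ka.rowLen (i + 1) + 1 ≤ ka.rowLen i := by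
    intro i hi
    have h2 := hstrict ⟨i, by omega⟩ ⟨i + 1, hi⟩ (by simp)
    have h3 := ka.rowLen_anti i (i + 1) (by omega)
    simp only at h2
    omega
  have hge : ∀ m, m < n → m ≤ ka.rowLen (n - 1 - m) := by
    intro m
    induction m with
    | zero => intro _; exact Nat.zero_le _
    | succ m ih =>
      intro hm
      have h2 := ih (by omega)
      have h3 := hdec (n - 1 - (m + 1)) (by omega)
      rw [show n - 1 - (m + 1) + 1 = n - 1 - m by omega] at h3
      omega
  have hanti : Antitone fun i => ka.rowLen i - (n - 1 - i) := by
    apply antitone_nat_of_succ_le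
    intro i
    have h3 := ka.rowLen_anti i (i + 1) (by omega)
    by_cases hi : i + 1 < n
    · have := hdec i hi
      omega
    · omega
  have hzero : ka.rowLen n - (n - 1 - n) = 0 := by
    rw [rowLen_eq_zero_iff.2 hka]
    simp
  set nu := ofAntitone _ hanti n with hnu
  have hrow : ∀ i, nu.rowLen i = ka.rowLen i - (n - 1 - i) := rowLen_ofAntitone _ hanti n hzero
  have hlen : nu.colLen 0 ≤ n := by
    rw [← rowLen_eq_zero_iff, hrow, hzero]
  apply h1
  have : expo n ka = stair n + expo n nu := by
    ext i
    rw [Finsupp.add_apply, stair_apply, expo_apply, expo_apply, hrow]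
    have := hge (n - 1 - i) (by omega)
    rw [show n - 1 - (n - 1 - (i : ℕ)) = i by omega] at this
    omega
  rw [this]
  exact h nu hlen

end Vandermonde

end Macdonald

namespace Macdonald

open MvPolynomial Finset

/-! ### The Macdonald operator and its eigenfunctions -/

section Operator

variable {n : ℕ}

/-- Rescaling by `a` of the variables with index in `I`. -/
noncomputable def scaleVars (a : ℂ) (I : Finset (Fin n)) :
    MvPolynomial (Fin n) ℂ →ₐ[ℂ] MvPolynomial (Fin n) ℂ :=
  aeval fun i => if i ∈ I then C a * X i else X i

theorem coeff_scaleVars (a : ℂ) (I : Finset (Fin n)) (f : MvPolynomial (Fin n) ℂ)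
    (α : Fin n →₀ ℕ) : coeff α (scaleVars a I f) = (∏ i ∈ I, a ^ α i) * coeff α f := by
  induction f using MvPolynomial.induction_on' with
  | monomial β b =>
    have : scaleVars a I (monomial β b) = monomial β ((∏ i ∈ I, a ^ β i) * b) := by
      rw [scaleVars, aeval_monomial, algebraMap_eq, monomial_eq, C_mul, mul_comm (C _) (C b),
        mul_assoc]
      congr 1
      rw [Finsupp.prod_fintype _ _ (by simp), Finsupp.prod_fintype _ _ (by simp), map_prod,
        ← Fintype.prod_ite_mem I, ← prod_mul_distrib]
      refine prod_congr rfl fun i _ => ?_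
      split_ifs
      · rw [mul_pow, map_pow]
      · rw [one_mul]
    rw [this, coeff_monomial, coeff_monomial]
    split_ifs with h
    · rw [h]
    · rw [mul_zero]
  | add f g hf hg => rw [map_add, coeff_add, coeff_add, hf, hg, mul_add]

/-- The Macdonald operator, multiplied by the Vandermonde polynomial. -/
noncomputable def macOp (q t x : ℂ) (f : MvPolynomial (Fin n) ℂ) : MvPolynomial (Fin n) ℂ :=
  ∑ I : Finset (Fin n), x ^ #I • (scaleVars t I (vdmPoly n) * scaleVars q I f)

theorem macOp_sum {ι : Type*} (q t x : ℂ) (s : Finset ι) (b : ι → ℂ)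
    (f : ι → MvPolynomial (Fin n) ℂ) :
    macOp q t x (∑ i ∈ s, b i • f i) = ∑ i ∈ s, b i • macOp q t x (f i) := by
  simp_rw [macOp, map_sum, mul_sum, smul_sum]
  rw [sum_comm]
  refine sum_congr rfl fun i _ => sum_congr rfl fun I _ => ?_
  rw [map_smul, mul_smul_comm, smul_comm]

/-- On a pair of monomials x^β from the Vandermonde and x^γ from f, the sum over subsets I factors
as ∏ (1 + x t^(β_i) q^(γ_i)). At the leading pair, staircase and λ, this product is the eigenvalue.
-/
theorem coeff_macOp (q t x : ℂ) (f : MvPolynomial (Fin n) ℂ) (κ : Fin n →₀ ℕ) :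
    coeff κ (macOp q t x f) = ∑ p ∈ antidiagonal κ, coeff p.1 (vdmPoly n) * coeff p.2 f *
      ∏ i, (1 + x * t ^ p.1 i * q ^ p.2 i) := by
  rw [macOp, coeff_sum]
  simp_rw [coeff_smul, coeff_mul, coeff_scaleVars, smul_sum]
  rw [sum_comm]
  refine sum_congr rfl fun p _ => ?_
  rw [Finset.prod_one_add, mul_sum, powerset_univ]
  refine sum_congr rfl fun I _ => ?_
  rw [prod_mul_distrib, prod_mul_distrib, prod_const, smul_eq_mul]
  ring

theorem rename_scaleVars (a : ℂ) (I : Finset (Fin n)) (σ : Equiv.Perm (Fin n))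
    (f : MvPolynomial (Fin n) ℂ) :
    rename σ (scaleVars a I f) = scaleVars a (I.map σ.toEmbedding) (rename σ f) := by
  induction f using MvPolynomial.induction_on with
  | C a => simp [scaleVars]
  | add f g hf hg => simp only [map_add, hf, hg]
  | mul_X f i hf =>
    simp only [map_mul, hf]
    congr 1
    simp only [scaleVars, aeval_X, rename_X, mem_map_equiv, Equiv.symm_apply_apply]
    split_ifs <;> simp

theorem isAlt_vdmPoly : IsAlt (vdmPoly n) := by
  intro σ
  rw [vdmPoly, ← vdm_comp_perm]
  have := map_vdm (rename σ : MvPolynomial (Fin n) ℂ →ₐ[ℂ] _).toRingHom X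
  refine this.trans ?_
  congr 1
  ext1 i
  exact rename_X _ _

theorem isAlt_macOp (q t x : ℂ) {f : MvPolynomial (Fin n) ℂ} (hf : f.IsSymmetric) :
    IsAlt (macOp q t x f) := by
  intro σ
  rw [macOp, map_sum, smul_sum]
  refine Fintype.sum_equiv (Equiv.finsetCongr σ) _ _ fun I => ?_
  rw [map_smul, map_mul, rename_scaleVars, rename_scaleVars, hf σ, isAlt_vdmPoly σ, map_zsmul,
    smul_mul_assoc, smul_comm, Equiv.finsetCongr_apply, card_map]

theorem IsAlt.mul_isSymmetric {g f : MvPolynomial (Fin n) ℂ} (hg : IsAlt g) (hf : f.IsSymmetric) :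
    IsAlt (g * f) := by
  intro σ
  rw [map_mul, hg σ, hf σ, smul_mul_assoc]

theorem IsAlt.sub_smul {g f : MvPolynomial (Fin n) ℂ} (hg : IsAlt g) (hf : IsAlt f) (c : ℂ) :
    IsAlt (g - c • f) := by
  intro σ
  rw [map_sub, map_smul, hg σ, hf σ, smul_sub, smul_comm]

/-- The eigenvalues of the Macdonald operator. -/
noncomputable def macEigen (n : ℕ) (q t x : ℂ) (lam : YoungDiagram) : ℂ :=
  ∏ i : Fin n, (1 + x * t ^ (n - 1 - i : ℕ) * q ^ lam.rowLen i)

theorem coeff_macOp_sub (q t x c : ℂ) (f : MvPolynomial (Fin n) ℂ) (κ : Fin n →₀ ℕ) :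
    coeff κ (macOp q t x f - c • (vdmPoly n * f)) =
      ∑ p ∈ antidiagonal κ, coeff p.1 (vdmPoly n) * coeff p.2 f *
        (∏ i, (1 + x * t ^ p.1 i * q ^ p.2 i) - c) := by
  rw [coeff_sub, coeff_macOp, coeff_smul, coeff_mul, smul_eq_mul, mul_sum, ← sum_sub_distrib]
  exact sum_congr rfl fun p _ => by ring

/-- A nonzero kernel vector is impossible: at a maximal index of its support only the diagonal term
survives. -/
theorem exists_solution_of_triangular {ι : Type*} [Fintype ι] [PartialOrder ι] (T : ι → ι → ℂ)
    (hT : ∀ i j, T i j ≠ 0 → i ≤ j) (hd : ∀ i, T i i ≠ 0) (v : ι → ℂ) :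
    ∃ b : ι → ℂ, ∀ i, ∑ j, T i j * b j = v i := by
  classical
  have hinj : Function.Injective (Matrix.of T).mulVecLin := by
    rw [← LinearMap.ker_eq_bot, LinearMap.ker_eq_bot']
    intro b hb
    by_contra hne
    have hS : ({i | b i ≠ 0} : Finset ι).Nonempty := by
      obtain ⟨i, hi⟩ := Function.ne_iff.1 hne
      exact ⟨i, by simpa using hi⟩
    obtain ⟨i, hi⟩ := exists_maximal hS
    have h1 := congrFun hb i
    rw [Matrix.mulVecLin_apply, Matrix.mulVec, dotProduct, sum_eq_single i] at h1
    · have h2 : b i ≠ 0 := by simpa using hi.1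
      exact (mul_ne_zero (hd i) h2) h1
    · intro j _ hji
      by_contra hc
      have h3 : T i j ≠ 0 := left_ne_zero_of_mul hc
      have h4 : b j ≠ 0 := right_ne_zero_of_mul hc
      exact hji (le_antisymm (hi.2 (by simpa using h4) (hT i j h3)) (hT i j h3))
    · simp
  obtain ⟨b, hb⟩ := LinearMap.surjective_of_injective hinj v
  exact ⟨b, fun i => congrFun hb i⟩

/-- The operator is triangular for dominance with the eigenvalues on the diagonal. Since the other
eigenvalues differ from that of λ, the correction to m_λ solves a triangular system with invertible
diagonal. -/
theorem exists_eigenfunction (q t x : ℂ) (lam : YoungDiagram) (hn : lam.card ≤ n)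
    (hsep : ∀ mu : YoungDiagram, mu.card = lam.card → mu ≠ lam →
      macEigen n q t x mu ≠ macEigen n q t x lam) :
    ∃ f : SymFun, IsHomog f lam.card ∧ mCoeff lam f = 1 ∧
      (∀ mu, mCoeff mu f ≠ 0 → DomLE mu lam) ∧
      macOp q t x (toPoly (Fin n) f) =
        macEigen n q t x lam • (vdmPoly n * toPoly (Fin n) f) := by
  classical
  have hlen : ∀ mu : YoungDiagram, mu.card = lam.card → mu.colLen 0 ≤ n := fun mu h =>
    (colLen_zero_le_card mu).trans (h.le.trans hn)
  set T : YoungDiagram → YoungDiagram → ℂ := fun nu mu =>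
    coeff (stair n + expo n nu) (macOp q t x (monomialSymm n mu) -
      macEigen n q t x lam • (vdmPoly n * monomialSymm n mu)) with hTdef
  have hT : ∀ nu mu : YoungDiagram, nu.colLen 0 ≤ n → T nu mu ≠ 0 →
      ExpLE (expo n nu) (expo n mu) := by
    intro nu mu hnu h
    rw [hTdef] at h
    simp only at h
    rw [coeff_macOp_sub] at h
    have h1 := (isLead_vdmPoly n).1.expLE_of_sum_ne_zero (isLead_monomialSymm mu)
      (w := fun a b => (∏ i, (1 + x * t ^ a i * q ^ b i) - macEigen n q t x lam)) h
    exact h1.of_add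
  have hTd : ∀ mu : YoungDiagram, mu.colLen 0 ≤ n →
      T mu mu = macEigen n q t x mu - macEigen n q t x lam := by
    intro mu hmu
    rw [hTdef]
    simp only
    rw [coeff_macOp_sub, (isLead_vdmPoly n).1.sum_antidiagonal (isLead_monomialSymm mu)
      (fun a b => (∏ i, (1 + x * t ^ a i * q ^ b i) - macEigen n q t x lam)),
      (isLead_vdmPoly n).2, coeff_expo_monomialSymm hmu, if_pos rfl]
    simp [macEigen]
  -- The unknowns are the coefficients of the m_μ with μ strictly dominated by λ; the equations are
  -- the coefficients at staircase plus ν for the same set of ν.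
  set D := (ofSize lam.card).filter (fun mu => DomLE mu lam ∧ mu ≠ lam) with hD
  have hDmem : ∀ mu, mu ∈ D ↔ mu.card = lam.card ∧ DomLE mu lam ∧ mu ≠ lam := by
    intro mu; simp [hD]
  let po : PartialOrder D :=
    { le := fun a b => DomLE a.1 b.1
      lt := fun a b => DomLE a.1 b.1 ∧ ¬ DomLE b.1 a.1
      lt_iff_le_not_ge := fun _ _ => Iff.rfl
      le_refl := fun a => DomLE.refl _
      le_trans := fun a b c => DomLE.trans
      le_antisymm := fun a b h h' => Subtype.ext (DomLE.antisymm h h') }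
  obtain ⟨b, hb⟩ := @exists_solution_of_triangular D _ po (fun i j => T i j)
    (fun i j h => domLE_of_expLE (hT i j (hlen _ ((hDmem _).1 i.2).1) h)
      (hlen _ ((hDmem _).1 i.2).1))
    (fun i => by
      have h1 := (hDmem _).1 i.2
      rw [hTd _ (hlen _ h1.1)]
      exact sub_ne_zero.2 (hsep _ h1.1 h1.2.2))
    (fun i => -T i lam)
  set f : SymFun := mon lam + ∑ j : D, b j • mon j with hf
  have hTlam : T lam lam = 0 := by rw [hTd _ (hlen _ rfl), sub_self]
  have hcoeff : ∀ mu, mCoeff mu f = (if mu = lam then 1 else 0) + ∑ j : D, if mu = j then b j else 0 := by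
    intro mu
    rw [hf, map_add, map_sum, mCoeff_mon]
    congr 1
    refine sum_congr rfl fun j _ => ?_
    rw [map_smul, mCoeff_mon, smul_eq_mul, mul_ite, mul_one, mul_zero]
  have hop : ∀ nu : YoungDiagram, coeff (stair n + expo n nu) (macOp q t x (toPoly (Fin n) f) -
      macEigen n q t x lam • (vdmPoly n * toPoly (Fin n) f)) =
      T nu lam + ∑ j : D, T nu j * b j := by
    intro nu
    have h1 : toPoly (Fin n) f = monomialSymm n lam + ∑ j : D, b j • monomialSymm n j := by
      rw [hf, map_add, map_sum, toPoly_mon]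
      congr 1
      exact sum_congr rfl fun j _ => by rw [map_smul, toPoly_mon]
    simp only [hTdef, h1]
    simp_rw [coeff_macOp_sub, coeff_add, coeff_sum, coeff_smul]
    simp_rw [mul_add, add_mul, sum_add_distrib]
    congr 1
    simp_rw [mul_sum, sum_mul]
    rw [sum_comm]
    refine sum_congr rfl fun j _ => sum_congr rfl fun p _ => ?_
    rw [smul_eq_mul]
    ring
  refine ⟨f, ?_, ?_, ?_, ?_⟩
  · apply (isHomog_mon lam).add
    apply IsHomog.sum
    intro j _
    have := (isHomog_mon j.1).smul (b j)
    rwa [((hDmem _).1 j.2).1] at this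
  · rw [hcoeff, if_pos rfl, sum_eq_zero, add_zero]
    intro j _
    rw [if_neg fun h => ((hDmem _).1 j.2).2.2 h.symm]
  · intro mu h
    by_cases h1 : mu = lam
    · rw [h1]; exact DomLE.refl _
    · rw [hcoeff, if_neg h1, zero_add] at h
      obtain ⟨j, _, hj⟩ := exists_ne_zero_of_sum_ne_zero h
      have : mu = j := by by_contra hc; simp [hc] at hj
      rw [this]
      exact ((hDmem _).1 j.2).2.1
  · rw [← sub_eq_zero]
    -- The defect of the eigenvalue equation is alternating, so only its coefficients at staircase
    -- plus partition have to be checked.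
    have halt : IsAlt (macOp q t x (toPoly (Fin n) f) -
        macEigen n q t x lam • (vdmPoly n * toPoly (Fin n) f)) :=
      (isAlt_macOp _ _ _ (isSymmetric_toPoly _ _)).sub_smul
        (isAlt_vdmPoly.mul_isSymmetric (isSymmetric_toPoly _ _)) _
    apply halt.eq_zero
    intro nu hnu
    rw [hop]
    by_cases h1 : nu ∈ D
    · rw [hb ⟨nu, h1⟩, add_neg_cancel]
    -- Outside D no equation was imposed, but none is needed: by triangularity a nonzero entry would
    -- put ν strictly below λ. At ν = λ the diagonal entry vanishes by the choice of eigenvalue.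
    · have hno : ∀ mu : YoungDiagram, mu.card = lam.card → DomLE mu lam → mu ≠ nu →
          T nu mu = 0 := by
        intro mu hmu hle hne
        by_contra hc
        have h2 := hT nu mu hnu hc
        have h3 := domLE_of_expLE h2 hnu
        have h4 := card_eq_of_expLE h2 hnu (hlen _ hmu)
        refine h1 ((hDmem _).2 ⟨h4.trans hmu, h3.trans hle, ?_⟩)
        rintro rfl
        exact hne (hle.antisymm h3)
      rw [sum_eq_zero, add_zero]
      · by_cases h2 : lam = nu
        · rw [← h2, hTlam]
        · exact hno lam rfl (DomLE.refl _) h2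
      · intro j _
        have h2 := (hDmem _).1 j.2
        rw [hno j h2.1 h2.2.1 (fun h => h1 (h ▸ j.2)), zero_mul]

end Operator

end Macdonald

namespace Macdonald

open MvPolynomial Finset

/-! ### Separation of partitions by eigenvalues -/

section Separation

/-- As a polynomial in x the eigenvalue determines the set of numbers t^(n-1-i) q^(λ_i) through its
roots. Their moduli increase strictly with i, so the set of moduli determines the sequence, and then
each |q|^(λ_i) and λ_i. This uses q ≠ 0 and t ≠ 0. -/
theorem macEigen_injective {n : ℕ} {q t : ℂ} (hq0 : q ≠ 0) (ht0 : t ≠ 0) (hq : ‖q‖ < 1)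
    (ht : ‖t‖ < 1) {lam mu : YoungDiagram} (hlam : lam.colLen 0 ≤ n) (hmu : mu.colLen 0 ≤ n)
    (h : ∀ x, macEigen n q t x lam = macEigen n q t x mu) : lam = mu := by
  set y : YoungDiagram → Fin n → ℂ := fun nu i => t ^ (n - 1 - i : ℕ) * q ^ nu.rowLen i with hy
  have hy0 : ∀ nu i, y nu i ≠ 0 := fun nu i => mul_ne_zero (pow_ne_zero _ ht0) (pow_ne_zero _ hq0)
  have hmono : ∀ nu, StrictMono fun i => ‖y nu i‖ := by
    intro nu i j hij
    simp only [hy, norm_mul, norm_pow]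
    have h1 : ‖t‖ ^ (n - 1 - i : ℕ) < ‖t‖ ^ (n - 1 - j : ℕ) := by
      apply pow_lt_pow_right_of_lt_one₀ (norm_pos_iff.2 ht0) ht
      have : (i : ℕ) < j := hij
      omega
    have h2 : ‖q‖ ^ nu.rowLen i ≤ ‖q‖ ^ nu.rowLen j :=
      pow_le_pow_of_le_one (norm_nonneg _) hq.le (nu.rowLen_anti i j (le_of_lt hij))
    exact mul_lt_mul h1 h2 (pow_pos (norm_pos_iff.2 hq0) _) (by positivity)
  have hsub : ∀ a b : YoungDiagram, (∀ x, macEigen n q t x a = macEigen n q t x b) →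
      Set.range (fun i => ‖y a i‖) ⊆ Set.range fun i => ‖y b i‖ := by
    rintro a b hab _ ⟨i, rfl⟩
    have h1 : macEigen n q t (-(y a i)⁻¹) a = 0 := by
      apply prod_eq_zero (mem_univ i)
      rw [mul_assoc]
      change 1 + -(y a i)⁻¹ * y a i = 0
      field_simp [hy0 a i]
      ring
    rw [hab, macEigen, prod_eq_zero_iff] at h1
    obtain ⟨j, _, hj⟩ := h1
    refine ⟨j, ?_⟩
    rw [mul_assoc] at hj
    change 1 + -(y a i)⁻¹ * y b j = 0 at hj
    have h2 := hy0 a i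
    have h3 : y b j = y a i := by
      field_simp at hj
      linear_combination -hj
    simp only [h3]
  have heq := (StrictMono.range_inj (hmono lam) (hmono mu)).1
    ((hsub _ _ h).antisymm (hsub _ _ fun x => (h x).symm))
  apply rowLen_ext
  intro i
  by_cases hi : i < n
  · have h1 := congrFun heq ⟨i, hi⟩
    simp only [hy, norm_mul, norm_pow] at h1
    have h2 := mul_left_cancel₀ (pow_ne_zero _ (norm_ne_zero_iff.2 ht0)) h1
    exact pow_right_injective₀ (norm_pos_iff.2 hq0) hq.ne h2
  · rw [rowLen_eq_zero_iff.2 (by omega), rowLen_eq_zero_iff.2 (by omega)]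

theorem finite_macEigen_eq {n : ℕ} {q t : ℂ} {lam mu : YoungDiagram}
    (h : ∃ x, macEigen n q t x lam ≠ macEigen n q t x mu) :
    {x | macEigen n q t x lam = macEigen n q t x mu}.Finite := by
  set P : YoungDiagram → Polynomial ℂ := fun nu =>
    ∏ i : Fin n, (1 + Polynomial.X * Polynomial.C (t ^ (n - 1 - i : ℕ)) *
      Polynomial.C (q ^ nu.rowLen i)) with hP
  have heval : ∀ nu x, (P nu).eval x = macEigen n q t x nu := by
    intro nu x
    simp [hP, macEigen, Polynomial.eval_prod]
  have hne : P lam - P mu ≠ 0 := by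
    obtain ⟨x, hx⟩ := h
    intro h0
    apply hx
    rw [← heval, ← heval, sub_eq_zero.1 h0]
  refine (P lam - P mu).roots.toFinset.finite_toSet.subset ?_
  intro x hx
  simp only [Set.mem_ofPred_eq] at hx
  simp [hne, heval, hx]

/-- All but finitely many parameters separate the partitions of `d`. -/
theorem finite_not_separating {n d : ℕ} {q t : ℂ} (hq0 : q ≠ 0) (ht0 : t ≠ 0) (hq : ‖q‖ < 1)
    (ht : ‖t‖ < 1) (hd : d ≤ n) :
    {x | ∃ lam ∈ ofSize d, ∃ mu ∈ ofSize d, lam ≠ mu ∧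
      macEigen n q t x lam = macEigen n q t x mu}.Finite := by
  have : {x | ∃ lam ∈ ofSize d, ∃ mu ∈ ofSize d, lam ≠ mu ∧
      macEigen n q t x lam = macEigen n q t x mu} ⊆
      ⋃ p ∈ ((ofSize d ×ˢ ofSize d).filter fun p => p.1 ≠ p.2),
        {x | macEigen n q t x p.1 = macEigen n q t x p.2} := by
    rintro x ⟨lam, hlam, mu, hmu, hne, hx⟩
    simp only [Set.mem_iUnion]
    exact ⟨(lam, mu), by simp only [mem_filter, mem_product]; exact ⟨⟨hlam, hmu⟩, hne⟩, hx⟩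
  refine Set.Finite.subset (Set.Finite.biUnion (finite_toSet _) fun p hp => ?_) this
  simp only [coe_filter, mem_product, Set.mem_ofPred_eq, mem_ofSize] at hp
  apply finite_macEigen_eq
  by_contra! hc
  exact hp.2 (macEigen_injective hq0 ht0 hq ht
    ((colLen_zero_le_card _).trans (hp.1.1.le.trans hd))
    ((colLen_zero_le_card _).trans (hp.1.2.le.trans hd)) hc)

end Separation

/-! ### The Cauchy determinant and the symmetry of the Macdonald sum -/

section Cauchy

variable {n : ℕ} {F : Type*} [Field F]

/-- Rescaling by `a` of the coordinates with index in `I`. -/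
def scalePt {R : Type*} [CommRing R] (a : R) (I : Finset (Fin n)) (x : Fin n → R) : Fin n → R :=
  fun i => if i ∈ I then a * x i else x i

/-- The coefficients of the polynomials `∏_{k ≠ j} (1 + w y_k)`. -/
noncomputable def cauchyCoeff (y : Fin n → F) : Matrix (Fin n) (Fin n) F :=
  Matrix.of fun i j => (∏ k ∈ univ.erase j, (1 + Polynomial.X * Polynomial.C (y k))).coeff i

theorem vdm_mul_det_cauchyCoeff (u y : Fin n → F) :
    vdm u * (cauchyCoeff y).det =
      (Matrix.of fun i j => ∏ k ∈ univ.erase j, (1 - u i * y k)).det := by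
  rw [vdm_eq_det, ← Matrix.det_mul]
  congr 1
  ext i j
  rw [Matrix.mul_apply]
  have hdeg : (∏ k ∈ univ.erase j, (1 + Polynomial.X * Polynomial.C (y k))).natDegree < n := by
    refine (Polynomial.natDegree_prod_le _ _).trans_lt ?_
    calc ∑ k ∈ univ.erase j, (1 + Polynomial.X * Polynomial.C (y k)).natDegree
        ≤ ∑ k ∈ univ.erase j, 1 := by
          refine sum_le_sum fun k _ => ?_
          compute_degree
      _ < n := by
          have := j.2
          simp
          omega
  have h1 := Polynomial.eval_eq_sum_range' hdeg (-u i)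
  rw [Polynomial.eval_prod] at h1
  simp only [Matrix.of_apply, cauchyCoeff, Matrix.vandermonde_apply]
  rw [Finset.sum_range] at h1
  calc _ = _ := sum_congr rfl fun k _ => mul_comm _ _
    _ = _ := h1.symm
    _ = _ := prod_congr rfl fun k _ => by simp; ring

theorem det_cauchyCoeff_ne_zero {y : Fin n → F} (hy : Function.Injective y) (h0 : ∀ i, y i ≠ 0) :
    (cauchyCoeff y).det ≠ 0 := by
  -- At u_i = 1/y_i the matrix of products is diagonal, because every off-diagonal product contains
  -- the factor 1 - y_i⁻¹ y_i.
  apply right_ne_zero_of_mul (a := vdm fun i => (y i)⁻¹)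
  rw [vdm_mul_det_cauchyCoeff]
  have : (Matrix.of fun i j => ∏ k ∈ univ.erase j, (1 - (y i)⁻¹ * y k)) =
      Matrix.diagonal fun i => ∏ k ∈ univ.erase i, (1 - (y i)⁻¹ * y k) := by
    ext i j
    rw [Matrix.of_apply]
    by_cases hij : i = j
    · subst hij; rw [Matrix.diagonal_apply_eq]
    · rw [Matrix.diagonal_apply_ne _ hij]
      apply prod_eq_zero (mem_erase.2 ⟨hij, mem_univ i⟩)
      rw [inv_mul_cancel₀ (h0 i), sub_self]
  rw [this, Matrix.det_diagonal, prod_ne_zero_iff]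
  intro i _
  rw [prod_ne_zero_iff]
  intro k hk hc
  apply ne_of_mem_erase hk
  apply hy
  have := h0 i
  field_simp at hc
  linear_combination -hc

theorem det_cauchy {x y : Fin n → F} (h : ∀ i j, 1 - x i * y j ≠ 0) :
    (Matrix.of fun i j => (1 - x i * y j)⁻¹).det * ∏ i, ∏ j, (1 - x i * y j) =
      vdm x * (cauchyCoeff y).det := by
  rw [vdm_mul_det_cauchyCoeff, mul_comm, ← Matrix.det_mul_column]
  congr 1
  ext i j
  rw [Matrix.of_apply, Matrix.of_apply, Matrix.of_apply, ← prod_erase_mul univ _ (mem_univ j),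
    mul_assoc, mul_inv_cancel₀ (h i j), mul_one]

/-- The determinant is multilinear in the rows: expanding each row of the sum on the right chooses
the subset I of rows taken from the first summand. -/
theorem sum_det_cauchy (X t : F) (x y : Fin n → F) :
    ∑ I : Finset (Fin n), X ^ #I * (Matrix.of fun i j => (1 - scalePt t I x i * y j)⁻¹).det =
      (Matrix.of fun i j => X * (1 - t * x i * y j)⁻¹ + (1 - x i * y j)⁻¹).det := by
  have h1 := (Matrix.detRowAlternating (n := Fin n) (R := F)).toMultilinearMap.map_add_univ
    (fun i => X • fun j => (1 - t * x i * y j)⁻¹) (fun i j => (1 - x i * y j)⁻¹)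
  refine Eq.trans ?_ h1.symm
  refine sum_congr rfl fun I _ => ?_
  have h2 := (Matrix.detRowAlternating (n := Fin n) (R := F)).toMultilinearMap.map_piecewise_smul
    (fun _ => X) (I.piecewise (fun i j => (1 - t * x i * y j)⁻¹) (fun i j => (1 - x i * y j)⁻¹)) I
  have h3 : I.piecewise (fun i => X • fun j => (1 - t * x i * y j)⁻¹)
      (fun i j => (1 - x i * y j)⁻¹) = I.piecewise (fun i => X •
        (I.piecewise (fun i j => (1 - t * x i * y j)⁻¹) (fun i j => (1 - x i * y j)⁻¹)) i)
        (I.piecewise (fun i j => (1 - t * x i * y j)⁻¹) (fun i j => (1 - x i * y j)⁻¹)) := by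
    ext i j
    by_cases hi : i ∈ I <;> simp [hi]
  rw [h3]
  refine Eq.trans ?_ h2.symm
  rw [prod_const, smul_eq_mul]
  congr 2
  ext i j
  by_cases hi : i ∈ I <;> simp [hi, scalePt]

/-- The sum over subsets that occurs in the action of the Macdonald operator on the kernel. -/
noncomputable def cauchySum (X t : F) (x y : Fin n → F) : F :=
  ∑ I : Finset (Fin n), X ^ #I * (vdm (scalePt t I x) *
    ∏ i ∈ I, ∏ j, ((1 - x i * y j) / (1 - t * x i * y j)))

theorem cauchySum_mul_det (X t : F) {x y : Fin n → F} (h : ∀ i j, 1 - x i * y j ≠ 0)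
    (h' : ∀ i j, 1 - t * x i * y j ≠ 0) :
    (cauchyCoeff y).det * cauchySum X t x y = (∏ i, ∏ j, (1 - x i * y j)) *
      (Matrix.of fun i j => X * (1 - t * x i * y j)⁻¹ + (1 - x i * y j)⁻¹).det := by
  rw [← sum_det_cauchy, cauchySum, mul_sum, mul_sum]
  refine sum_congr rfl fun I _ => ?_
  have hI : ∀ i j, 1 - scalePt t I x i * y j ≠ 0 := by
    intro i j
    by_cases hi : i ∈ I <;> simp only [scalePt, hi, if_true, if_false]
    · exact h' i j
    · exact h i j
  have h1 := det_cauchy hI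
  have h2 : (∏ i ∈ I, ∏ j, ((1 - x i * y j) / (1 - t * x i * y j))) *
      ∏ i, ∏ j, (1 - scalePt t I x i * y j) = ∏ i, ∏ j, (1 - x i * y j) := by
    rw [← Fintype.prod_ite_mem I, ← prod_mul_distrib]
    refine prod_congr rfl fun i _ => ?_
    by_cases hi : i ∈ I
    · simp only [scalePt, hi, if_true]
      rw [← prod_mul_distrib]
      exact prod_congr rfl fun j _ => div_mul_cancel₀ _ (h' i j)
    · simp only [scalePt, hi, if_false, one_mul]
  rw [← h2]
  linear_combination (-(X ^ #I) * ∏ i ∈ I, ∏ j, ((1 - x i * y j) / (1 - t * x i * y j))) * h1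

/-- Write C(y) = det `cauchyCoeff y`. Then C(y) S(x,y) is ∏ (1 - x_i y_j) times the determinant of a
matrix that is transposed when x and y are exchanged, so C(y) S(x,y) = C(x) S(y,x). The Cauchy
determinant gives vdm(x) C(y) = vdm(y) C(x) for the same reason. Cancelling C(x) ≠ 0 leaves the
claim, without an explicit value of C. -/
theorem cauchySum_symm (X t : F) {x y : Fin n → F} (hx : Function.Injective x)
    (hx0 : ∀ i, x i ≠ 0) (h : ∀ i j, 1 - x i * y j ≠ 0) (h' : ∀ i j, 1 - t * x i * y j ≠ 0) :
    vdm y * cauchySum X t x y = vdm x * cauchySum X t y x := by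
  have e1 := cauchySum_mul_det X t h h'
  have e2 := cauchySum_mul_det X t (x := y) (y := x) (fun i j => by rw [mul_comm]; exact h j i)
    (fun i j => by rw [mul_right_comm]; exact h' j i)
  have e3 := det_cauchy h
  have e4 := det_cauchy (x := y) (y := x) (fun i j => by rw [mul_comm]; exact h j i)
  have p1 : ∏ i, ∏ j, (1 - y i * x j) = ∏ i, ∏ j, (1 - x i * y j) := by
    rw [prod_comm]
    exact prod_congr rfl fun i _ => prod_congr rfl fun j _ => by rw [mul_comm]
  have p2 : (Matrix.of fun i j => X * (1 - t * y i * x j)⁻¹ + (1 - y i * x j)⁻¹).det =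
      (Matrix.of fun i j => X * (1 - t * x i * y j)⁻¹ + (1 - x i * y j)⁻¹).det := by
    rw [← Matrix.det_transpose]
    congr 1
    ext i j
    simp only [Matrix.transpose_apply, Matrix.of_apply]
    rw [mul_right_comm t, mul_comm (y j)]
  have p3 : (Matrix.of fun i j => (1 - y i * x j)⁻¹).det =
      (Matrix.of fun i j => (1 - x i * y j)⁻¹).det := by
    rw [← Matrix.det_transpose]
    congr 1
    ext i j
    simp only [Matrix.transpose_apply, Matrix.of_apply]
    rw [mul_comm (y j)]
  rw [p1, p2] at e2
  rw [p1, p3] at e4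
  apply mul_right_cancel₀ (det_cauchyCoeff_ne_zero hx hx0)
  linear_combination (-cauchySum X t x y) * e4 + cauchySum X t x y * e3 + vdm x * e1 - vdm x * e2

end Cauchy

end Macdonald

namespace Macdonald

open MvPolynomial Finset

/-! ### Unitriangular families as bases of Λ -/

section Unitriangular

/-- Families of symmetric functions with a lexicographically unitriangular expansion in the
monomial symmetric functions. -/
structure IsUnitriangular (F : YoungDiagram → SymFun) : Prop where
  homog : ∀ lam, IsHomog (F lam) lam.card
  diag : ∀ lam, mCoeff lam (F lam) = 1
  lower : ∀ lam mu, mCoeff mu (F lam) ≠ 0 → mu = lam ∨ LexLT mu lam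

theorem isUnitriangular_mon : IsUnitriangular mon where
  homog := isHomog_mon
  diag lam := by rw [mCoeff_mon, if_pos rfl]
  lower lam mu h := by
    rw [mCoeff_mon] at h
    left
    by_contra hc
    exact h (if_neg hc)

namespace IsUnitriangular

variable {F : YoungDiagram → SymFun}

theorem linearIndependent (hF : IsUnitriangular F) : LinearIndependent ℂ F := by
  rw [linearIndependent_iff]
  intro c hc
  by_contra hne
  have hS : c.support.Nonempty := Finsupp.support_nonempty_iff.2 hne
  let po : PartialOrder YoungDiagram :=
    { le := fun a b => a = b ∨ LexLT a b
      lt := LexLT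
      le_refl := fun a => Or.inl rfl
      le_trans := by
        rintro a b c (rfl | h) (rfl | h')
        · exact Or.inl rfl
        · exact Or.inr h'
        · exact Or.inr h
        · exact Or.inr (h.trans h')
      le_antisymm := by
        rintro a b (rfl | h) (h1 | h')
        · rfl
        · rfl
        · exact h1.symm
        · exact absurd (h.trans h') (LexLT.irrefl a)
      lt_iff_le_not_ge := by
        intro a b
        constructor
        · refine fun h => ⟨Or.inr h, ?_⟩
          rintro (rfl | h')
          · exact LexLT.irrefl _ h
          · exact LexLT.irrefl _ (h.trans h')
        · rintro ⟨rfl | h, h'⟩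
          · exact absurd (Or.inl rfl) h'
          · exact h }
  obtain ⟨lam, hlam⟩ := @Finset.exists_maximal _ po.toPreorder.toLE inferInstance c.support hS
  have h1 := congrArg (mCoeff lam) hc
  rw [map_zero, Finsupp.linearCombination_apply, Finsupp.sum, map_sum, sum_eq_single lam] at h1
  · rw [map_smul, hF.diag, smul_eq_mul, mul_one] at h1
    exact Finsupp.mem_support_iff.1 hlam.1 h1
  · intro mu hmu hne
    rw [map_smul, smul_eq_mul]
    by_contra h2
    rcases hF.lower mu lam (right_ne_zero_of_mul h2) with h3 | h3
    · exact hne h3.symm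
    · rcases hlam.2 hmu (Or.inr h3) with h4 | h4
      · exact hne h4
      · exact LexLT.irrefl _ (h3.trans h4)
  · intro h
    exact absurd hlam.1 h

theorem mon_mem_span (hF : IsUnitriangular F) (lam : YoungDiagram) :
    mon lam ∈ Submodule.span ℂ (F '' {mu | mu.card = lam.card}) := by
  induction lam using wellFounded_lexLT.induction with
  | _ lam ih =>
    have h1 := (hF.homog lam).eq_sum_mon
    rw [← sum_erase_add _ _ (mem_ofSize.2 rfl), hF.diag, one_smul] at h1
    rw [← sub_eq_iff_eq_add'.2 h1]
    refine Submodule.sub_mem _ (Submodule.subset_span (Set.mem_image_of_mem F rfl)) ?_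
    apply Submodule.sum_mem
    intro nu hnu
    rw [mem_erase, mem_ofSize] at hnu
    by_cases h0 : mCoeff nu (F lam) = 0
    · rw [h0, zero_smul]; exact Submodule.zero_mem _
    · apply Submodule.smul_mem
      have := ih nu ((hF.lower lam nu h0).resolve_left hnu.1)
      rwa [hnu.2] at this

theorem homog_mem_span (hF : IsUnitriangular F) {f : SymFun} {d : ℕ} (hf : IsHomog f d) :
    f ∈ Submodule.span ℂ (F '' {mu | mu.card = d}) := by
  rw [hf.eq_sum_mon]
  apply Submodule.sum_mem
  intro nu hnu
  apply Submodule.smul_mem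
  have := hF.mon_mem_span nu
  rwa [mem_ofSize.1 hnu] at this

theorem span_eq_top (hF : IsUnitriangular F) : ⊤ ≤ Submodule.span ℂ (Set.range F) := by
  intro f _
  induction f using MvPolynomial.induction_on' with
  | monomial e a =>
    have h1 : IsHomog (monomial e a) (Finsupp.weight (fun k : ℕ+ => (k : ℕ)) e) :=
      isWeightedHomogeneous_monomial _ _ _ rfl
    exact Submodule.span_mono (Set.image_subset_range _ _) (hF.homog_mem_span h1)
  | add f g hf hg => exact Submodule.add_mem _ (hf trivial) (hg trivial)

/-- A unitriangular family is a basis. -/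
noncomputable def basis (hF : IsUnitriangular F) : Module.Basis YoungDiagram ℂ SymFun :=
  Module.Basis.mk hF.linearIndependent hF.span_eq_top

@[simp]
theorem basis_apply (hF : IsUnitriangular F) (lam : YoungDiagram) : hF.basis lam = F lam :=
  Module.Basis.mk_apply _ _ _

theorem repr_eq_zero (hF : IsUnitriangular F) {f : SymFun} {d : ℕ} (hf : IsHomog f d) {mu : YoungDiagram}
    (h : mu.card ≠ d) : hF.basis.repr f mu = 0 := by
  have hm := hF.homog_mem_span hf
  clear hf
  induction hm using Submodule.span_induction with
  | mem x hx =>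
    obtain ⟨nu, hnu, rfl⟩ := hx
    rw [← hF.basis_apply, Module.Basis.repr_self, Finsupp.single_apply, if_neg]
    rintro rfl
    exact h hnu
  | zero => simp
  | add x y _ _ hx hy => rw [map_add, Finsupp.add_apply, hx, hy, add_zero]
  | smul a x _ hx => rw [map_smul, Finsupp.smul_apply, hx, smul_zero]

theorem eq_sum_repr (hF : IsUnitriangular F) {f : SymFun} {d : ℕ} (hf : IsHomog f d) :
    f = ∑ nu ∈ ofSize d, hF.basis.repr f nu • F nu := by
  conv_lhs => rw [← hF.basis.linearCombination_repr f]
  rw [Finsupp.linearCombination_apply, Finsupp.sum_of_support_subset _ (s := ofSize d)]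
  · simp
  · intro nu hnu
    rw [mem_ofSize]
    by_contra hc
    exact Finsupp.mem_support_iff.1 hnu (hF.repr_eq_zero hf hc)
  · simp

end IsUnitriangular

end Unitriangular

/-! ### The reproducing kernel and its symmetry under the operator -/

section Kernel

/-- The components of the reproducing kernel `exp (∑ k, (1 - t ^ k)/(1 - q ^ k) ρ_k p_k / k)`. -/
noncomputable def kernel (q t : ℂ) (ρ : ℕ → ℂ) (d : ℕ) : SymFun :=
  expCoeff (fun k => (ratio t q (k + 1) * ρ k) • powerSum k) d

theorem isHomog_kernel (q t : ℂ) (ρ : ℕ → ℂ) (d : ℕ) : IsHomog (kernel q t ρ d) d :=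
  isHomog_expCoeff _ _

theorem pderiv_kernel (q t : ℂ) (ρ : ℕ → ℂ) (k d : ℕ) :
    pderiv k.succPNat (kernel q t ρ d) = if k + 1 ≤ d then
      (ratio t q (k + 1) * ρ k / (k + 1)) • kernel q t ρ (d - (k + 1)) else 0 :=
  pderiv_expCoeff _ _ _

/-- The derivative of the kernel in p_k is a multiple of ρ_k times the kernel shifted by k degrees,
and p_k is adjoint to this derivative up to the inverse multiple. Partial sums over degrees are used
because f is arbitrary in the induction. -/
theorem exists_form_sum_kernel {q t : ℂ} (hq : ‖q‖ < 1) (ht : ‖t‖ < 1) (ρ : ℕ → ℂ) (f : SymFun) :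
    ∃ N₀, ∀ N, N₀ ≤ N → form q t f (∑ d ∈ range N, kernel q t ρ d) =
      aeval (fun k : ℕ+ => ρ k.natPred) f := by
  induction f using MvPolynomial.induction_on with
  | C a =>
    refine ⟨1, fun N hN => ?_⟩
    obtain ⟨N, rfl⟩ : ∃ M, N = M + 1 := ⟨N - 1, by omega⟩
    have hC : IsHomog (C a) 0 := isWeightedHomogeneous_C _ _
    rw [sum_range_succ', map_add, map_sum, sum_eq_zero, zero_add, kernel, expCoeff_zero, form_comm,
      ← C_1, C_apply, form_monomial, powerSumNorm_zero]
    · simp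
    · intro d _
      exact form_eq_zero_of_ne q t hC (isHomog_kernel _ _ _ _) (by omega)
  | add f g hf hg =>
    obtain ⟨N, hN⟩ := hf
    obtain ⟨M, hM⟩ := hg
    refine ⟨max N M, fun K hK => ?_⟩
    rw [map_add, map_add, LinearMap.add_apply, hN K (le_of_max_le_left hK),
      hM K (le_of_max_le_right hK)]
  | mul_X f k hf =>
    obtain ⟨N, hN⟩ := hf
    obtain ⟨j, rfl⟩ : ∃ j : ℕ, k = j.succPNat := ⟨k.natPred, by simp⟩
    refine ⟨N + (j + 1), fun K hK => ?_⟩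
    obtain ⟨M, rfl⟩ : ∃ M, K = j + 1 + M := ⟨K - (j + 1), by omega⟩
    have hj : ((j : ℂ) + 1) ≠ 0 := by exact_mod_cast Nat.succ_ne_zero j
    have h2 := ratio_mul_ratio hq ht (k := j + 1) (by omega)
    rw [mul_comm f, form_X_mul, map_sum, sum_range_add, sum_eq_zero, zero_add, map_mul, aeval_X,
      ← hN M (by omega)]
    · simp_rw [pderiv_kernel]
      rw [sum_congr rfl (g := fun d => (ratio t q (j + 1) * ρ j / (j + 1)) • kernel q t ρ d),
        ← smul_sum, map_smul, smul_eq_mul, ← mul_assoc]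
      · congr 1
        simp only [Nat.succPNat_coe, Nat.succ_eq_add_one, Nat.natPred_succPNat]
        push_cast
        field_simp
        linear_combination ρ j * h2
      · intro d _
        rw [if_pos (by omega), Nat.add_sub_cancel_left]
    · intro d hd
      rw [mem_range] at hd
      rw [pderiv_kernel, if_neg (by omega)]

theorem form_kernel {q t : ℂ} (hq : ‖q‖ < 1) (ht : ‖t‖ < 1) (ρ : ℕ → ℂ) {f : SymFun} {d : ℕ}
    (hf : IsHomog f d) :
    form q t f (kernel q t ρ d) = aeval (fun k : ℕ+ => ρ k.natPred) f := by
  obtain ⟨N, hN⟩ := exists_form_sum_kernel hq ht ρ f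
  rw [← hN (max N (d + 1)) (le_max_left _ _), map_sum, sum_eq_single d]
  · intro e _ he
    exact form_eq_zero_of_ne q t hf (isHomog_kernel _ _ _ _) he.symm
  · intro h
    exact absurd (mem_range.2 (lt_of_lt_of_le (Nat.lt_succ_self d) (le_max_right _ _))) h

/-- The power sums of a point. -/
def pointSum {n : ℕ} (x : Fin n → ℂ) (k : ℕ) : ℂ := ∑ i, x i ^ (k + 1)

theorem aeval_pointSum {n : ℕ} (x : Fin n → ℂ) (f : SymFun) :
    aeval (fun k : ℕ+ => pointSum x k.natPred) f = eval x (toPoly (Fin n) f) := by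
  rw [← coe_aeval_eq_eval, RingHom.coe_coe, toPoly, ← AlgHom.comp_apply]
  congr 1
  ext k
  simp [pointSum, psum]

theorem eval_toPoly_kernel (q t : ℂ) {n : ℕ} (x : Fin n → ℂ) (ρ : ℕ → ℂ) (d : ℕ) :
    eval x (toPoly (Fin n) (kernel q t ρ d)) =
      expCoeff (fun k => ratio t q (k + 1) * pointSum x k * ρ k) d := by
  rw [← aeval_pointSum, kernel, map_expCoeff]
  congr 1
  ext k
  rw [map_smul, powerSum, aeval_X, smul_eq_mul, Nat.natPred_succPNat]
  ring

/-- The generating function in `s` of the components of the kernel at two points. -/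
noncomputable def kernelSeries (q t : ℂ) {n : ℕ} (x y : Fin n → ℂ) : PowerSeries ℂ :=
  expSeries fun k => ratio t q (k + 1) * pointSum x k * pointSum y k

theorem kernelSeries_comm (q t : ℂ) {n : ℕ} (x y : Fin n → ℂ) :
    kernelSeries q t x y = kernelSeries q t y x := by
  rw [kernelSeries, kernelSeries]
  congr 1
  ext k
  ring

/-- Replacing x_i by q x_i changes the exponent by Σ (t^k - 1) (x_i y_j s)^k / k, since the
denominator 1 - q^k cancels. This is the logarithm of (1 - x_i y_j s)/(1 - t x_i y_j s). -/
theorem kernelSeries_scalePt {q : ℂ} (hq : ‖q‖ < 1) (t : ℂ) {n : ℕ} (I : Finset (Fin n))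
    (x y : Fin n → ℂ) :
    kernelSeries q t (scalePt q I x) y *
        ∏ i ∈ I, ∏ j, (1 - PowerSeries.C (t * x i * y j) * PowerSeries.X) =
      kernelSeries q t x y * ∏ i ∈ I, ∏ j, (1 - PowerSeries.C (x i * y j) * PowerSeries.X) := by
  simp_rw [← expSeries_neg_geom, ← expSeries_sum, kernelSeries, ← expSeries_add]
  congr 1
  ext k
  simp only [Pi.add_apply, Finset.sum_apply]
  have h1 : pointSum (scalePt q I x) k = pointSum x k + (q ^ (k + 1) - 1) * ∑ i ∈ I, x i ^ (k + 1) := by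
    rw [pointSum, pointSum, mul_sum, ← Fintype.sum_ite_mem I, ← sum_add_distrib]
    refine sum_congr rfl fun i _ => ?_
    rw [scalePt]
    split_ifs <;> ring
  have h2 : ratio t q (k + 1) * (q ^ (k + 1) - 1) = t ^ (k + 1) - 1 := by
    rw [ratio, div_mul_eq_mul_div, div_eq_iff (one_sub_pow_ne_zero hq (k := k + 1) (by omega))]
    ring
  have h3 : ∀ c : ℂ, ∑ i ∈ I, ∑ j, -(c * x i * y j) ^ (k + 1) =
      -(c ^ (k + 1) * (∑ i ∈ I, x i ^ (k + 1)) * pointSum y k) := by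
    intro c
    rw [pointSum, mul_assoc, sum_mul_sum, mul_sum, ← sum_neg_distrib]
    refine sum_congr rfl fun i _ => ?_
    rw [mul_sum, ← sum_neg_distrib]
    exact sum_congr rfl fun j _ => by ring
  have h4 := h3 1
  simp_rw [one_mul] at h4
  rw [h3, h4, h1]
  linear_combination (∑ i ∈ I, x i ^ (k + 1)) * pointSum y k * h2

theorem vdm_mul_left {R : Type*} [CommRing R] {n : ℕ} (c : R) (x : Fin n → R) :
    vdm (fun i => c * x i) = c ^ (∑ i : Fin n, #(Ioi i)) * vdm x := by
  rw [vdm, vdm, ← prod_pow_eq_pow_sum, ← prod_mul_distrib]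
  refine prod_congr rfl fun i _ => ?_
  rw [← prod_const, ← prod_mul_distrib]
  exact prod_congr rfl fun j _ => by ring

/-- After division by the kernel both sides are the rational sums of `cauchySum_symm`. The field K
over the power series makes this division possible. -/
theorem sum_kernelSeries_symm {K : Type*} [Field K] (ι : PowerSeries ℂ →+* K)
    (hinj : Function.Injective ι) {q t : ℂ} (hq : ‖q‖ < 1) (z : ℂ) {n : ℕ} {x : Fin n → ℂ}
    (hx : Function.Injective x) (hx0 : ∀ i, x i ≠ 0) (y : Fin n → ℂ) :
    PowerSeries.C (vdm y) * ∑ I : Finset (Fin n), PowerSeries.C (z ^ #I * vdm (scalePt t I x)) *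
        kernelSeries q t (scalePt q I x) y =
      PowerSeries.C (vdm x) * ∑ I : Finset (Fin n), PowerSeries.C (z ^ #I * vdm (scalePt t I y)) *
        kernelSeries q t (scalePt q I y) x := by
  set c : ℂ → K := fun a => ι (PowerSeries.C a) with hc
  set s := ι PowerSeries.X with hs
  have hs0 : s ≠ 0 := by
    rw [hs, Ne, map_eq_zero_iff _ hinj]
    exact PowerSeries.X_ne_zero
  have hcinj : Function.Injective c := hinj.comp PowerSeries.C_injective
  have hlin : ∀ a : ℂ, ι (1 - PowerSeries.C a * PowerSeries.X) = 1 - c a * s := by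
    intro a; rw [map_sub, map_mul, map_one]
  have hne : ∀ a : ℂ, 1 - c a * s ≠ 0 := by
    intro a
    rw [← hlin, Ne, map_eq_zero_iff _ hinj]
    intro h
    simpa using congrArg (PowerSeries.coeff 0) h
  have hcv : ∀ w : Fin n → ℂ, vdm (fun i => c (w i)) = c (vdm w) := fun w =>
    (map_vdm (ι.comp PowerSeries.C) w).symm
  have key : ∀ (x y : Fin n → ℂ) (I : Finset (Fin n)),
      ι (kernelSeries q t (scalePt q I x) y) = ι (kernelSeries q t x y) *
        ∏ i ∈ I, ∏ j, ((1 - c (x i * y j) * s) / (1 - c (t * x i * y j) * s)) := by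
    intro x y I
    have h1 := congrArg ι (kernelSeries_scalePt hq t I x y)
    simp_rw [map_mul ι, map_prod, hlin] at h1
    simp_rw [prod_div_distrib]
    rw [mul_div_assoc', eq_div_iff, h1]
    exact prod_ne_zero_iff.2 fun i _ => prod_ne_zero_iff.2 fun j _ => hne _
  -- The marker s is attached to x alone. Each 1 - s x_i y_j then comes from a series with constant
  -- term 1 and is nonzero; the Vandermonde of s x contributes a power of s on both sides, cancelled
  -- at the end.
  have e := cauchySum_symm (c z) (c t) (x := fun i => s * c (x i)) (y := fun i => c (y i))
    (fun i j h => hx (hcinj (mul_left_cancel₀ hs0 h)))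
    (fun i => mul_ne_zero hs0 ((map_ne_zero_iff (ι.comp PowerSeries.C) hcinj).2 (hx0 i)))
    (fun i j => by
      have := hne (x i * y j)
      simp only [hc, map_mul] at this ⊢
      convert this using 2
      ring)
    (fun i j => by
      have := hne (t * x i * y j)
      simp only [hc, map_mul] at this ⊢
      convert this using 2
      ring)
  set N := ∑ i : Fin n, #(Ioi i)
  have hA : cauchySum (c z) (c t) (fun i => s * c (x i)) (fun i => c (y i)) *
      ι (kernelSeries q t x y) = s ^ N * ι (∑ I : Finset (Fin n),
        PowerSeries.C (z ^ #I * vdm (scalePt t I x)) * kernelSeries q t (scalePt q I x) y) := by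
    rw [cauchySum, sum_mul, map_sum, mul_sum]
    refine sum_congr rfl fun I _ => ?_
    have h1 : scalePt (c t) I (fun i => s * c (x i)) = fun i => s * c (scalePt t I x i) := by
      ext i
      simp only [scalePt]
      split_ifs
      · simp only [hc, map_mul]; ring
      · rfl
    have h2 : ∏ i ∈ I, ∏ j, ((1 - s * c (x i) * c (y j)) / (1 - c t * (s * c (x i)) * c (y j))) =
        ∏ i ∈ I, ∏ j, ((1 - c (x i * y j) * s) / (1 - c (t * x i * y j) * s)) := by
      refine prod_congr rfl fun i _ => prod_congr rfl fun j _ => ?_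
      simp only [hc, map_mul]
      congr 1 <;> ring
    rw [h1, vdm_mul_left, hcv, h2, map_mul ι, key]
    simp only [hc, map_mul, map_pow]
    ring
  have hB : cauchySum (c z) (c t) (fun i => c (y i)) (fun i => s * c (x i)) *
      ι (kernelSeries q t x y) = ι (∑ I : Finset (Fin n),
        PowerSeries.C (z ^ #I * vdm (scalePt t I y)) * kernelSeries q t (scalePt q I y) x) := by
    rw [cauchySum, sum_mul, map_sum]
    refine sum_congr rfl fun I _ => ?_
    have h1 : scalePt (c t) I (fun i => c (y i)) = fun i => c (scalePt t I y i) := by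
      ext i
      simp only [scalePt]
      split_ifs
      · simp only [hc, map_mul]
      · rfl
    have h2 : ∏ i ∈ I, ∏ j, ((1 - c (y i) * (s * c (x j))) / (1 - c t * c (y i) * (s * c (x j)))) =
        ∏ i ∈ I, ∏ j, ((1 - c (y i * x j) * s) / (1 - c (t * y i * x j) * s)) := by
      refine prod_congr rfl fun i _ => prod_congr rfl fun j _ => ?_
      simp only [hc, map_mul]
      congr 1 <;> ring
    rw [h1, hcv, h2, map_mul ι, key, kernelSeries_comm q t x y]
    simp only [hc, map_mul, map_pow]
    ring
  rw [hcv, vdm_mul_left, hcv] at e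
  apply hinj
  apply mul_left_cancel₀ (pow_ne_zero N hs0)
  rw [map_mul, map_mul]
  change s ^ N * (c (vdm y) * _) = s ^ N * (c (vdm x) * _)
  rw [← hB]
  linear_combination ι (kernelSeries q t x y) * e - c (vdm y) * hA

theorem sum_kernel_symm {q t : ℂ} (hq : ‖q‖ < 1) (z : ℂ) {n : ℕ} {x : Fin n → ℂ}
    (hx : Function.Injective x) (hx0 : ∀ i, x i ≠ 0) (y : Fin n → ℂ) (d : ℕ) :
    vdm y * ∑ I : Finset (Fin n), z ^ #I * vdm (scalePt t I x) *
        eval (scalePt q I x) (toPoly (Fin n) (kernel q t (pointSum y) d)) =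
      vdm x * ∑ I : Finset (Fin n), z ^ #I * vdm (scalePt t I y) *
        eval x (toPoly (Fin n) (kernel q t (pointSum (scalePt q I y)) d)) := by
  have h := congrArg (PowerSeries.coeff d) (sum_kernelSeries_symm
    (algebraMap (PowerSeries ℂ) (FractionRing (PowerSeries ℂ))) (IsFractionRing.injective _ _)
    (t := t) hq z hx hx0 y)
  simp_rw [PowerSeries.coeff_C_mul, map_sum, PowerSeries.coeff_C_mul] at h
  simp_rw [eval_toPoly_kernel]
  simp_rw [kernelSeries, expSeries, PowerSeries.coeff_mk] at h
  refine h.trans ?_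
  congr 1
  refine sum_congr rfl fun I _ => ?_
  congr 2
  funext k
  ring

end Kernel

end Macdonald

namespace Macdonald

open MvPolynomial Finset

/-! ### Self-adjointness and orthogonal eigenfunctions -/

section Orthogonality

variable {n : ℕ}

theorem eval_scaleVars (a : ℂ) (I : Finset (Fin n)) (x : Fin n → ℂ) (f : MvPolynomial (Fin n) ℂ) :
    eval x (scaleVars a I f) = eval (scalePt a I x) f := by
  induction f using MvPolynomial.induction_on with
  | C a => simp [scaleVars]
  | add f g hf hg => simp only [map_add, hf, hg]
  | mul_X f i hf =>
    simp only [map_mul, hf, eval_X]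
    congr 1
    simp only [scaleVars, aeval_X, scalePt]
    split_ifs <;> simp

theorem eval_vdmPoly (x : Fin n → ℂ) : eval x (vdmPoly n) = vdm x := by
  rw [vdmPoly, map_vdm]
  simp

theorem eval_macOp (q t z : ℂ) (x : Fin n → ℂ) (f : MvPolynomial (Fin n) ℂ) :
    eval x (macOp q t z f) =
      ∑ I : Finset (Fin n), z ^ #I * vdm (scalePt t I x) * eval (scalePt q I x) f := by
  rw [macOp, map_sum]
  refine sum_congr rfl fun I _ => ?_
  rw [smul_eval, map_mul, eval_scaleVars, eval_scaleVars, eval_vdmPoly, mul_assoc]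

theorem eq_zero_of_eval_eq_zero {f : MvPolynomial (Fin n) ℂ}
    (h : ∀ x : Fin n → ℂ, Function.Injective x → (∀ i, x i ≠ 0) → eval x f = 0) : f = 0 := by
  have h1 : f * (vdmPoly n * ∏ i, X i) = 0 := by
    apply MvPolynomial.funext
    intro x
    rw [map_mul, map_mul, map_prod, map_zero, eval_vdmPoly]
    simp_rw [eval_X]
    by_cases hx : Function.Injective x
    · by_cases hx0 : ∀ i, x i ≠ 0
      · rw [h x hx hx0, zero_mul]
      · push Not at hx0
        obtain ⟨i, hi⟩ := hx0
        rw [prod_eq_zero (mem_univ i) hi, mul_zero, mul_zero]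
    · rw [not_imp_comm.1 vdm_ne_zero_iff.1 hx, zero_mul, mul_zero]
  refine (mul_eq_zero.1 h1).resolve_right (mul_ne_zero (vdmPoly_ne_zero n) ?_)
  exact prod_ne_zero_iff.2 fun i _ => X_ne_zero i

/-- The diagonal operator in a unitriangular basis. -/
noncomputable def diagOp {F : YoungDiagram → SymFun} (hF : IsUnitriangular F)
    (c : YoungDiagram → ℂ) : SymFun →ₗ[ℂ] SymFun :=
  hF.basis.constr ℂ fun lam => c lam • F lam

theorem diagOp_apply {F : YoungDiagram → SymFun} (hF : IsUnitriangular F) (c : YoungDiagram → ℂ)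
    (lam : YoungDiagram) : diagOp hF c (F lam) = c lam • F lam := by
  conv_lhs => rw [← hF.basis_apply lam]
  rw [diagOp, Module.Basis.constr_basis]

theorem diagOp_eq_sum {F : YoungDiagram → SymFun} (hF : IsUnitriangular F) (c : YoungDiagram → ℂ)
    {f : SymFun} {d : ℕ} (hf : IsHomog f d) :
    diagOp hF c f = ∑ nu ∈ ofSize d, hF.basis.repr f nu • c nu • F nu := by
  conv_lhs => rw [hF.eq_sum_repr hf]
  rw [map_sum]
  exact sum_congr rfl fun nu _ => by rw [map_smul, diagOp_apply]

theorem isHomog_diagOp {F : YoungDiagram → SymFun} (hF : IsUnitriangular F) (c : YoungDiagram → ℂ)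
    {f : SymFun} {d : ℕ} (hf : IsHomog f d) : IsHomog (diagOp hF c f) d := by
  rw [diagOp_eq_sum hF c hf]
  refine IsHomog.sum fun nu hnu => IsHomog.smul (IsHomog.smul ?_ _) _
  have := hF.homog nu
  rwa [mem_ofSize.1 hnu] at this

theorem macOp_eq_diagOp {q t z : ℂ} {F : YoungDiagram → SymFun} (hF : IsUnitriangular F)
    {c : YoungDiagram → ℂ} {d : ℕ}
    (hc : ∀ lam, lam.card = d → macOp q t z (toPoly (Fin n) (F lam)) =
      c lam • (vdmPoly n * toPoly (Fin n) (F lam))) {f : SymFun} (hf : IsHomog f d) :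
    macOp q t z (toPoly (Fin n) f) = vdmPoly n * toPoly (Fin n) (diagOp hF c f) := by
  rw [diagOp_eq_sum hF c hf]
  conv_lhs => rw [hF.eq_sum_repr hf]
  simp_rw [map_sum, map_smul]
  rw [macOp_sum, mul_sum]
  refine sum_congr rfl fun nu hnu => ?_
  rw [hc nu (mem_ofSize.1 hnu), mul_smul_comm, mul_smul_comm]

/-- By the symmetry of the kernel the operator acting in x can be moved to y, where it yields a
finite combination of kernels at rescaled points. -/
theorem diagOp_kernel {q t z : ℂ} (hq : ‖q‖ < 1) {F : YoungDiagram → SymFun}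
    (hF : IsUnitriangular F) {c : YoungDiagram → ℂ} {d : ℕ} (hd : d ≤ n)
    (hc : ∀ lam, lam.card = d → macOp q t z (toPoly (Fin n) (F lam)) =
      c lam • (vdmPoly n * toPoly (Fin n) (F lam))) {y : Fin n → ℂ} (hy : Function.Injective y) :
    diagOp hF c (kernel q t (pointSum y) d) = ∑ I : Finset (Fin n),
      (z ^ #I * vdm (scalePt t I y) / vdm y) • kernel q t (pointSum (scalePt q I y)) d := by
  rw [← sub_eq_zero]
  have hK := isHomog_kernel q t (pointSum y) d
  apply IsHomog.eq_zero (d := d) (n := n) _ hd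
  · apply eq_zero_of_eval_eq_zero
    intro x hx hx0
    have h1 := congrArg (eval x) (macOp_eq_diagOp hF hc hK)
    rw [eval_macOp, map_mul, eval_vdmPoly] at h1
    have h2 := sum_kernel_symm (t := t) hq z hx hx0 y d
    have hvx := vdm_ne_zero_iff.2 hx
    have hvy := vdm_ne_zero_iff.2 hy
    rw [h1, mul_left_comm] at h2
    have h3 := mul_left_cancel₀ hvx h2
    rw [map_sub, map_sub, sub_eq_zero]
    apply mul_left_cancel₀ hvy
    rw [h3, map_sum, map_sum, mul_sum]
    refine sum_congr rfl fun I _ => ?_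
    rw [map_smul, smul_eval]
    field_simp
  · exact (isHomog_diagOp hF c hK).sub (IsHomog.sum fun I _ => (isHomog_kernel _ _ _ _).smul _)

/-- Pairing with a kernel evaluates F_μ at its point, so pairing with the combination of rescaled
kernels evaluates the Macdonald operator of F_μ at y. -/
theorem form_diagOp_kernel {q t z : ℂ} (hq : ‖q‖ < 1) (ht : ‖t‖ < 1) {F : YoungDiagram → SymFun}
    (hF : IsUnitriangular F) {c : YoungDiagram → ℂ} {d : ℕ} (hd : d ≤ n)
    (hc : ∀ lam, lam.card = d → macOp q t z (toPoly (Fin n) (F lam)) =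
      c lam • (vdmPoly n * toPoly (Fin n) (F lam))) {y : Fin n → ℂ} (hy : Function.Injective y)
    {mu : YoungDiagram} (hmu : mu.card = d) :
    form q t (F mu) (diagOp hF c (kernel q t (pointSum y) d)) =
      c mu * form q t (F mu) (kernel q t (pointSum y) d) := by
  have hmuH : IsHomog (F mu) d := hmu ▸ hF.homog mu
  have hvy := vdm_ne_zero_iff.2 hy
  rw [diagOp_kernel hq hF hd hc hy, map_sum]
  simp_rw [map_smul, form_kernel hq ht _ hmuH, aeval_pointSum, smul_eq_mul]
  have h1 := congrArg (eval y) (hc mu hmu)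
  rw [eval_macOp, smul_eval, map_mul, eval_vdmPoly] at h1
  apply mul_left_cancel₀ hvy
  rw [mul_left_comm, ← h1, mul_sum]
  refine sum_congr rfl fun I _ => ?_
  field_simp

/-- In degree d the functional is pairing with h = Σ l(m_ν) g_ν. On the kernel at y it takes the
value h(y), so h vanishes at all points with distinct coordinates, hence h = 0. -/
theorem eq_zero_on_homog_of_kernel {q t : ℂ} (hq : ‖q‖ < 1) (ht : ‖t‖ < 1) {d : ℕ} (hd : d ≤ n)
    (l : SymFun →ₗ[ℂ] ℂ)
    (hl : ∀ y : Fin n → ℂ, Function.Injective y → l (kernel q t (pointSum y) d) = 0)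
    {f : SymFun} (hf : IsHomog f d) : l f = 0 := by
  set h : SymFun := ∑ nu ∈ ofSize d, l (mon nu) • gPart q t nu with hh
  have hhom : IsHomog h d := IsHomog.sum fun nu hnu => by
    have := isHomog_gPart q t nu
    rw [mem_ofSize.1 hnu] at this
    exact this.smul _
  have hform : ∀ f, IsHomog f d → form q t h f = l f := by
    intro f hf
    conv_rhs => rw [hf.eq_sum_mon]
    rw [hh, map_sum, map_sum, LinearMap.sum_apply]
    refine sum_congr rfl fun nu _ => ?_
    rw [map_smul, map_smul, LinearMap.smul_apply, form_gPart hq ht, smul_eq_mul, smul_eq_mul,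
      mul_comm]
  have h0 : h = 0 := by
    apply hhom.eq_zero hd
    apply eq_zero_of_eval_eq_zero
    intro y hy _
    rw [← aeval_pointSum, ← form_kernel hq ht _ hhom, hform _ (isHomog_kernel _ _ _ _), hl y hy]
  rw [← hform f hf, h0, map_zero, LinearMap.zero_apply]

/-- ⟨F_μ, D f⟩ = c_μ ⟨F_μ, f⟩ holds for kernels, hence for all f of degree d. With f = F_λ it gives
(c_λ - c_μ) ⟨F_λ, F_μ⟩ = 0. -/
theorem form_eq_zero_of_eigen {q t z : ℂ} (hq : ‖q‖ < 1) (ht : ‖t‖ < 1)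
    {F : YoungDiagram → SymFun} (hF : IsUnitriangular F) {c : YoungDiagram → ℂ} {d : ℕ}
    (hd : d ≤ n) (hc : ∀ lam, lam.card = d → macOp q t z (toPoly (Fin n) (F lam)) =
      c lam • (vdmPoly n * toPoly (Fin n) (F lam))) {lam mu : YoungDiagram} (hlam : lam.card = d)
    (hmu : mu.card = d) (hne : c lam ≠ c mu) : form q t (F lam) (F mu) = 0 := by
  have h := eq_zero_on_homog_of_kernel hq ht hd
    ((form q t (F mu)).comp (diagOp hF c) - c mu • form q t (F mu)) (fun y hy => by
      rw [LinearMap.sub_apply, LinearMap.comp_apply, LinearMap.smul_apply,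
        form_diagOp_kernel hq ht hF hd hc hy hmu, smul_eq_mul, sub_self])
    (hlam ▸ hF.homog lam)
  rw [LinearMap.sub_apply, LinearMap.comp_apply, diagOp_apply, LinearMap.smul_apply, map_smul,
    smul_eq_mul, smul_eq_mul, ← sub_mul, form_comm] at h
  exact (mul_eq_zero.1 h).resolve_left (sub_ne_zero.2 hne)

/-- A separating parameter gives a unitriangular family whose members of size `d` are orthogonal
eigenfunctions of the Macdonald operator. -/
theorem exists_orthogonal_eigenfamily {q t z : ℂ} (hq : ‖q‖ < 1) (ht : ‖t‖ < 1) {d : ℕ}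
    (hd : d ≤ n) (hsep : ∀ lam mu : YoungDiagram, lam.card = d → mu.card = d → lam ≠ mu →
      macEigen n q t z lam ≠ macEigen n q t z mu) :
    ∃ F, IsUnitriangular F ∧ (∀ lam mu, mCoeff mu (F lam) ≠ 0 → DomLE mu lam) ∧
      (∀ lam mu, lam.card = d → mu.card = d → lam ≠ mu → form q t (F lam) (F mu) = 0) ∧
      ∀ lam, lam.card = d → macOp q t z (toPoly (Fin n) (F lam)) =
        macEigen n q t z lam • (vdmPoly n * toPoly (Fin n) (F lam)) := by
  classical
  have hex : ∀ lam : YoungDiagram, ∃ f : SymFun, IsHomog f lam.card ∧ mCoeff lam f = 1 ∧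
      (∀ mu, mCoeff mu f ≠ 0 → DomLE mu lam) ∧ (lam.card = d →
      macOp q t z (toPoly (Fin n) f) = macEigen n q t z lam • (vdmPoly n * toPoly (Fin n) f)) := by
    intro lam
    by_cases h : lam.card = d
    · obtain ⟨f, h1, h2, h3, h4⟩ := exists_eigenfunction q t z lam (h.le.trans hd)
        fun mu hmu hne => hsep mu lam (hmu.trans h) h hne
      exact ⟨f, h1, h2, h3, fun _ => h4⟩
    -- Only degree d is of interest; m_λ serves as filler in the other degrees so that the whole
    -- family is a basis.
    · refine ⟨mon lam, isHomog_mon lam, by rw [mCoeff_mon, if_pos rfl], fun mu hmu => ?_,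
        fun hc => absurd hc h⟩
      rw [mCoeff_mon] at hmu
      by_cases hc : mu = lam
      · rw [hc]; exact DomLE.refl _
      · exact absurd (if_neg hc) hmu
  choose F h1 h2 h3 h4 using hex
  have hF : IsUnitriangular F := ⟨h1, h2, fun lam mu hmu => by
    by_cases hc : mu = lam
    · exact Or.inl hc
    · refine Or.inr ((h3 lam mu hmu).lexLT ?_ hc)
      by_contra hcard
      exact hmu (mCoeff_eq_zero (h1 lam) hcard)⟩
  exact ⟨F, hF, h3, fun lam mu hlam hmu hne =>
    form_eq_zero_of_eigen hq ht hF hd h4 hlam hmu (hsep lam mu hlam hmu hne), h4⟩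

end Orthogonality

/-! ### Uniqueness of unitriangular orthogonal families -/

section Uniqueness

variable {q t : ℂ} {F G : YoungDiagram → SymFun}

/-- The form is bilinear over ℂ, not definite, so the norm is nonzero only by nondegeneracy:
otherwise F_λ would be orthogonal to the whole basis. -/
theorem IsUnitriangular.form_self_ne_zero (hq : ‖q‖ < 1) (ht : ‖t‖ < 1) (hF : IsUnitriangular F)
    {lam : YoungDiagram}
    (ho : ∀ mu : YoungDiagram, mu.card = lam.card → mu ≠ lam → form q t (F mu) (F lam) = 0) :
    form q t (F lam) (F lam) ≠ 0 := by
  intro h0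
  have h1 : F lam = 0 := by
    apply form_eq_zero hq ht
    intro g
    induction hF.span_eq_top (x := g) trivial using Submodule.span_induction with
    | mem x hx =>
      obtain ⟨nu, rfl⟩ := hx
      by_cases hnu : nu = lam
      · rw [hnu, h0]
      · by_cases hcard : nu.card = lam.card
        · exact ho nu hcard hnu
        · exact form_eq_zero_of_ne q t (hF.homog nu) (hF.homog lam) hcard
    | zero => simp
    | add x y _ _ hx hy => rw [map_add, LinearMap.add_apply, hx, hy, add_zero]
    | smul a x _ hx => rw [map_smul, LinearMap.smul_apply, hx, smul_zero]
  have h2 := hF.diag lam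
  rw [h1, map_zero] at h2
  exact zero_ne_one h2

/-- The span of the members of a family strictly below `lam`. -/
noncomputable def lowerSpan (F : YoungDiagram → SymFun) (lam : YoungDiagram) : Submodule ℂ SymFun :=
  Submodule.span ℂ (F '' {mu | LexLT mu lam})

theorem IsUnitriangular.sub_mon_mem (hF : IsUnitriangular F) (lam : YoungDiagram) :
    F lam - mon lam ∈ lowerSpan mon lam := by
  have h1 := (hF.homog lam).eq_sum_mon
  rw [← sum_erase_add _ _ (mem_ofSize.2 rfl), hF.diag, one_smul] at h1
  rw [sub_eq_of_eq_add h1]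
  apply Submodule.sum_mem
  intro nu hnu
  rw [mem_erase] at hnu
  by_cases h0 : mCoeff nu (F lam) = 0
  · rw [h0, zero_smul]; exact Submodule.zero_mem _
  · apply Submodule.smul_mem
    exact Submodule.subset_span
      (Set.mem_image_of_mem mon ((hF.lower lam nu h0).resolve_left hnu.1))

theorem lowerSpan_mono (F : YoungDiagram → SymFun) {mu lam : YoungDiagram} (h : LexLT mu lam) :
    lowerSpan F mu ≤ lowerSpan F lam :=
  Submodule.span_mono (Set.image_mono fun _ hc => LexLT.trans hc h)

theorem IsUnitriangular.lowerSpan_eq (hF : IsUnitriangular F) (lam : YoungDiagram) :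
    lowerSpan F lam = lowerSpan mon lam := by
  induction lam using wellFounded_lexLT.induction with
  | _ lam ih =>
    apply le_antisymm
    · rw [lowerSpan, Submodule.span_le]
      rintro _ ⟨mu, hmu, rfl⟩
      have h1 := lowerSpan_mono mon hmu (hF.sub_mon_mem mu)
      have h2 := Submodule.add_mem _ h1 (Submodule.subset_span (Set.mem_image_of_mem mon hmu))
      rwa [sub_add_cancel] at h2
    · rw [lowerSpan, Submodule.span_le]
      rintro _ ⟨mu, hmu, rfl⟩
      have h1 := hF.sub_mon_mem mu
      rw [← ih mu hmu] at h1
      have h2 := Submodule.sub_mem _ (Submodule.subset_span (Set.mem_image_of_mem F hmu))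
        (lowerSpan_mono F hmu h1)
      rwa [sub_sub_cancel] at h2

theorem IsUnitriangular.isHomog_of_mem_lowerSpan (hF : IsUnitriangular F) {lam : YoungDiagram}
    {x : SymFun} (hx : x ∈ lowerSpan F lam) : IsHomog x lam.card := by
  induction hx using Submodule.span_induction with
  | mem x hx =>
    obtain ⟨nu, hnu, rfl⟩ := hx
    have := hF.homog nu
    rwa [hnu.1] at this
  | zero => exact isWeightedHomogeneous_zero _ _ _
  | add x y _ _ hx hy => exact hx.add hy
  | smul a x _ hx => exact hx.smul a

theorem form_eq_zero_of_mem_lowerSpan {lam : YoungDiagram}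
    (ho : ∀ mu, LexLT mu lam → form q t (F lam) (F mu) = 0) {x : SymFun}
    (hx : x ∈ lowerSpan F lam) : form q t (F lam) x = 0 := by
  induction hx using Submodule.span_induction with
  | mem x hx =>
    obtain ⟨nu, hnu, rfl⟩ := hx
    exact ho nu hnu
  | zero => simp
  | add x y _ _ hx hy => rw [map_add, hx, hy, add_zero]
  | smul a x _ hx => rw [map_smul, hx, smul_zero]

theorem LexLT.ne {a b : YoungDiagram} (h : LexLT a b) : a ≠ b := by
  rintro rfl
  exact LexLT.irrefl _ h

/-- Unitriangularity and orthogonality determine a family in each degree. -/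
theorem IsUnitriangular.eq_of_orthogonal (hq : ‖q‖ < 1) (ht : ‖t‖ < 1) (hF : IsUnitriangular F)
    {lam : YoungDiagram}
    (hoF : ∀ mu nu : YoungDiagram, mu.card = lam.card → nu.card = lam.card → mu ≠ nu →
      form q t (F mu) (F nu) = 0) {g : SymFun} (hg : g - mon lam ∈ lowerSpan mon lam)
    (hog : ∀ x ∈ lowerSpan mon lam, form q t g x = 0) : g = F lam := by
  -- F_λ and g are both m_λ plus an element of the same lower span, and both are orthogonal to that
  -- span. Their difference lies in the span and is orthogonal to it, so its coefficients vanish one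
  -- by one.
  have h1 : F lam - g ∈ lowerSpan F lam := by
    rw [hF.lowerSpan_eq]
    have := Submodule.sub_mem _ (hF.sub_mon_mem lam) hg
    rwa [sub_sub_sub_cancel_right] at this
  have h2 : ∀ mu, LexLT mu lam → form q t (F mu) (F lam - g) = 0 := by
    intro mu hmu
    rw [map_sub, hoF mu lam hmu.1 rfl hmu.ne, form_comm, hog _ _, sub_zero]
    rw [← hF.lowerSpan_eq]
    exact Submodule.subset_span (Set.mem_image_of_mem F hmu)
  have h3 : ∀ mu, hF.basis.repr (F lam - g) mu = 0 := by
    intro mu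
    have hfin : (hF.basis.repr (F lam - g)).support ⊆ ofSize lam.card := by
      intro nu hnu
      rw [mem_ofSize]
      by_contra hc
      refine Finsupp.mem_support_iff.1 hnu (hF.repr_eq_zero (d := lam.card) ?_ hc)
      exact hF.isHomog_of_mem_lowerSpan h1
    by_cases hmu : LexLT mu lam
    · have h4 := h2 mu hmu
      have h5 : F lam - g = ∑ nu ∈ ofSize lam.card, hF.basis.repr (F lam - g) nu • F nu := by
        conv_lhs => rw [← hF.basis.linearCombination_repr (F lam - g)]
        rw [Finsupp.linearCombination_apply, Finsupp.sum_of_support_subset _ hfin]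
        · simp
        · simp
      rw [h5, map_sum, sum_eq_single mu] at h4
      · rw [map_smul, smul_eq_mul] at h4
        refine (mul_eq_zero.1 h4).resolve_right (hF.form_self_ne_zero hq ht fun nu hnu hne => ?_)
        exact hoF nu mu (hnu.trans hmu.1) hmu.1 hne
      · intro nu hnu hne
        rw [map_smul, hoF mu nu hmu.1 (mem_ofSize.1 hnu) hne.symm, smul_zero]
      · intro h
        exact absurd (mem_ofSize.2 hmu.1) h
    · have := (hF.basis.mem_span_image (m := F lam - g) (s := {mu | LexLT mu lam})).1 (by
        have : (hF.basis : YoungDiagram → SymFun) = F := funext hF.basis_apply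
        rw [this]
        exact h1)
      by_contra hc
      exact hmu (this (Finsupp.mem_support_iff.2 hc))
  have h4 : hF.basis.repr (F lam - g) = 0 := Finsupp.ext h3
  rw [LinearEquiv.map_eq_zero_iff, sub_eq_zero] at h4
  exact h4.symm

end Uniqueness

end Macdonald

namespace Macdonald

open MvPolynomial Finset

/-! ### Holomorphy in (q, t) and a Hurwitz argument -/

section Analytic

/-- The open unit polydisc. -/
abbrev polydisc : Set (ℂ × ℂ) := Metric.ball 0 1

theorem mem_polydisc {p : ℂ × ℂ} : p ∈ polydisc ↔ ‖p.1‖ < 1 ∧ ‖p.2‖ < 1 := by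
  rw [polydisc, mem_ball_zero_iff, Prod.norm_def, max_lt_iff]

theorem differentiableOn_prod {ι : Type*} (u : Finset ι) {f : ι → ℂ × ℂ → ℂ} {s : Set (ℂ × ℂ)}
    (h : ∀ i ∈ u, DifferentiableOn ℂ (f i) s) : DifferentiableOn ℂ (fun p => ∏ i ∈ u, f i p) s := by
  classical
  induction u using Finset.induction_on with
  | empty => simp
  | insert a u ha ih =>
    simp_rw [prod_insert ha]
    exact (h a (mem_insert_self a u)).mul (ih fun i hi => h i (mem_insert_of_mem hi))

theorem differentiableOn_powerSumNorm (d : ℕ+ →₀ ℕ) :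
    DifferentiableOn ℂ (fun p : ℂ × ℂ => powerSumNorm p.1 p.2 d) polydisc := by
  unfold powerSumNorm Finsupp.prod
  have h : ∀ k : ℕ+, DifferentiableOn ℂ (fun p : ℂ × ℂ => ((1 - p.1 ^ (k : ℕ)) /
      (1 - p.2 ^ (k : ℕ))) ^ d k * (((k : ℕ) : ℂ) ^ d k * ((d k).factorial : ℂ))) polydisc := by
    intro k
    simp_rw [div_eq_mul_inv]
    have h1 : DifferentiableOn ℂ (fun p : ℂ × ℂ => (1 - p.2 ^ (k : ℕ))⁻¹) polydisc :=
      DifferentiableOn.fun_inv (by fun_prop) fun p hp =>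
        one_sub_pow_ne_zero (mem_polydisc.1 hp).2 k.ne_zero
    have h2 : DifferentiableOn ℂ (fun p : ℂ × ℂ => 1 - p.1 ^ (k : ℕ)) polydisc := by fun_prop
    exact ((h2.mul h1).pow _).mul_const _
  exact differentiableOn_prod _ fun k _ => h k

theorem differentiableOn_form (f g : SymFun) :
    DifferentiableOn ℂ (fun p : ℂ × ℂ => form p.1 p.2 f g) polydisc := by
  simp only [form_apply, scalarProduct]
  refine DifferentiableOn.fun_sum fun d _ => ?_
  exact (differentiableOn_powerSumNorm d).const_mul _

theorem differentiableOn_det {ι : Type*} [Fintype ι] [DecidableEq ι] {s : Set (ℂ × ℂ)}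
    {M : ℂ × ℂ → Matrix ι ι ℂ} (hM : ∀ i j, DifferentiableOn ℂ (fun p => M p i j) s) :
    DifferentiableOn ℂ (fun p => (M p).det) s := by
  simp only [Matrix.det_apply]
  refine DifferentiableOn.fun_sum fun σ _ => ?_
  apply DifferentiableOn.const_smul
  exact differentiableOn_prod _ fun i _ => hM _ _

/-- A weak form of Hurwitz's theorem. -/
theorem ne_zero_of_forall_mul_ne_zero {H : ℂ × ℂ → ℂ} (hH : DifferentiableOn ℂ H polydisc)
    (h00 : H (0, 0) ≠ 0) (h : ∀ p ∈ polydisc, p.1 ≠ 0 → p.2 ≠ 0 → H p ≠ 0) {t : ℂ} (ht : ‖t‖ < 1) :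
    H (0, t) ≠ 0 := by
  intro hzero
  have ht0 : t ≠ 0 := by rintro rfl; exact h00 hzero
  have hmaps : ∀ q : ℂ, ‖q‖ < 1 → Set.MapsTo (fun z => (q, z)) (Metric.ball (0 : ℂ) 1) polydisc := by
    intro q hq z hz
    exact mem_polydisc.2 ⟨hq, by simpa using hz⟩
  have hdiff : ∀ q : ℂ, ‖q‖ < 1 → DifferentiableOn ℂ (fun z => H (q, z)) (Metric.ball 0 1) :=
    fun q hq => hH.comp (by fun_prop) (hmaps q hq)
  have han : AnalyticOnNhd ℂ (fun z => H (0, z)) (Metric.ball 0 1) :=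
    (hdiff 0 (by simp)).analyticOnNhd Metric.isOpen_ball
  have htb : t ∈ Metric.ball (0 : ℂ) 1 := by simpa using ht
  -- The slice H(0, ·) is nonzero at the origin, so its supposed zero t is isolated. The disc around
  -- t is chosen to contain no other zero of the slice and not the point 0.
  have hne : ∀ᶠ z in nhdsWithin t {t}ᶜ, H (0, z) ≠ 0 := by
    rcases (han t htb).eventually_eq_zero_or_eventually_ne_zero with h1 | h1
    · exfalso
      exact h00 (han.eqOn_zero_of_preconnected_of_eventuallyEq_zero
        (convex_ball (0 : ℂ) 1).isPreconnected htb h1 (Metric.mem_ball_self one_pos))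
    · exact h1
  have hev : ∀ᶠ z in nhds t, (z ≠ t → H (0, z) ≠ 0) ∧ z ≠ 0 ∧ z ∈ Metric.ball (0 : ℂ) 1 :=
    (eventually_nhdsWithin_iff.1 hne).and ((isOpen_ne.eventually_mem ht0).and
      (Metric.isOpen_ball.eventually_mem htb))
  obtain ⟨r, hr, hball⟩ := Metric.nhds_basis_closedBall.eventually_iff.1 hev
  have hcont : ∀ z ∈ Metric.sphere t r, ContinuousAt H (0, z) := fun z hz =>
    (hH.continuousOn).continuousAt (Metric.isOpen_ball.mem_nhds
      (hmaps 0 (by simp) (hball (Metric.sphere_subset_closedBall hz)).2.2))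
  have hcs : IsCompact (Metric.sphere t r) := isCompact_sphere _ _
  obtain ⟨m, hm0, hm⟩ : ∃ m : ℝ, 0 < m ∧ ∀ z ∈ Metric.sphere t r, m < ‖H (0, z)‖ := by
    have hsne : (Metric.sphere t r).Nonempty := NormedSpace.sphere_nonempty.2 hr.le
    have hco : ContinuousOn (fun z => ‖H (0, z)‖) (Metric.sphere t r) := by
      refine ContinuousOn.norm ((hdiff 0 (by simp)).continuousOn.mono fun z hz => ?_)
      exact (hball (Metric.sphere_subset_closedBall hz)).2.2
    obtain ⟨w, hw, hmin⟩ := hcs.exists_isMinOn hsne hco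
    have hw0 : 0 < ‖H (0, w)‖ := by
      apply norm_pos_iff.2
      refine (hball (Metric.sphere_subset_closedBall hw)).1 ?_
      rintro rfl
      rw [Metric.mem_sphere, dist_self] at hw
      exact hr.ne hw
    exact ⟨‖H (0, w)‖ / 2, by positivity, fun z hz => by
      have := hmin hz
      simp only [Set.mem_ofPred_eq] at this
      linarith⟩
  have e1 : ∀ᶠ q in nhds (0 : ℂ), ∀ z ∈ Metric.sphere t r, m < ‖H (q, z)‖ := by
    apply hcs.eventually_forall_of_forall_eventually
    intro z hz
    exact (hcont z hz).norm.eventually (lt_mem_nhds (hm z hz))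
  have e2 : ∀ᶠ q in nhds (0 : ℂ), ‖H (q, t)‖ < m := by
    have hc : ContinuousAt H (0, t) :=
      (hH.continuousOn).continuousAt (Metric.isOpen_ball.mem_nhds (hmaps 0 (by simp) htb))
    have hc2 : ContinuousAt (fun q => ‖H (q, t)‖) 0 :=
      (ContinuousAt.comp (f := fun q => (q, t)) (x := (0 : ℂ)) hc (by fun_prop)).norm
    apply hc2.eventually (gt_mem_nhds _)
    simpa [hzero] using hm0
  have e3 : ∀ᶠ q in nhds (0 : ℂ), ‖q‖ < 1 := by
    filter_upwards [Metric.ball_mem_nhds (0 : ℂ) one_pos] with q hq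
    simpa using hq
  obtain ⟨q, ⟨hq1, hq2, hq3⟩, hq0⟩ := ((((e1.and (e2.and e3)).filter_mono
    nhdsWithin_le_nhds).and self_mem_nhdsWithin) :
      ∀ᶠ q in nhdsWithin (0 : ℂ) {0}ᶜ, _ ∧ q ∈ ({0}ᶜ : Set ℂ)).exists
  have hsub : Metric.closedBall t r ⊆ Metric.ball 0 1 := fun z hz => (hball hz).2.2
  have hnz : ∀ z ∈ Metric.closedBall t r, H (q, z) ≠ 0 := fun z hz =>
    h (q, z) (hmaps q hq3 (hsub hz)) hq0 (hball hz).2.1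
  -- For this small q ≠ 0 the slice H(q, ·) has no zero on the closed disc and exceeds m in modulus
  -- on the circle. The maximum principle for the reciprocal gives |H(q, t)| ≥ m, against |H(q, t)|
  -- < m by continuity.
  have hd : DifferentiableOn ℂ (fun z => (H (q, z))⁻¹) (Metric.closedBall t r) :=
    ((hdiff q hq3).mono hsub).inv hnz
  have hfin := Complex.norm_le_of_forall_mem_frontier_norm_le (U := Metric.ball t r)
    Metric.isBounded_ball (C := m⁻¹) (DifferentiableOn.diffContOnCl (by
      rwa [closure_ball t hr.ne'])) (fun z hz => by
      rw [frontier_ball t hr.ne'] at hz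
      rw [norm_inv]
      exact inv_anti₀ hm0 (hq1 z hz).le) (subset_closure (Metric.mem_ball_self hr))
  rw [norm_inv, inv_le_inv₀ (norm_pos_iff.2 (hnz t (Metric.mem_closedBall_self hr.le))) hm0] at hfin
  linarith

end Analytic

/-! ### Nonvanishing of the Gram determinants -/

section Gram

/-- Nondegeneracy of the scalar product on the span below a partition. -/
def NondegenerateBelow (q t : ℂ) (lam : YoungDiagram) : Prop :=
  ∀ x ∈ lowerSpan mon lam, (∀ y ∈ lowerSpan mon lam, form q t x y = 0) → x = 0

theorem nondegenerateBelow_of_orthogonal {q t : ℂ} (hq : ‖q‖ < 1) (ht : ‖t‖ < 1)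
    {F : YoungDiagram → SymFun} (hF : IsUnitriangular F) {lam : YoungDiagram}
    (hoF : ∀ mu nu : YoungDiagram, mu.card = lam.card → nu.card = lam.card → mu ≠ nu →
      form q t (F mu) (F nu) = 0) : NondegenerateBelow q t lam := by
  intro x hx h
  rw [← hF.lowerSpan_eq] at hx h
  have hhom := hF.isHomog_of_mem_lowerSpan hx
  have hsupp : ↑(hF.basis.repr x).support ⊆ {mu | LexLT mu lam} :=
    (hF.basis.mem_span_image (m := x)).1 (by
      rw [show (hF.basis : YoungDiagram → SymFun) = F from funext hF.basis_apply]
      exact hx)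
  rw [← LinearEquiv.map_eq_zero_iff hF.basis.repr]
  ext mu
  rw [Finsupp.zero_apply]
  by_contra hc
  have hmu : LexLT mu lam := hsupp (Finsupp.mem_support_iff.2 hc)
  have h1 := h _ (Submodule.subset_span (Set.mem_image_of_mem F hmu))
  rw [hF.eq_sum_repr hhom, map_sum, LinearMap.sum_apply, sum_eq_single mu] at h1
  · rw [map_smul, LinearMap.smul_apply, smul_eq_mul] at h1
    rcases mul_eq_zero.1 h1 with h2 | h2
    · exact hc h2
    · exact hF.form_self_ne_zero hq ht (lam := mu)
        (fun nu hnu hne => hoF nu mu (hnu.trans hmu.1) hmu.1 hne) h2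
  · intro nu hnu hne
    rw [map_smul, LinearMap.smul_apply, hoF nu mu (mem_ofSize.1 hnu) hmu.1 hne, smul_zero]
  · intro hn
    exact absurd (mem_ofSize.2 hmu.1) hn

theorem nondegenerateBelow_of_ne_zero {q t : ℂ} (hq0 : q ≠ 0) (ht0 : t ≠ 0) (hq : ‖q‖ < 1)
    (ht : ‖t‖ < 1) (lam : YoungDiagram) : NondegenerateBelow q t lam := by
  obtain ⟨z, hz⟩ := (finite_not_separating hq0 ht0 hq ht (le_refl lam.card)).exists_notMem
  obtain ⟨F, hF, _, ho, _⟩ := exists_orthogonal_eigenfamily hq ht (le_refl lam.card) (z := z)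
    fun a b ha hb hne heq => hz ⟨a, mem_ofSize.2 ha, b, mem_ofSize.2 hb, hne, heq⟩
  exact nondegenerateBelow_of_orthogonal hq ht hF ho

theorem toPoly_map_conj (n : ℕ) (f : SymFun) :
    toPoly (Fin n) (map (starRingEnd ℂ) f) = map (starRingEnd ℂ) (toPoly (Fin n) f) := by
  induction f using MvPolynomial.induction_on with
  | C a => simp
  | add f g hf hg => simp only [map_add, hf, hg]
  | mul_X f k hf => 
    rw [map_mul, map_mul, map_mul, map_mul, hf, map_X, toPoly_X, psum, map_sum]
    simp

theorem mCoeff_map_conj (nu : YoungDiagram) (f : SymFun) :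
    mCoeff nu (map (starRingEnd ℂ) f) = starRingEnd ℂ (mCoeff nu f) := by
  rw [mCoeff_eq_coeff le_rfl, mCoeff_eq_coeff le_rfl, toPoly_map_conj, coeff_map]

theorem map_conj_mon (lam : YoungDiagram) : map (starRingEnd ℂ) (mon lam) = mon lam := by
  rw [← sub_eq_zero]
  apply mCoeff_ext
  intro nu
  rw [map_sub, mCoeff_map_conj, mCoeff_mon]
  split_ifs <;> simp

theorem map_conj_mem_lowerSpan {lam : YoungDiagram} {x : SymFun} (hx : x ∈ lowerSpan mon lam) :
    map (starRingEnd ℂ) x ∈ lowerSpan mon lam := by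
  induction hx using Submodule.span_induction with
  | mem x hx =>
    obtain ⟨nu, hnu, rfl⟩ := hx
    rw [map_conj_mon]
    exact Submodule.subset_span (Set.mem_image_of_mem mon hnu)
  | zero => simp
  | add x y _ _ hx hy => rw [map_add]; exact Submodule.add_mem _ hx hy
  | smul a x _ hx =>
    rw [smul_eq_C_mul, map_mul, map_C, ← smul_eq_C_mul]
    exact Submodule.smul_mem _ _ hx

/-- At q = t = 0 the norms of the p_λ are positive reals, so pairing x with its conjugate is a
positive definite expression. Conjugation stays in the span because it fixes the m_μ. -/
theorem nondegenerateBelow_zero (lam : YoungDiagram) : NondegenerateBelow 0 0 lam := by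
  intro x hx h
  have h1 := h _ (map_conj_mem_lowerSpan hx)
  rw [form_apply, scalarProduct] at h1
  have hnorm : ∀ d : ℕ+ →₀ ℕ, ∃ r : ℝ, 0 < r ∧ powerSumNorm 0 0 d = (r : ℂ) := by
    intro d
    refine ⟨d.prod fun k m => (k : ℝ) ^ m * (m.factorial : ℝ), ?_, ?_⟩
    · refine prod_pos fun k _ => ?_
      have : (0 : ℝ) < (k : ℕ) := by exact_mod_cast k.pos
      have := Nat.factorial_pos (d k)
      positivity
    · simp [powerSumNorm, Finsupp.prod]
  choose r hr hr' using hnorm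
  have h2 : ∑ d ∈ x.support, ‖x.coeff d‖ ^ 2 * r d = 0 := by
    have : ((∑ d ∈ x.support, ‖x.coeff d‖ ^ 2 * r d : ℝ) : ℂ) = 0 := by
      rw [← h1]
      push_cast
      refine sum_congr rfl fun d _ => ?_
      rw [coeff_map, hr', Complex.mul_conj']
    exact_mod_cast this
  rw [sum_eq_zero_iff_of_nonneg fun d _ => mul_nonneg (sq_nonneg _) (hr d).le] at h2
  ext d
  rw [coeff_zero]
  by_contra hc
  have h3 := h2 d (mem_support_iff.2 hc)
  have h4 := hr d
  have h5 := norm_pos_iff.2 hc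
  have : 0 < ‖coeff d x‖ ^ 2 * r d := by positivity
  linarith

/-- The partitions below `lam`. -/
noncomputable def below (lam : YoungDiagram) : Finset YoungDiagram := (finite_lexLT lam).toFinset

@[simp]
theorem mem_below {lam mu : YoungDiagram} : mu ∈ below lam ↔ LexLT mu lam := by simp [below]

/-- The Gram matrix of the monomial symmetric functions below `lam`. -/
noncomputable def gram (q t : ℂ) (lam : YoungDiagram) : Matrix (below lam) (below lam) ℂ :=
  Matrix.of fun i j => form q t (mon i) (mon j)

theorem sum_mon_mem_lowerSpan (lam : YoungDiagram) (v : below lam → ℂ) :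
    ∑ i, v i • mon (i : YoungDiagram) ∈ lowerSpan mon lam :=
  Submodule.sum_mem _ fun i _ => Submodule.smul_mem _ _
    (Submodule.subset_span (Set.mem_image_of_mem mon (mem_below.1 i.2)))

theorem form_mon_sum (q t : ℂ) (lam : YoungDiagram) (v : below lam → ℂ) (i : below lam) :
    form q t (mon i) (∑ j, v j • mon (j : YoungDiagram)) = (gram q t lam).mulVec v i := by
  rw [map_sum, Matrix.mulVec, dotProduct]
  refine sum_congr rfl fun j _ => ?_
  rw [map_smul, gram, Matrix.of_apply, smul_eq_mul, mul_comm]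

theorem form_eq_zero_of_forall_mon {q t : ℂ} {lam : YoungDiagram} {g : SymFun}
    (h : ∀ mu, LexLT mu lam → form q t (mon mu) g = 0) {x : SymFun} (hx : x ∈ lowerSpan mon lam) :
    form q t x g = 0 := by
  induction hx using Submodule.span_induction with
  | mem x hx =>
    obtain ⟨nu, hnu, rfl⟩ := hx
    exact h nu hnu
  | zero => simp
  | add x y _ _ hx hy => rw [map_add, LinearMap.add_apply, hx, hy, add_zero]
  | smul a x _ hx => rw [map_smul, LinearMap.smul_apply, hx, smul_zero]

theorem eq_sum_of_mem_lowerSpan {lam : YoungDiagram} {x : SymFun} (hx : x ∈ lowerSpan mon lam) :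
    x = ∑ i : below lam, mCoeff i x • mon (i : YoungDiagram) := by
  induction hx using Submodule.span_induction with
  | mem x hx =>
    obtain ⟨nu, hnu, rfl⟩ := hx
    rw [sum_eq_single ⟨nu, mem_below.2 hnu⟩]
    · rw [mCoeff_mon, if_pos rfl, one_smul]
    · intro j _ hj
      rw [mCoeff_mon, if_neg (fun h => hj (Subtype.ext h)), zero_smul]
    · simp
  | zero => simp
  | add x y _ _ hx hy =>
    simp_rw [map_add, add_smul, sum_add_distrib]
    rw [← hx, ← hy]
  | smul a x _ hx =>
    simp_rw [map_smul, smul_assoc]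
    rw [← smul_sum, ← hx]

theorem det_gram_ne_zero_iff {q t : ℂ} {lam : YoungDiagram} :
    (gram q t lam).det ≠ 0 ↔ NondegenerateBelow q t lam := by
  rw [← not_iff_not, not_not, ← Matrix.exists_mulVec_eq_zero_iff]
  constructor
  · rintro ⟨v, hv, h⟩ hn
    have h1 := hn _ (sum_mon_mem_lowerSpan lam v) fun y hy => by
      rw [form_comm]
      refine form_eq_zero_of_forall_mon (fun mu hmu => ?_) hy
      have := form_mon_sum q t lam v ⟨mu, mem_below.2 hmu⟩
      rwa [h] at this
    apply hv
    ext i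
    have h2 := congrArg (mCoeff i) h1
    rw [map_sum, map_zero, sum_eq_single i] at h2
    · rwa [map_smul, mCoeff_mon, if_pos rfl, smul_eq_mul, mul_one] at h2
    · intro j _ hj
      rw [map_smul, mCoeff_mon, if_neg (fun h => hj (Subtype.ext h.symm)), smul_zero]
    · simp
  · intro h
    rw [NondegenerateBelow] at h
    push Not at h
    obtain ⟨x, hx, hx', hne⟩ := h
    have hsum := eq_sum_of_mem_lowerSpan hx
    refine ⟨fun i => mCoeff i x, fun hc => hne ?_, ?_⟩
    · rw [hsum]
      exact sum_eq_zero fun i _ => by rw [show mCoeff i x = 0 from congrFun hc i, zero_smul]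
    · ext i
      rw [← form_mon_sum, ← hsum, form_comm, hx' _ (Submodule.subset_span
        (Set.mem_image_of_mem mon (mem_below.1 i.2)))]
      rfl

/-- For qt ≠ 0 nondegeneracy comes from the orthogonal eigenfunctions, at the origin from
positivity. Hurwitz extends it to the axis q = 0, and after exchanging the coordinates to t = 0. -/
theorem det_gram_ne_zero {q t : ℂ} (hq : ‖q‖ < 1) (ht : ‖t‖ < 1) (lam : YoungDiagram) :
    (gram q t lam).det ≠ 0 := by
  have hd : DifferentiableOn ℂ (fun p : ℂ × ℂ => (gram p.1 p.2 lam).det) polydisc :=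
    differentiableOn_det fun i j => differentiableOn_form _ _
  have h0 : (gram 0 0 lam).det ≠ 0 := det_gram_ne_zero_iff.2 (nondegenerateBelow_zero lam)
  have h1 : ∀ p ∈ polydisc, p.1 ≠ 0 → p.2 ≠ 0 → (gram p.1 p.2 lam).det ≠ 0 := fun p hp h h' =>
    det_gram_ne_zero_iff.2 (nondegenerateBelow_of_ne_zero h h' (mem_polydisc.1 hp).1
      (mem_polydisc.1 hp).2 lam)
  by_cases hq0 : q = 0
  · rw [hq0]
    exact ne_zero_of_forall_mul_ne_zero hd h0 h1 ht
  by_cases ht0 : t = 0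
  · rw [ht0]
    have hmaps : Set.MapsTo (fun p : ℂ × ℂ => (p.2, p.1)) polydisc polydisc := fun p hp =>
      mem_polydisc.2 (mem_polydisc.1 hp).symm
    have hd' : DifferentiableOn ℂ (fun p : ℂ × ℂ => (gram p.2 p.1 lam).det) polydisc :=
      differentiableOn_det fun i j => (differentiableOn_form (mon i) (mon j)).comp
        (f := fun p : ℂ × ℂ => (p.2, p.1)) (by fun_prop) hmaps
    have h1' : ∀ p ∈ polydisc, p.1 ≠ 0 → p.2 ≠ 0 → (gram p.2 p.1 lam).det ≠ 0 :=
      fun p hp h h' => h1 (p.2, p.1) (hmaps hp) h' h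
    exact ne_zero_of_forall_mul_ne_zero hd' h0 h1' hq
  · exact h1 (q, t) (mem_polydisc.2 ⟨hq, ht⟩) hq0 ht0

end Gram

end Macdonald

namespace Macdonald

open MvPolynomial Finset

/-! ### Existence and uniqueness of the Macdonald family -/

section Family

/-- The Gram–Schmidt family. -/
noncomputable def gramFamily (q t : ℂ) (lam : YoungDiagram) : SymFun :=
  mon lam - ∑ i : below lam, ((gram q t lam)⁻¹.mulVec fun j => form q t (mon j) (mon lam)) i •
    mon (i : YoungDiagram)

theorem gramFamily_sub_mon_mem (q t : ℂ) (lam : YoungDiagram) :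
    gramFamily q t lam - mon lam ∈ lowerSpan mon lam := by
  rw [gramFamily, sub_sub_cancel_left]
  exact Submodule.neg_mem _ (sum_mon_mem_lowerSpan lam _)

theorem form_gramFamily {q t : ℂ} (hq : ‖q‖ < 1) (ht : ‖t‖ < 1) {lam : YoungDiagram} {x : SymFun}
    (hx : x ∈ lowerSpan mon lam) : form q t x (gramFamily q t lam) = 0 := by
  refine form_eq_zero_of_forall_mon (fun mu hmu => ?_) hx
  have h1 := form_mon_sum q t lam ((gram q t lam)⁻¹.mulVec fun j => form q t (mon j) (mon lam))
    ⟨mu, mem_below.2 hmu⟩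
  rw [Matrix.mulVec_mulVec, Matrix.mul_nonsing_inv _ (det_gram_ne_zero hq ht lam).isUnit,
    Matrix.one_mulVec] at h1
  rw [gramFamily, map_sub, h1, sub_self]

theorem isUnitriangular_of_sub_mon_mem {F : YoungDiagram → SymFun}
    (h : ∀ lam, F lam - mon lam ∈ lowerSpan mon lam) : IsUnitriangular F := by
  have hF : ∀ lam, F lam = (F lam - mon lam) + mon lam := fun lam => (sub_add_cancel _ _).symm
  have key : ∀ lam mu, mCoeff mu (F lam - mon lam) ≠ 0 → LexLT mu lam := by
    intro lam mu hmu
    rw [eq_sum_of_mem_lowerSpan (h lam), map_sum] at hmu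
    obtain ⟨i, _, hi⟩ := exists_ne_zero_of_sum_ne_zero hmu
    rw [map_smul, mCoeff_mon] at hi
    have : mu = i := by
      by_contra hc
      rw [if_neg hc, smul_zero] at hi
      exact hi rfl
    rw [this]
    exact mem_below.1 i.2
  refine ⟨fun lam => ?_, fun lam => ?_, fun lam mu hmu => ?_⟩
  · rw [hF lam]
    exact (isUnitriangular_mon.isHomog_of_mem_lowerSpan (h lam)).add (isHomog_mon lam)
  · rw [hF lam, map_add, mCoeff_mon, if_pos rfl, add_eq_right]
    by_contra hc
    exact LexLT.irrefl _ (key _ _ hc)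
  · by_cases hc : mu = lam
    · exact Or.inl hc
    · right
      apply key
      rwa [map_sub, mCoeff_mon, if_neg hc, sub_zero]

theorem isUnitriangular_gramFamily (q t : ℂ) : IsUnitriangular (gramFamily q t) :=
  isUnitriangular_of_sub_mon_mem (gramFamily_sub_mon_mem q t)

theorem form_gramFamily_of_ne {q t : ℂ} (hq : ‖q‖ < 1) (ht : ‖t‖ < 1) {lam mu : YoungDiagram}
    (h : lam ≠ mu) : form q t (gramFamily q t lam) (gramFamily q t mu) = 0 := by
  have hF := isUnitriangular_gramFamily q t
  have key : ∀ {a b}, LexLT a b → form q t (gramFamily q t a) (gramFamily q t b) = 0 := by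
    intro a b hab
    apply form_gramFamily hq ht
    rw [← hF.lowerSpan_eq]
    exact Submodule.subset_span (Set.mem_image_of_mem _ hab)
  by_cases hc : lam.card = mu.card
  · rcases LexLT.trichotomy hc with h1 | h1 | h1
    · exact key h1
    · exact absurd h1 h
    · rw [form_comm]; exact key h1
  · exact form_eq_zero_of_ne q t (hF.homog lam) (hF.homog mu) hc

theorem isMacdonaldFamily_gramFamily {q t : ℂ} (hq : ‖q‖ < 1) (ht : ‖t‖ < 1) :
    IsMacdonaldFamily q t (gramFamily q t) where
  triangular lam := by
    set v := (gram q t lam)⁻¹.mulVec fun j => form q t (mon j) (mon lam) with hv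
    refine ⟨Finsupp.onFinset (below lam) (fun mu => if h : mu ∈ below lam then -v ⟨mu, h⟩ else 0)
      (fun mu h => ?_), fun mu hmu => ?_, fun n => ?_⟩
    · by_contra hc
      exact h (dif_neg hc)
    · exact mem_below.1 (Finsupp.support_onFinset_subset hmu)
    · rw [← toPoly_mon, sum_subset Finsupp.support_onFinset_subset fun mu _ hmu => by
          rw [Finsupp.notMem_support_iff.1 hmu, zero_smul], gramFamily, map_sub, sub_eq_add_neg,
        map_sum, ← sum_neg_distrib, ← sum_coe_sort (below lam)]
      congr 1
      refine sum_congr rfl fun i _ => ?_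
      rw [Finsupp.onFinset_apply, dif_pos i.2, map_smul, toPoly_mon, neg_smul]
  orthogonal lam mu h := form_gramFamily_of_ne hq ht h

theorem IsMacdonaldFamily.sub_mon_mem {q t : ℂ} {P : YoungDiagram → SymFun}
    (hP : IsMacdonaldFamily q t P) (lam : YoungDiagram) : P lam - mon lam ∈ lowerSpan mon lam := by
  obtain ⟨R, hR, h⟩ := hP.triangular lam
  have h1 : P lam - mon lam = ∑ mu ∈ R.support, R mu • mon mu := by
    rw [← sub_eq_zero]
    apply toPoly_injective (N := 0)
    intro n _
    simp_rw [map_sub, map_sum, map_smul, toPoly_mon]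
    rw [h n]
    ring
  rw [h1]
  exact Submodule.sum_mem _ fun mu hmu => Submodule.smul_mem _ _
    (Submodule.subset_span (Set.mem_image_of_mem mon (hR mu hmu)))

theorem isMacdonaldFamily_macP {q t : ℂ} (hq : ‖q‖ < 1) (ht : ‖t‖ < 1) :
    IsMacdonaldFamily q t (macP q t) :=
  Classical.epsilon_spec ⟨_, isMacdonaldFamily_gramFamily hq ht⟩

variable {q t : ℂ}

theorem isUnitriangular_macP (hq : ‖q‖ < 1) (ht : ‖t‖ < 1) : IsUnitriangular (macP q t) :=
  isUnitriangular_of_sub_mon_mem (isMacdonaldFamily_macP hq ht).sub_mon_mem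

theorem form_macP_of_ne (hq : ‖q‖ < 1) (ht : ‖t‖ < 1) {lam mu : YoungDiagram} (h : lam ≠ mu) :
    form q t (macP q t lam) (macP q t mu) = 0 :=
  (isMacdonaldFamily_macP hq ht).orthogonal lam mu h

theorem form_macP_self_ne_zero (hq : ‖q‖ < 1) (ht : ‖t‖ < 1) (lam : YoungDiagram) :
    form q t (macP q t lam) (macP q t lam) ≠ 0 :=
  (isUnitriangular_macP hq ht).form_self_ne_zero hq ht fun _ _ h => form_macP_of_ne hq ht h

theorem form_macP_lowerSpan (hq : ‖q‖ < 1) (ht : ‖t‖ < 1) (lam : YoungDiagram) {x : SymFun}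
    (hx : x ∈ lowerSpan mon lam) : form q t (macP q t lam) x = 0 := by
  rw [← (isUnitriangular_macP hq ht).lowerSpan_eq] at hx
  exact form_eq_zero_of_mem_lowerSpan (fun mu hmu => form_macP_of_ne hq ht hmu.ne.symm) hx

theorem macP_eq_of_orthogonal (hq : ‖q‖ < 1) (ht : ‖t‖ < 1) {F : YoungDiagram → SymFun}
    (hF : IsUnitriangular F) {lam : YoungDiagram}
    (hoF : ∀ mu nu : YoungDiagram, mu.card = lam.card → nu.card = lam.card → mu ≠ nu →
      form q t (F mu) (F nu) = 0) : macP q t lam = F lam :=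
  hF.eq_of_orthogonal hq ht hoF ((isUnitriangular_macP hq ht).sub_mon_mem lam)
    fun _ hx => form_macP_lowerSpan hq ht lam hx

theorem macP_eq_gramFamily (hq : ‖q‖ < 1) (ht : ‖t‖ < 1) (lam : YoungDiagram) :
    macP q t lam = gramFamily q t lam :=
  macP_eq_of_orthogonal hq ht (isUnitriangular_gramFamily q t)
    fun _ _ _ _ h => form_gramFamily_of_ne hq ht h

end Family

/-! ### Holomorphy of the coefficients and passage to the axes -/

section Continuity

theorem differentiableOn_gram_inv (lam : YoungDiagram) (i j : below lam) :
    DifferentiableOn ℂ (fun p : ℂ × ℂ => (gram p.1 p.2 lam)⁻¹ i j) polydisc := by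
  simp_rw [Matrix.inv_def, Ring.inverse_eq_inv', Matrix.smul_apply, Matrix.adjugate_apply,
    smul_eq_mul]
  have hg : ∀ i j, DifferentiableOn ℂ (fun p : ℂ × ℂ => gram p.1 p.2 lam i j) polydisc :=
    fun i j => differentiableOn_form _ _
  refine DifferentiableOn.mul ((differentiableOn_det hg).fun_inv fun p hp =>
    det_gram_ne_zero (mem_polydisc.1 hp).1 (mem_polydisc.1 hp).2 lam)
    (differentiableOn_det fun a b => ?_)
  by_cases ha : a = j
  · subst ha
    simp only [Matrix.updateRow_self]
    exact differentiableOn_const _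
  · simp only [Matrix.updateRow_ne ha]
    exact hg a b

theorem differentiableOn_mCoeff_macP (lam mu : YoungDiagram) :
    DifferentiableOn ℂ (fun p : ℂ × ℂ => mCoeff mu (macP p.1 p.2 lam)) polydisc := by
  have h : DifferentiableOn ℂ (fun p : ℂ × ℂ => mCoeff mu (gramFamily p.1 p.2 lam)) polydisc := by
    simp only [gramFamily, map_sub, map_sum, map_smul, smul_eq_mul]
    refine (differentiableOn_const _).sub (DifferentiableOn.fun_sum fun i _ => ?_)
    refine DifferentiableOn.mul_const ?_ _
    simp only [Matrix.mulVec, dotProduct]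
    exact DifferentiableOn.fun_sum fun j _ =>
      (differentiableOn_gram_inv lam i j).mul (differentiableOn_form _ _)
  exact h.congr fun p hp => by
    rw [macP_eq_gramFamily (mem_polydisc.1 hp).1 (mem_polydisc.1 hp).2]

theorem continuousOn_mCoeff_macP (lam mu : YoungDiagram) :
    ContinuousOn (fun p : ℂ × ℂ => mCoeff mu (macP p.1 p.2 lam)) polydisc :=
  (differentiableOn_mCoeff_macP lam mu).continuousOn

/-- A continuous function that vanishes where an analytic function does not is zero. -/
theorem eq_zero_of_forall_ne_zero {f R : ℂ × ℂ → ℂ} (hf : ContinuousOn f polydisc)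
    (hR : DifferentiableOn ℂ R polydisc) {p₁ : ℂ × ℂ} (hp₁ : p₁ ∈ polydisc) (hne : R p₁ ≠ 0)
    (h : ∀ p ∈ polydisc, R p ≠ 0 → f p = 0) {p : ℂ × ℂ} (hp : p ∈ polydisc) : f p = 0 := by
  -- Restriction to the complex line through p and p₁ reduces the claim to one variable: R along the
  -- line is analytic and not identically zero, so f vanishes on a punctured neighbourhood of p in
  -- this line.
  set L : ℂ → ℂ × ℂ := fun s => p + s • (p₁ - p) with hL
  have hLd : Differentiable ℂ L := by
    rw [hL]
    fun_prop
  set U : Set ℂ := L ⁻¹' polydisc with hU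
  have hUo : IsOpen U := Metric.isOpen_ball.preimage hLd.continuous
  have h0 : (0 : ℂ) ∈ U := by simpa [hU, hL] using hp
  have h1 : (1 : ℂ) ∈ U := by simpa [hU, hL] using hp₁
  have hUc : Convex ℝ U := by
    intro a ha b hb c d hc hd hcd
    have : L (c • a + d • b) = c • L a + d • L b := by
      simp only [hL, smul_add]
      rw [add_add_add_comm, ← add_smul c d p, hcd, one_smul, add_smul, smul_assoc, smul_assoc]
    change L _ ∈ polydisc
    rw [this]
    exact convex_ball (0 : ℂ × ℂ) 1 ha hb hc hd hcd
  have han : AnalyticOnNhd ℂ (fun s => R (L s)) U :=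
    (hR.comp hLd.differentiableOn fun s hs => hs).analyticOnNhd hUo
  have hev : ∀ᶠ s in nhdsWithin (0 : ℂ) {0}ᶜ, R (L s) ≠ 0 := by
    rcases (han 0 h0).eventually_eq_zero_or_eventually_ne_zero with h2 | h2
    · exfalso
      apply hne
      have := han.eqOn_zero_of_preconnected_of_eventuallyEq_zero hUc.isPreconnected h0 h2 h1
      simpa [hL] using this
    · exact h2
  have hcont : ContinuousAt (fun s => f (L s)) 0 := by
    apply ContinuousAt.comp (g := f)
    · exact hf.continuousAt (Metric.isOpen_ball.mem_nhds h0)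
    · exact hLd.continuous.continuousAt
  have hz : (fun s => f (L s)) =ᶠ[nhdsWithin (0 : ℂ) {0}ᶜ] fun _ => 0 := by
    filter_upwards [hev, nhdsWithin_le_nhds (hUo.mem_nhds h0)] with s hs hsU
    exact h _ hsU hs
  have ht1 : Filter.Tendsto (fun s => f (L s)) (nhdsWithin (0 : ℂ) {0}ᶜ) (nhds (f (L 0))) :=
    hcont.tendsto.mono_left nhdsWithin_le_nhds
  have ht2 := tendsto_nhds_unique ht1 (tendsto_const_nhds.congr' hz.symm)
  simpa [hL] using ht2

/-- For each separating z the orthogonal eigenfunctions are the P_λ by uniqueness. All but finitely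
many z separate, and each coefficient of the equation is a polynomial in z, so it holds for every z.
-/
theorem macOp_macP {q t : ℂ} (hq0 : q ≠ 0) (ht0 : t ≠ 0) (hq : ‖q‖ < 1) (ht : ‖t‖ < 1) {n : ℕ}
    {lam : YoungDiagram} (hn : lam.card ≤ n) (z : ℂ) :
    macOp q t z (toPoly (Fin n) (macP q t lam)) =
      macEigen n q t z lam • (vdmPoly n * toPoly (Fin n) (macP q t lam)) := by
  rw [← sub_eq_zero]
  ext κ
  rw [coeff_zero, coeff_macOp_sub]
  set A : Polynomial ℂ := ∑ p ∈ antidiagonal κ, Polynomial.C (coeff p.1 (vdmPoly n) *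
    coeff p.2 (toPoly (Fin n) (macP q t lam))) * (∏ i, (1 + Polynomial.X *
      Polynomial.C (t ^ p.1 i) * Polynomial.C (q ^ p.2 i)) - ∏ i : Fin n, (1 + Polynomial.X *
      Polynomial.C (t ^ (n - 1 - i : ℕ)) * Polynomial.C (q ^ lam.rowLen i))) with hA
  have hAe : ∀ z, A.eval z = ∑ p ∈ antidiagonal κ, coeff p.1 (vdmPoly n) *
      coeff p.2 (toPoly (Fin n) (macP q t lam)) *
        (∏ i, (1 + z * t ^ p.1 i * q ^ p.2 i) - macEigen n q t z lam) := by
    intro z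
    simp [hA, Polynomial.eval_finsetSum, Polynomial.eval_prod, macEigen]
  rw [← hAe]
  have hA0 : A = 0 := by
    refine Polynomial.eq_zero_of_infinite_isRoot A (Set.Infinite.mono (s := {z | ∃ lam₁ ∈
      ofSize lam.card, ∃ mu ∈ ofSize lam.card, lam₁ ≠ mu ∧
      macEigen n q t z lam₁ = macEigen n q t z mu}ᶜ) (fun w hw => ?_)
      (finite_not_separating hq0 ht0 hq ht hn).infinite_compl)
    obtain ⟨F, hF, _, ho, he⟩ := exists_orthogonal_eigenfamily hq ht hn (z := w)
      fun a b ha hb hne heq => hw ⟨a, mem_ofSize.2 ha, b, mem_ofSize.2 hb, hne, heq⟩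
    have h1 := he lam rfl
    rw [← macP_eq_of_orthogonal hq ht hF ho, ← sub_eq_zero] at h1
    have h2 := congrArg (coeff κ) h1
    rw [coeff_macOp_sub, coeff_zero, ← hAe] at h2
    exact h2
  rw [hA0, Polynomial.eval_zero]

/-- The definition only gives lexicographic triangularity. For qt ≠ 0 the eigenfunctions are
triangular for dominance, and the vanishing of the other coefficients extends to the axes by
continuity. -/
theorem domLE_of_mCoeff_macP_ne_zero {q t : ℂ} (hq : ‖q‖ < 1) (ht : ‖t‖ < 1)
    {lam mu : YoungDiagram} (h : mCoeff mu (macP q t lam) ≠ 0) : DomLE mu lam := by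
  by_contra hc
  refine h (eq_zero_of_forall_ne_zero (R := fun p => p.1 * p.2) (p₁ := (1 / 2, 1 / 2))
    (continuousOn_mCoeff_macP lam mu) (by fun_prop) ?_ (by norm_num) ?_
    (p := (q, t)) (mem_polydisc.2 ⟨hq, ht⟩))
  · rw [mem_polydisc]
    norm_num
  · rintro ⟨q, t⟩ hp h0
    obtain ⟨hq, ht⟩ := mem_polydisc.1 hp
    obtain ⟨hq0, ht0⟩ := mul_ne_zero_iff.1 h0
    obtain ⟨z, hz⟩ := (finite_not_separating hq0 ht0 hq ht (le_refl lam.card)).exists_notMem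
    obtain ⟨F, hF, hdom, ho, _⟩ := exists_orthogonal_eigenfamily hq ht (le_refl lam.card) (z := z)
      fun a b ha hb hne heq => hz ⟨a, mem_ofSize.2 ha, b, mem_ofSize.2 hb, hne, heq⟩
    by_contra hmu
    rw [macP_eq_of_orthogonal hq ht hF ho] at hmu
    exact hc (hdom lam mu hmu)

end Continuity

end Macdonald

namespace Macdonald

open MvPolynomial Finset

/-! ### Elementary symmetric functions and dominance -/

section Elementary

/-- The elementary symmetric functions. -/
noncomputable def elem : ℕ → SymFun := expCoeff fun k => (-1 : ℂ) ^ k • powerSum k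

theorem toPoly_elem (n r : ℕ) : toPoly (Fin n) (elem r) = esymm (Fin n) ℂ r := by
  induction r using Nat.strong_induction_on with
  | _ r ih =>
    rcases r with _ | r
    · rw [elem, expCoeff_zero, map_one, esymm_zero]
    · have h0 : ((r : ℂ) + 1) ≠ 0 := by exact_mod_cast Nat.succ_ne_zero r
      have h1 := mul_esymm_eq_sum (Fin n) ℂ (r + 1)
      rw [sum_filter, Nat.sum_antidiagonal_eq_sum_range_succ (fun i j => if i < r + 1 then
        (-1) ^ i * esymm (Fin n) ℂ i * psum (Fin n) ℂ j else 0), sum_range_succ,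
        if_neg (lt_irrefl _), add_zero, ← sum_range_reflect] at h1
      apply smul_right_injective _ h0
      simp only
      rw [← map_smul, elem, expCoeff_succ, map_sum, smul_eq_C_mul, map_add, map_one, map_natCast,
        ← Nat.cast_succ, h1, mul_sum]
      refine sum_congr rfl fun k hk => ?_
      rw [mem_range] at hk
      rw [if_pos (by omega), map_mul, map_smul, powerSum, toPoly_X]
      have h2 := ih (r - k) (by omega)
      rw [elem] at h2
      rw [h2, show r + 1 - 1 - k = r - k by omega, show r + 1 - (r - k) = k + 1 by omega]
      simp only [Nat.succPNat_coe, Nat.succ_eq_add_one, smul_eq_C_mul, map_pow, map_neg, map_one]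
      have h3 : (-1 : MvPolynomial (Fin n) ℂ) ^ (r + 1 + 1) * (-1) ^ (r - k) = (-1) ^ k := by
        rw [← pow_add, show r + 1 + 1 + (r - k) = k + 2 * (r - k + 1) by omega, pow_add, pow_mul]
        simp
      linear_combination (-(esymm (Fin n) ℂ (r - k) * psum (Fin n) ℂ (k + 1))) * h3

/-- The exponent vector of a squarefree monomial. -/
noncomputable def indExp {n : ℕ} (s : Finset (Fin n)) : Fin n →₀ ℕ := ∑ i ∈ s, Finsupp.single i 1

theorem indExp_apply {n : ℕ} (s : Finset (Fin n)) (i : Fin n) :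
    indExp s i = if i ∈ s then 1 else 0 := by
  rw [indExp, Finsupp.finsetSum_apply]
  simp_rw [Finsupp.single_apply]
  rw [sum_ite_eq']

theorem partialSum_indExp {n : ℕ} (s : Finset (Fin n)) (k : ℕ) :
    partialSum (indExp s) k = #(filter (fun i : Fin n => (i : ℕ) < k) s) := by
  rw [partialSum, card_filter, ← Fintype.sum_ite_mem s]
  refine sum_congr rfl fun i _ => ?_
  rw [indExp_apply]
  split_ifs <;> rfl

theorem isLead_esymm {n r : ℕ} (hr : r ≤ n) :
    IsLead (esymm (Fin n) ℂ r) (indExp {i | (i : ℕ) < r}) ∧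
      coeff (indExp {i : Fin n | (i : ℕ) < r}) (esymm (Fin n) ℂ r) = 1 := by
  have hc : ∀ α, coeff α (esymm (Fin n) ℂ r) =
      ∑ s ∈ powersetCard r univ, if indExp s = α then 1 else 0 := by
    intro α
    rw [esymm_eq_sum_monomial, coeff_sum]
    refine sum_congr rfl fun s _ => ?_
    rw [coeff_monomial]
    rfl
  have hcard : ∀ k, #{i : Fin n | (i : ℕ) < k} = min k n := fun k => by
    rw [Fin.card_filter_val_lt, min_comm]
  constructor
  · intro α hα
    rw [hc] at hα
    obtain ⟨s, hs, hne⟩ := exists_ne_zero_of_sum_ne_zero hα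
    have : indExp s = α := by by_contra h; simp [h] at hne
    rw [← this]
    rw [mem_powersetCard] at hs
    constructor
    · rw [partialSum_indExp, partialSum_indExp, filter_true_of_mem fun i _ => i.2,
        filter_true_of_mem fun i _ => i.2, hs.2, hcard, min_eq_left hr]
    · intro k
      rw [partialSum_indExp, partialSum_indExp, filter_filter]
      have h1 : #(filter (fun i : Fin n => (i : ℕ) < k) s) ≤ min r (min k n) := by
        apply le_min
        · exact (card_le_card (filter_subset _ _)).trans hs.2.le
        · rw [← hcard]
          exact card_le_card (filter_subset_filter _ (subset_univ s))
      have h2 : #{i : Fin n | (i : ℕ) < r ∧ (i : ℕ) < k} = min (min r k) n := by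
        rw [← hcard]
        congr 1
        ext i
        simp
      rw [h2]
      omega
  · rw [hc, sum_eq_single (filter (fun i : Fin n => (i : ℕ) < r) univ), if_pos rfl]
    · intro s _ hs
      rw [if_neg]
      intro h
      apply hs
      ext i
      have := DFunLike.congr_fun h i
      rw [indExp_apply, indExp_apply] at this
      by_cases h1 : i ∈ s <;> by_cases h2 : i ∈ ({i : Fin n | (i : ℕ) < r} : Finset (Fin n)) <;>
        simp_all
    · intro h
      exact absurd (mem_powersetCard.2 ⟨subset_univ _, by rw [hcard, min_eq_left hr]⟩) h

/-- The products of elementary symmetric functions, indexed by column lengths. -/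
noncomputable def elemPart (lam : YoungDiagram) : SymFun :=
  ∏ j ∈ range (lam.rowLen 0), elem (lam.colLen j)

theorem expo_eq_sum_indExp (n : ℕ) (lam : YoungDiagram) : expo n lam =
    ∑ j ∈ range (lam.rowLen 0), indExp {i : Fin n | (i : ℕ) < lam.colLen j} := by
  ext i
  rw [Finsupp.finsetSum_apply, expo_apply]
  simp_rw [indExp_apply]
  rw [sum_boole, Nat.cast_id]
  have : filter (fun j => i ∈ ({i : Fin n | (i : ℕ) < lam.colLen j} : Finset (Fin n)))
      (range (lam.rowLen 0)) = range (lam.rowLen i) := by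
    ext j
    simp only [mem_filter, mem_range, mem_univ, true_and, ← YoungDiagram.mem_iff_lt_rowLen,
      ← YoungDiagram.mem_iff_lt_colLen]
    constructor
    · exact fun h => h.2
    · exact fun h => ⟨lam.up_left_mem (Nat.zero_le _) le_rfl h, h⟩
  rw [this, card_range]

theorem isLead_elemPart {n : ℕ} {lam : YoungDiagram} (hn : lam.colLen 0 ≤ n) :
    IsLead (toPoly (Fin n) (elemPart lam)) (expo n lam) ∧
      coeff (expo n lam) (toPoly (Fin n) (elemPart lam)) = 1 := by
  rw [expo_eq_sum_indExp, elemPart, map_prod]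
  apply IsLead.prod
  intro j _
  rw [toPoly_elem]
  exact isLead_esymm ((lam.colLen_anti 0 j (Nat.zero_le j)).trans hn)

/-- Families with a unitriangular expansion for the dominance order. -/
structure IsDomUnitriangular (F : YoungDiagram → SymFun) : Prop extends IsUnitriangular F where
  domLE : ∀ lam mu, mCoeff mu (F lam) ≠ 0 → DomLE mu lam

theorem isHomog_elemPart (lam : YoungDiagram) : IsHomog (elemPart lam) lam.card := by
  have h1 : lam.card = ∑ j ∈ range (lam.rowLen 0), lam.colLen j := by
    rw [← card_transpose, ← sum_range_rowLen (n := lam.rowLen 0)]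
    · simp_rw [YoungDiagram.rowLen_transpose]
    · rw [YoungDiagram.colLen_transpose]
  rw [h1]
  exact IsWeightedHomogeneous.prod _ _ _ fun j _ => isHomog_expCoeff _ _

theorem isDomUnitriangular_of {F : YoungDiagram → SymFun} (h : ∀ lam, IsHomog (F lam) lam.card)
    (h1 : ∀ lam, mCoeff lam (F lam) = 1) (h2 : ∀ lam mu, mCoeff mu (F lam) ≠ 0 → DomLE mu lam) :
    IsDomUnitriangular F where
  homog := h
  diag := h1
  lower lam mu hmu := by
    by_cases hc : mu = lam
    · exact Or.inl hc
    · refine Or.inr ((h2 lam mu hmu).lexLT ?_ hc)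
      by_contra hcard
      exact hmu (mCoeff_eq_zero (h lam) hcard)
  domLE := h2

/-- The leading monomial of e_r is x_1 ⋯ x_r; multiplying over the columns of λ, of lengths λ'_j,
gives x^λ. -/
theorem isDomUnitriangular_elemPart : IsDomUnitriangular elemPart := by
  refine isDomUnitriangular_of isHomog_elemPart (fun lam => ?_) fun lam mu hmu => ?_
  · rw [mCoeff_eq_coeff le_rfl, (isLead_elemPart le_rfl).2]
  · rw [mCoeff_eq_coeff (le_max_left _ (lam.colLen 0))] at hmu
    exact domLE_of_expLE ((isLead_elemPart (le_max_right _ _)).1 _ hmu) (le_max_left _ _)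

theorem isDomUnitriangular_macP {q t : ℂ} (hq : ‖q‖ < 1) (ht : ‖t‖ < 1) :
    IsDomUnitriangular (macP q t) :=
  ⟨isUnitriangular_macP hq ht, fun _ _ => domLE_of_mCoeff_macP_ne_zero hq ht⟩

/-- The span of the members of a family strictly below `lam` in the dominance order. -/
noncomputable def domSpan (F : YoungDiagram → SymFun) (lam : YoungDiagram) : Submodule ℂ SymFun :=
  Submodule.span ℂ (F '' {mu | mu.card = lam.card ∧ DomLE mu lam ∧ mu ≠ lam})

theorem IsDomUnitriangular.sub_mon_mem {F : YoungDiagram → SymFun} (hF : IsDomUnitriangular F)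
    (lam : YoungDiagram) : F lam - mon lam ∈ domSpan mon lam := by
  have h1 := (hF.homog lam).eq_sum_mon
  rw [← sum_erase_add _ _ (mem_ofSize.2 rfl), hF.diag, one_smul] at h1
  rw [sub_eq_of_eq_add h1]
  apply Submodule.sum_mem
  intro nu hnu
  rw [mem_erase, mem_ofSize] at hnu
  by_cases h0 : mCoeff nu (F lam) = 0
  · rw [h0, zero_smul]; exact Submodule.zero_mem _
  · apply Submodule.smul_mem
    exact Submodule.subset_span (Set.mem_image_of_mem mon ⟨hnu.2, hF.domLE lam nu h0, hnu.1⟩)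

theorem domSpan_mono (F : YoungDiagram → SymFun) {mu lam : YoungDiagram}
    (h : mu.card = lam.card ∧ DomLE mu lam ∧ mu ≠ lam) : domSpan F mu ≤ domSpan F lam := by
  refine Submodule.span_mono (Set.image_mono fun c hc => ⟨hc.1.trans h.1, hc.2.1.trans h.2.1, ?_⟩)
  rintro rfl
  exact h.2.2 (h.2.1.antisymm hc.2.1)

theorem IsDomUnitriangular.domSpan_eq {F : YoungDiagram → SymFun} (hF : IsDomUnitriangular F)
    (lam : YoungDiagram) : domSpan F lam = domSpan mon lam := by
  induction lam using wellFounded_lexLT.induction with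
  | _ lam ih =>
    apply le_antisymm
    · rw [domSpan, Submodule.span_le]
      rintro _ ⟨mu, hmu, rfl⟩
      have h1 := domSpan_mono mon hmu (hF.sub_mon_mem mu)
      have h2 := Submodule.add_mem _ h1 (Submodule.subset_span (Set.mem_image_of_mem mon hmu))
      rwa [sub_add_cancel] at h2
    · rw [domSpan, Submodule.span_le]
      rintro _ ⟨mu, hmu, rfl⟩
      have h1 := hF.sub_mon_mem mu
      rw [← ih mu (hmu.2.1.lexLT hmu.1 hmu.2.2)] at h1
      have h2 := Submodule.sub_mem _ (Submodule.subset_span (Set.mem_image_of_mem F hmu))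
        (domSpan_mono F hmu h1)
      rwa [sub_sub_cancel] at h2

end Elementary

/-! ### Duality under the Macdonald involution -/

section Duality

/-- The Macdonald involution `p_k ↦ (-1) ^ (k - 1) (1 - q ^ k)/(1 - t ^ k) p_k`. -/
noncomputable def omega (q t : ℂ) : SymFun →ₐ[ℂ] SymFun :=
  aeval fun k : ℕ+ => ((-1) ^ ((k : ℕ) - 1) * ratio q t k) • X k

theorem omega_elem (q t : ℂ) (r : ℕ) : omega q t (elem r) = gFun t q r := by
  rw [elem, map_expCoeff, gFun]
  congr 1
  ext1 k
  rw [map_smul, powerSum, omega, aeval_X, smul_smul]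
  congr 1
  rw [Nat.succPNat_coe, Nat.succ_eq_add_one, Nat.add_sub_cancel, ← mul_assoc, ← mul_pow]
  simp

theorem omega_elemPart (q t : ℂ) (lam : YoungDiagram) :
    omega q t (elemPart lam) = gPart t q lam.transpose := by
  rw [elemPart, map_prod, gPart, YoungDiagram.colLen_transpose]
  refine prod_congr rfl fun j _ => ?_
  rw [omega_elem, YoungDiagram.rowLen_transpose]

theorem isHomog_omega (q t : ℂ) {f : SymFun} {d : ℕ} (hf : IsHomog f d) :
    IsHomog (omega q t f) d := by
  rw [isDomUnitriangular_elemPart.eq_sum_repr hf, map_sum]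
  refine IsHomog.sum fun nu hnu => ?_
  rw [map_smul, omega_elemPart]
  have := isHomog_gPart t q nu.transpose
  rw [card_transpose, mem_ofSize.1 hnu] at this
  exact this.smul _

theorem coeff_omega (q t : ℂ) (f : SymFun) (d : ℕ+ →₀ ℕ) : coeff d (omega q t f) =
    (d.prod fun k m => ((-1) ^ ((k : ℕ) - 1) * ratio q t k) ^ m) * coeff d f := by
  induction f using MvPolynomial.induction_on' with
  | monomial e a =>
    have : omega q t (monomial e a) =
        monomial e ((e.prod fun k m => ((-1) ^ ((k : ℕ) - 1) * ratio q t k) ^ m) * a) := by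
      rw [omega, aeval_monomial, algebraMap_eq, monomial_eq, C_mul, mul_comm (C _) (C a), mul_assoc]
      congr 1
      simp_rw [smul_eq_C_mul, mul_pow]
      rw [Finsupp.prod, prod_mul_distrib, Finsupp.prod, map_prod]
      simp_rw [← mul_pow, ← map_pow]
      rfl
    rw [this, coeff_monomial, coeff_monomial]
    split_ifs with h
    · rw [h]
    · rw [mul_zero]
  | add f g hf hg => rw [map_add, coeff_add, coeff_add, hf, hg, mul_add]

/-- Each part k contributes the square of its ω-factor to the pairing. The signs square to 1, and
`ratio q t k` ^ 2 * `ratio t q k` = `ratio q t k`. -/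
theorem form_omega {q t : ℂ} (hq : ‖q‖ < 1) (ht : ‖t‖ < 1) (f g : SymFun) :
    form t q (omega q t f) (omega q t g) = form q t f g := by
  rw [form_apply, form_apply, scalarProduct_eq_sum t q (omega q t f) _ f.support (fun d hd => by
    rw [mem_support_iff, coeff_omega] at hd
    exact mem_support_iff.2 (right_ne_zero_of_mul hd)), scalarProduct]
  refine sum_congr rfl fun d _ => ?_
  rw [coeff_omega, coeff_omega]
  have h1 : (d.prod fun k m => ((-1) ^ ((k : ℕ) - 1) * ratio q t k) ^ m) *
      (d.prod fun k m => ((-1) ^ ((k : ℕ) - 1) * ratio q t k) ^ m) * powerSumNorm t q d =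
      powerSumNorm q t d := by
    rw [powerSumNorm, powerSumNorm, ← Finsupp.prod_mul, ← Finsupp.prod_mul]
    refine Finsupp.prod_congr fun k _ => ?_
    have h2 := ratio_mul_ratio hq ht k.ne_zero
    rw [← ratio, ← ratio, ← mul_pow, ← mul_assoc, ← mul_pow]
    congr 2
    have h3 : ((-1 : ℂ) ^ ((k : ℕ) - 1)) * (-1) ^ ((k : ℕ) - 1) = 1 := by
      rw [← mul_pow]; simp
    linear_combination ratio q t k * (ratio q t k * ratio t q k) * h3 + ratio q t k * h2
  linear_combination coeff d f * coeff d g * h1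

/-- P_λ is `elemPart lam` plus terms `elemPart μ` with μ strictly dominated by λ. Under ω these
become g_{λ'} and g_{μ'} for the exchanged parameters, dual to m_{λ'} and m_{μ'}, and conjugation
puts μ' above λ'. -/
theorem form_omega_macP_mon {q t : ℂ} (hq : ‖q‖ < 1) (ht : ‖t‖ < 1) (lam kap : YoungDiagram) :
    (form t q (omega q t (macP q t lam)) (mon kap) ≠ 0 → DomLE lam.transpose kap) ∧
      form t q (omega q t (macP q t lam)) (mon lam.transpose) = 1 := by
  have hE := isDomUnitriangular_elemPart
  have hform : ∀ mu kap : YoungDiagram, form t q (omega q t (elemPart mu)) (mon kap) =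
      if mu.transpose = kap then 1 else 0 := by
    intro mu kap
    rw [omega_elemPart, form_gPart ht hq, mCoeff_mon]
  have h1 : macP q t lam - elemPart lam ∈ domSpan elemPart lam := by
    rw [hE.domSpan_eq]
    have := Submodule.sub_mem _ ((isDomUnitriangular_macP hq ht).sub_mon_mem lam)
      (hE.sub_mon_mem lam)
    rwa [sub_sub_sub_cancel_right] at this
  have h2 : ∀ kap : YoungDiagram, (¬ DomLE lam.transpose kap ∨ kap = lam.transpose) →
      ∀ x ∈ domSpan elemPart lam, form t q (omega q t x) (mon kap) = 0 := by
    intro kap hkap x hx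
    induction hx using Submodule.span_induction with
    | mem x hx =>
      obtain ⟨nu, ⟨hcard, hdom, hne⟩, rfl⟩ := hx
      rw [hform, if_neg]
      rintro rfl
      rcases hkap with h | h
      · exact h (hdom.transpose hcard)
      · apply hne
        rw [← nu.transpose_transpose, h, lam.transpose_transpose]
    | zero => simp
    | add x y _ _ hx hy => rw [map_add, map_add, LinearMap.add_apply, hx, hy, add_zero]
    | smul a x _ hx => rw [map_smul, map_smul, LinearMap.smul_apply, hx, smul_zero]
  have h3 : macP q t lam = (macP q t lam - elemPart lam) + elemPart lam := (sub_add_cancel _ _).symm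
  constructor
  · intro hne
    by_contra hc
    apply hne
    rw [h3, map_add, map_add, LinearMap.add_apply, h2 kap (Or.inl hc) _ h1, hform, if_neg, zero_add]
    rintro rfl
    exact hc (DomLE.refl _)
  · rw [h3, map_add, map_add, LinearMap.add_apply, h2 _ (Or.inr rfl) _ h1, hform, if_pos rfl,
      zero_add]

theorem form_omega_macP_macP {q t : ℂ} (hq : ‖q‖ < 1) (ht : ‖t‖ < 1) (lam kap : YoungDiagram) :
    (form t q (omega q t (macP q t lam)) (macP t q kap) ≠ 0 → DomLE lam.transpose kap) ∧
      form t q (omega q t (macP q t lam)) (macP t q lam.transpose) = 1 := by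
  have hP := isDomUnitriangular_macP ht hq
  have hsum : ∀ kap, form t q (omega q t (macP q t lam)) (macP t q kap) =
      ∑ nu ∈ ofSize kap.card, mCoeff nu (macP t q kap) *
        form t q (omega q t (macP q t lam)) (mon nu) := by
    intro kap
    conv_lhs => rw [(hP.homog kap).eq_sum_mon, map_sum]
    simp_rw [map_smul, smul_eq_mul]
  constructor
  · intro h
    rw [hsum] at h
    obtain ⟨nu, _, hnu⟩ := exists_ne_zero_of_sum_ne_zero h
    exact ((form_omega_macP_mon hq ht lam nu).1 (right_ne_zero_of_mul hnu)).trans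
      (hP.domLE _ _ (left_ne_zero_of_mul hnu))
  · rw [hsum, sum_eq_single lam.transpose, hP.diag, (form_omega_macP_mon hq ht lam lam).2, one_mul]
    · intro nu _ hne
      by_contra h
      exact hne ((hP.domLE _ _ (left_ne_zero_of_mul h)).antisymm
        ((form_omega_macP_mon hq ht lam nu).1 (right_ne_zero_of_mul h)))
    · intro h
      exact absurd (mem_ofSize.2 rfl) h

theorem form_macQ_macP {q t : ℂ} (hq : ‖q‖ < 1) (ht : ‖t‖ < 1) (lam mu : YoungDiagram) :
    form q t (macQ q t lam) (macP q t mu) = if lam = mu then 1 else 0 := by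
  rw [macQ, map_smul, LinearMap.smul_apply, smul_eq_mul, ← form_apply]
  split_ifs with h
  · rw [← h, inv_mul_cancel₀ (form_macP_self_ne_zero hq ht lam)]
  · rw [form_macP_of_ne hq ht h, mul_zero]

theorem eq_of_form_macP {q t : ℂ} (hq : ‖q‖ < 1) (ht : ‖t‖ < 1) {f g : SymFun}
    (h : ∀ mu, form q t f (macP q t mu) = form q t g (macP q t mu)) : f = g := by
  rw [← sub_eq_zero]
  apply form_eq_zero hq ht
  intro x
  have hx := (isUnitriangular_macP hq ht).span_eq_top (x := x) trivial
  induction hx using Submodule.span_induction with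
  | mem x hx =>
    obtain ⟨nu, rfl⟩ := hx
    rw [form_comm, map_sub, LinearMap.sub_apply, h, sub_self]
  | zero => simp
  | add x y _ _ hx hy => rw [map_add, LinearMap.add_apply, hx, hy, add_zero]
  | smul a x _ hx => rw [map_smul, LinearMap.smul_apply, hx, smul_zero]

/-- The duality of Macdonald symmetric functions. -/
theorem omega_macP {q t : ℂ} (hq : ‖q‖ < 1) (ht : ‖t‖ < 1) (lam : YoungDiagram) :
    omega q t (macP q t lam) = macQ t q lam.transpose := by
  induction lam using wellFounded_lexLT.induction with
  | _ lam ih =>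
    apply eq_of_form_macP ht hq
    intro kap
    rw [form_macQ_macP ht hq]
    split_ifs with h
    · rw [← h, (form_omega_macP_macP hq ht lam lam).2]
    · by_contra hne
      -- Triangularity leaves only κ above λ', so κ' lies below λ. By induction P_κ(t,q) is a
      -- multiple of ω P_{κ'}, and since ω is an isometry the pairing reduces to ⟨P_λ, P_{κ'}⟩ = 0.
      have hdom := (form_omega_macP_macP hq ht lam kap).1 hne
      have hcard : kap.card = lam.card := by
        by_contra hc
        exact hne (form_eq_zero_of_ne t q (isHomog_omega q t ((isUnitriangular_macP hq ht).homog lam))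
          ((isUnitriangular_macP ht hq).homog kap) (Ne.symm hc))
      have hdom' := hdom.transpose (by rw [card_transpose, hcard])
      rw [YoungDiagram.transpose_transpose] at hdom'
      have hne' : kap.transpose ≠ lam := by
        rintro rfl
        exact h (YoungDiagram.transpose_transpose _)
      have h1 := ih kap.transpose (hdom'.lexLT (by rw [card_transpose, hcard]) hne')
      rw [YoungDiagram.transpose_transpose, macQ] at h1
      have h2 : macP t q kap = form t q (macP t q kap) (macP t q kap) •
          omega q t (macP q t kap.transpose) := by
        rw [h1, ← form_apply, smul_smul, mul_inv_cancel₀ (form_macP_self_ne_zero ht hq kap), one_smul]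
      rw [h2, map_smul, form_omega hq ht, form_macP_of_ne hq ht hne'.symm, smul_zero] at hne
      exact hne rfl

end Duality

end Macdonald

namespace Macdonald

open MvPolynomial Finset

/-! ### Changing one coordinate of the Vandermonde product -/

section VandermondeUpdate

variable {n : ℕ} {R : Type*} [CommRing R]

theorem vdm_eq_mul (x : Fin n → R) (i : Fin n) :
    vdm x = (-1) ^ (i : ℕ) * (∏ k ∈ univ.erase i, (x i - x k)) *
      ∏ a, ∏ b ∈ Ioi a, if a = i ∨ b = i then 1 else x a - x b := by
  have h1 : vdm x = ∏ a, ∏ b ∈ Ioi a, ((if a = i then x i - x b else 1) *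
      (if b = i then x a - x i else 1) * if a = i ∨ b = i then 1 else x a - x b) := by
    refine prod_congr rfl fun a _ => prod_congr rfl fun b hb => ?_
    have hab : a ≠ b := (mem_Ioi.1 hb).ne
    by_cases ha : a = i
    · subst ha
      simp [hab.symm]
    · by_cases hb : b = i <;> simp [ha, hb]
  have h2 : ∏ a, ∏ b ∈ Ioi a, (if a = i then x i - x b else 1) = ∏ b ∈ Ioi i, (x i - x b) := by
    rw [prod_eq_single i (fun a _ ha => prod_eq_one fun b _ => if_neg ha) (by simp)]
    simp
  have h3 : ∏ a, ∏ b ∈ Ioi a, (if b = i then x a - x i else 1) =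
      (-1) ^ (i : ℕ) * ∏ a ∈ Iio i, (x i - x a) := by
    have : ∀ a, ∏ b ∈ Ioi a, (if b = i then x a - x i else 1) =
        if a ∈ Iio i then -1 * (x i - x a) else 1 := by
      intro a
      rw [prod_ite_eq']
      simp only [mem_Ioi, mem_Iio]
      split_ifs <;> ring
    simp_rw [this]
    rw [Fintype.prod_ite_mem, prod_mul_distrib, prod_const, Fin.card_Iio]
  have h4 : univ.erase i = Iio i ∪ Ioi i := by
    ext k
    simp [lt_or_lt_iff_ne]
  have h5 : Disjoint (Iio i) (Ioi i) := by
    rw [disjoint_left]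
    intro k hk hk'
    exact lt_asymm (mem_Iio.1 hk) (mem_Ioi.1 hk')
  rw [h1]
  simp_rw [prod_mul_distrib]
  rw [h2, h3, h4, prod_union h5]
  ring

/-- A cleared form of the ratio ∏ (v - x_k)/(x_i - x_k): the factors of the Vandermonde product
without the index i are unchanged. -/
theorem vdm_update (x : Fin n → R) (i : Fin n) (v : R) :
    vdm (Function.update x i v) * ∏ k ∈ univ.erase i, (x i - x k) =
      vdm x * ∏ k ∈ univ.erase i, (v - x k) := by
  have h1 : ∏ k ∈ univ.erase i, (Function.update x i v i - Function.update x i v k) =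
      ∏ k ∈ univ.erase i, (v - x k) := by
    refine prod_congr rfl fun k hk => ?_
    rw [Function.update_self, Function.update_of_ne (ne_of_mem_erase hk)]
  have h2 : (∏ a, ∏ b ∈ Ioi a, if a = i ∨ b = i then 1 else
      Function.update x i v a - Function.update x i v b) =
      ∏ a, ∏ b ∈ Ioi a, if a = i ∨ b = i then 1 else x a - x b := by
    refine prod_congr rfl fun a _ => prod_congr rfl fun b _ => ?_
    split_ifs with h
    · rfl
    · push Not at h
      rw [Function.update_of_ne h.1, Function.update_of_ne h.2]
  rw [vdm_eq_mul _ i, vdm_eq_mul x i, h1, h2]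
  ring

theorem scalePt_singleton (a : R) (i : Fin n) (x : Fin n → R) :
    scalePt a {i} x = Function.update x i (a * x i) := by
  ext k
  by_cases h : k = i
  · subst h; simp [scalePt]
  · simp [scalePt, h]

theorem scalePt_pair (a : R) {i j : Fin n} (hij : i ≠ j) (x : Fin n → R) :
    scalePt a {i, j} x = Function.update (scalePt a {i} x) j (a * x j) := by
  ext k
  by_cases h : k = j
  · subst h; simp [scalePt]
  · simp [scalePt, h]

theorem scalePt_scalePt (a : R) {i j : Fin n} (hij : i ≠ j) (x : Fin n → R) :
    scalePt a {j} (scalePt a {i} x) = scalePt a {i, j} x := by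
  rw [scalePt_pair a hij, scalePt_singleton a j]
  congr 2
  simp [scalePt, hij.symm]

/-- Summation over unordered pairs. -/
theorem sum_powersetCard_two {ι M : Type*} [DecidableEq ι] [CommRing M] (s : Finset ι)
    (G : Finset ι → M) :
    ∑ p ∈ s.offDiag, G {p.1, p.2} = 2 * ∑ I ∈ powersetCard 2 s, G I := by
  rw [← sum_fiberwise_of_maps_to (t := powersetCard 2 s) (g := fun p : ι × ι => {p.1, p.2}),
    mul_sum]
  · refine sum_congr rfl fun I hI => ?_
    rw [mem_powersetCard] at hI
    obtain ⟨a, b, hab, rfl⟩ := card_eq_two.1 hI.2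
    have : filter (fun p : ι × ι => ({p.1, p.2} : Finset ι) = {a, b}) s.offDiag =
        {(a, b), (b, a)} := by
      ext ⟨c, d⟩
      have ha : a ∈ s := hI.1 (by simp)
      have hb : b ∈ s := hI.1 (by simp)
      simp only [mem_filter, mem_offDiag, mem_insert, mem_singleton, Prod.mk.injEq]
      constructor
      · rintro ⟨⟨_, _, hcd⟩, h⟩
        have hc : c ∈ ({a, b} : Finset ι) := h ▸ by simp
        have hd : d ∈ ({a, b} : Finset ι) := h ▸ by simp
        simp only [mem_insert, mem_singleton] at hc hd
        rcases hc with rfl | rfl <;> rcases hd with rfl | rfl <;> simp_all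
      · rintro (⟨rfl, rfl⟩ | ⟨rfl, rfl⟩)
        · exact ⟨⟨ha, hb, hab⟩, rfl⟩
        · exact ⟨⟨hb, ha, hab.symm⟩, pair_comm _ _⟩
    rw [this, sum_pair (by simp [hab])]
    simp only
    rw [pair_comm b a]
    ring
  · rintro ⟨c, d⟩ h
    rw [mem_offDiag] at h
    rw [mem_powersetCard]
    exact ⟨by simp [insert_subset_iff, h.1, h.2.1], card_pair h.2.2⟩

end VandermondeUpdate

/-! ### The Macdonald operators of each level -/

section LevelOperators

variable {n : ℕ}

theorem sum_powersetCard_eq_zero {a : Finset (Fin n) → ℂ}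
    (h : ∀ z : ℂ, ∑ I, z ^ #I * a I = 0) (k : ℕ) : ∑ I ∈ powersetCard k univ, a I = 0 := by
  set A : Polynomial ℂ := ∑ I : Finset (Fin n), Polynomial.C (a I) * Polynomial.X ^ #I with hA
  have h0 : A = 0 := by
    apply Polynomial.funext
    intro z
    rw [Polynomial.eval_zero, ← h z, hA, Polynomial.eval_finsetSum]
    refine sum_congr rfl fun I _ => ?_
    rw [Polynomial.eval_mul, Polynomial.eval_C, Polynomial.eval_pow, Polynomial.eval_X, mul_comm]
  have h1 := congrArg (Polynomial.coeff · k) h0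
  simp only [hA, Polynomial.finsetSum_coeff, Polynomial.coeff_C_mul_X_pow,
    Polynomial.coeff_zero] at h1
  rw [← h1, ← sum_filter]
  refine sum_congr ?_ fun _ _ => rfl
  ext I
  simp only [mem_powersetCard, mem_filter, mem_univ, true_and, subset_univ]
  exact eq_comm

/-- The elementary symmetric functions of the spectral parameters. -/
noncomputable def levelEigen (n : ℕ) (q t : ℂ) (k : ℕ) (lam : YoungDiagram) : ℂ :=
  ∑ I ∈ powersetCard k (univ : Finset (Fin n)), ∏ i ∈ I, (t ^ (n - 1 - i : ℕ) * q ^ lam.rowLen i)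

/-- The coefficient of z^k in the eigenvalue equation, which holds for every z. -/
theorem sum_level_macP {q t : ℂ} (hq0 : q ≠ 0) (ht0 : t ≠ 0) (hq : ‖q‖ < 1) (ht : ‖t‖ < 1)
    {lam : YoungDiagram} (hn : lam.card ≤ n) (k : ℕ) (x : Fin n → ℂ) :
    ∑ I ∈ powersetCard k univ, vdm (scalePt t I x) *
        eval (scalePt q I x) (toPoly (Fin n) (macP q t lam)) =
      levelEigen n q t k lam * (vdm x * eval x (toPoly (Fin n) (macP q t lam))) := by
  rw [levelEigen, sum_mul, ← sub_eq_zero, ← sum_sub_distrib]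
  refine sum_powersetCard_eq_zero (a := fun I => vdm (scalePt t I x) *
    eval (scalePt q I x) (toPoly (Fin n) (macP q t lam)) - _) (fun z => ?_) k
  have h1 := congrArg (eval x) (macOp_macP hq0 ht0 hq ht hn z)
  rw [eval_macOp, smul_eval, map_mul, eval_vdmPoly, macEigen] at h1
  simp_rw [mul_assoc z] at h1
  rw [prod_one_add, powerset_univ] at h1
  simp_rw [mul_sub]
  rw [sum_sub_distrib, sub_eq_zero]
  simp_rw [← mul_assoc (z ^ _)]
  rw [h1, sum_mul]
  refine sum_congr rfl fun I _ => ?_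
  rw [prod_mul_distrib, prod_const]

/-- The diagonal operators with the eigenvalues `levelEigen`. -/
noncomputable def levelOp {q t : ℂ} (hq : ‖q‖ < 1) (ht : ‖t‖ < 1) (n k : ℕ) :
    SymFun →ₗ[ℂ] SymFun :=
  diagOp (isUnitriangular_macP hq ht) (levelEigen n q t k)

theorem sum_level {q t : ℂ} (hq0 : q ≠ 0) (ht0 : t ≠ 0) (hq : ‖q‖ < 1) (ht : ‖t‖ < 1)
    {f : SymFun} {d : ℕ} (hf : IsHomog f d) (hn : d ≤ n) (k : ℕ) (x : Fin n → ℂ) :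
    ∑ I ∈ powersetCard k univ, vdm (scalePt t I x) * eval (scalePt q I x) (toPoly (Fin n) f) =
      vdm x * eval x (toPoly (Fin n) (levelOp hq ht n k f)) := by
  have hP := isUnitriangular_macP hq ht
  rw [levelOp, diagOp_eq_sum hP _ hf]
  conv_lhs => rw [hP.eq_sum_repr hf]
  simp_rw [map_sum, map_smul, smul_eval, mul_sum]
  rw [sum_comm]
  refine sum_congr rfl fun nu hnu => ?_
  have h1 := sum_level_macP hq0 ht0 hq ht ((mem_ofSize.1 hnu).le.trans hn) k x
  simp_rw [mul_left_comm (vdm _), ← mul_sum]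
  rw [h1]

theorem sum_level_one {q t : ℂ} (hq0 : q ≠ 0) (ht0 : t ≠ 0) (hq : ‖q‖ < 1) (ht : ‖t‖ < 1)
    {f : SymFun} {d : ℕ} (hf : IsHomog f d) (hn : d ≤ n) (x : Fin n → ℂ) :
    ∑ i, vdm (scalePt t {i} x) * eval (scalePt q {i} x) (toPoly (Fin n) f) =
      vdm x * eval x (toPoly (Fin n) (levelOp hq ht n 1 f)) := by
  rw [← sum_level hq0 ht0 hq ht hf hn, powersetCard_one, sum_map]
  rfl

theorem isHomog_levelOp {q t : ℂ} (hq : ‖q‖ < 1) (ht : ‖t‖ < 1) (n k : ℕ) {f : SymFun} {d : ℕ}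
    (hf : IsHomog f d) : IsHomog (levelOp hq ht n k f) d :=
  isHomog_diagOp _ _ hf

end LevelOperators

/-! ### The rational identity for two shifts -/

section PairIdentity

variable {n : ℕ}

/-- The points at which the coefficients of the Macdonald operators and of their products are
regular. -/
def IsGeneric (q t : ℂ) (x : Fin n → ℂ) : Prop :=
  ∀ i j, i ≠ j → x i - x j ≠ 0 ∧ x i - q * x j ≠ 0 ∧ x i - t * x j ≠ 0

theorem eq_zero_of_isGeneric {q t : ℂ} {f : MvPolynomial (Fin n) ℂ}
    (h : ∀ x, IsGeneric q t x → eval x f = 0) : f = 0 := by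
  set g : MvPolynomial (Fin n) ℂ := ∏ p ∈ univ.offDiag,
    ((X p.1 - X p.2) * (X p.1 - C q * X p.2) * (X p.1 - C t * X p.2)) with hg
  have hne : ∀ (i j : Fin n) (a : ℂ), i ≠ j → (X i - C a * X j : MvPolynomial (Fin n) ℂ) ≠ 0 := by
    intro i j a hij h0
    have := congrArg (eval (Pi.single i (1 : ℂ))) h0
    simp [hij.symm] at this
  have hg0 : g ≠ 0 := by
    rw [hg, prod_ne_zero_iff]
    intro p hp
    have hij := (mem_offDiag.1 hp).2.2
    refine mul_ne_zero (mul_ne_zero ?_ (hne _ _ q hij)) (hne _ _ t hij)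
    have := hne _ _ 1 hij
    rwa [C_1, one_mul] at this
  refine (mul_eq_zero.1 (?_ : f * g = 0)).resolve_right hg0
  apply MvPolynomial.funext
  intro x
  rw [map_mul, map_zero]
  by_cases hx : IsGeneric q t x
  · rw [h x hx, zero_mul]
  · rw [IsGeneric] at hx
    push Not at hx
    obtain ⟨i, j, hij, hx⟩ := hx
    rw [hg, map_prod, prod_eq_zero (i := (i, j)), mul_zero]
    · exact mem_offDiag.2 ⟨mem_univ _, mem_univ _, hij⟩
    · simp only [map_mul, map_sub, eval_X, eval_C]
      by_cases h1 : x i - x j = 0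
      · rw [h1]; ring
      · by_cases h2 : x i - q * x j = 0
        · rw [h2]; ring
        · rw [hx h1 h2]; ring

theorem IsGeneric.vdm_ne_zero {q t : ℂ} {x : Fin n → ℂ} (hx : IsGeneric q t x) : vdm x ≠ 0 := by
  rw [vdm_ne_zero_iff]
  intro i j hij
  by_contra hne
  exact (hx i j hne).1 (sub_eq_zero.2 hij)

theorem IsGeneric.vdm_scalePt_ne_zero {q t : ℂ} {x : Fin n → ℂ} (hx : IsGeneric q t x)
    (i : Fin n) : vdm (scalePt q {i} x) ≠ 0 := by
  rw [vdm_ne_zero_iff]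
  intro a b hab
  by_contra hne
  simp only [scalePt, mem_singleton] at hab
  by_cases ha : a = i
  · rw [if_pos ha, if_neg (fun hb => hne (ha.trans hb.symm))] at hab
    exact (hx b a (Ne.symm hne)).2.1 (sub_eq_zero.2 hab.symm)
  · rw [if_neg ha] at hab
    by_cases hb : b = i
    · rw [if_pos hb] at hab
      exact (hx a b hne).2.1 (sub_eq_zero.2 hab)
    · rw [if_neg hb] at hab
      exact (hx a b hne).1 (sub_eq_zero.2 hab)

theorem vdm_update_div {x : Fin n → ℂ} {i j : Fin n} (hij : i ≠ j) (hx : vdm x ≠ 0) (v : ℂ) :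
    vdm (Function.update x j v) / vdm x =
      (v - x i) / (x j - x i) * ∏ k ∈ (univ.erase j).erase i, ((v - x k) / (x j - x k)) := by
  have h1 := vdm_update x j v
  have hd : ∏ k ∈ univ.erase j, (x j - x k) ≠ 0 := by
    rw [prod_ne_zero_iff]
    intro k hk h0
    exact ne_of_mem_erase hk (vdm_ne_zero_iff.1 hx (sub_eq_zero.1 h0)).symm
  rw [mul_prod_erase (univ.erase j) (fun k => (v - x k) / (x j - x k))
    (mem_erase.2 ⟨hij, mem_univ i⟩), prod_div_distrib, div_eq_div_iff hx hd, h1, mul_comm]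

/-- The cancellation between the two orders of a pair of shifts. -/
theorem pair_identity {q t : ℂ} {x : Fin n → ℂ} (hx : IsGeneric q t x) {i j : Fin n}
    (hij : i ≠ j) :
    vdm (scalePt t {i} x) / vdm x * (vdm (scalePt t {j} (scalePt q {i} x)) /
        vdm (scalePt q {i} x)) * (q * x i - x j) +
      vdm (scalePt t {j} x) / vdm x * (vdm (scalePt t {i} (scalePt q {j} x)) /
        vdm (scalePt q {j} x)) * (q * x j - x i) =
      (q - 1) * (vdm (scalePt t {i, j} x) / vdm x * (x i + x j)) := by
  -- All factors with a third variable x_k collect in B i j * B j i, common to the three terms. What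
  -- remains is a rational identity in x_i, x_j, q and t.
  set B : Fin n → Fin n → ℂ := fun a b =>
    ∏ k ∈ (univ.erase a).erase b, ((t * x a - x k) / (x a - x k)) with hB
  have hv := hx.vdm_ne_zero
  have hxt : IsGeneric t q x := fun a b hab =>
    ⟨(hx a b hab).1, (hx a b hab).2.2, (hx a b hab).2.1⟩
  have hA : ∀ a b, a ≠ b → vdm (scalePt t {a} x) / vdm x =
      (t * x a - x b) / (x a - x b) * B a b := by
    intro a b hab
    rw [scalePt_singleton, vdm_update_div hab.symm hv]
  have hA2 : ∀ (s : ℂ) (a b : Fin n), a ≠ b → vdm (scalePt s {a} x) ≠ 0 →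
      vdm (scalePt t {b} (scalePt s {a} x)) / vdm (scalePt s {a} x) =
        (t * x b - s * x a) / (x b - s * x a) * B b a := by
    intro s a b hab hne
    have hb : scalePt s {a} x b = x b := by simp [scalePt, hab.symm]
    have ha : scalePt s {a} x a = s * x a := by simp [scalePt]
    rw [scalePt_singleton t b, vdm_update_div hab hne, hb, ha]
    congr 1
    refine prod_congr rfl fun k hk => ?_
    have : scalePt s {a} x k = x k := by simp [scalePt, ne_of_mem_erase hk]
    rw [this]
  have hAij : vdm (scalePt t {i, j} x) / vdm x = t * (B i j * B j i) := by
    have h1 : vdm (scalePt t {i, j} x) / vdm x = vdm (scalePt t {j} (scalePt t {i} x)) /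
        vdm (scalePt t {i} x) * (vdm (scalePt t {i} x) / vdm x) := by
      rw [scalePt_scalePt t hij, div_mul_div_cancel₀ (hxt.vdm_scalePt_ne_zero i)]
    rw [h1, hA2 t i j hij (hxt.vdm_scalePt_ne_zero i), hA i j hij]
    have h2 := (hx j i hij.symm).2.2
    have h3 := (hx i j hij).1
    have h4 : t * x i - x j = -(x j - t * x i) := by ring
    have h5 : t * x j - t * x i = -(t * (x i - x j)) := by ring
    rw [h4, h5]
    field_simp
  rw [hA i j hij, hA j i hij.symm, hA2 q i j hij (hx.vdm_scalePt_ne_zero i),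
    hA2 q j i hij.symm (hx.vdm_scalePt_ne_zero j), hAij]
  have h1 := (hx i j hij).1
  have h2 := (hx j i hij.symm).2.1
  have h3 := (hx i j hij).2.1
  -- The factor q x_i - x_j cancels the pole of the second coefficient at x_j = q x_i, and likewise
  -- with i and j exchanged.
  have e1 : q * x i - x j = -(x j - q * x i) := by ring
  have e2 : q * x j - x i = -(x i - q * x j) := by ring
  have e3 : x j - x i = -(x i - x j) := by ring
  rw [e1, e2, e3]
  generalize x j - q * x i = u at h2 ⊢
  generalize x i - q * x j = w at h3 ⊢
  obtain ⟨s, hs⟩ : ∃ s, s = x i - x j := ⟨_, rfl⟩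
  rw [← hs] at h1 ⊢
  field_simp
  rw [hs]
  ring

end PairIdentity

end Macdonald

namespace Macdonald

open MvPolynomial Finset

/-! ### Commutators of Macdonald operators with power sums -/

section Commutators

variable {n : ℕ}

theorem pointSum_scalePt (q : ℂ) (I : Finset (Fin n)) (x : Fin n → ℂ) (k : ℕ) :
    pointSum (scalePt q I x) k =
      pointSum x k + (q ^ (k + 1) - 1) * ∑ i ∈ I, x i ^ (k + 1) := by
  rw [pointSum, pointSum, mul_sum, ← Fintype.sum_ite_mem I, ← sum_add_distrib]
  refine sum_congr rfl fun i _ => ?_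
  rw [scalePt]
  split_ifs <;> ring

theorem eval_toPoly_powerSum (x : Fin n → ℂ) (k : ℕ) :
    eval x (toPoly (Fin n) (powerSum k)) = pointSum x k := by
  simp [powerSum, toPoly_X, psum, pointSum]

/-- The commutator of an operator with the multiplication by a power sum. -/
noncomputable def comm (T : SymFun →ₗ[ℂ] SymFun) (k : ℕ) : SymFun →ₗ[ℂ] SymFun :=
  T.comp (LinearMap.mulLeft ℂ (powerSum k)) - (LinearMap.mulLeft ℂ (powerSum k)).comp T

theorem comm_apply (T : SymFun →ₗ[ℂ] SymFun) (k : ℕ) (f : SymFun) :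
    comm T k f = T (powerSum k * f) - powerSum k * T f := rfl

theorem isHomog_powerSum_mul {f : SymFun} {d : ℕ} (hf : IsHomog f d) (k : ℕ) :
    IsHomog (powerSum k * f) (d + (k + 1)) := by
  rw [add_comm]
  exact (isHomog_powerSum k).mul hf

variable {q t : ℂ} (hq : ‖q‖ < 1) (ht : ‖t‖ < 1)

theorem isHomog_comm {T : SymFun →ₗ[ℂ] SymFun} (hT : ∀ f d, IsHomog f d → IsHomog (T f) d) (k : ℕ)
    {f : SymFun} {d : ℕ} (hf : IsHomog f d) : IsHomog (comm T k f) (d + (k + 1)) :=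
  (hT _ _ (isHomog_powerSum_mul hf k)).sub (isHomog_powerSum_mul (hT _ _ hf) k)

theorem sum_comm_level (hq0 : q ≠ 0) (ht0 : t ≠ 0) {f : SymFun} {d : ℕ} (hf : IsHomog f d)
    (k l : ℕ) (hn : d + (k + 1) ≤ n) (x : Fin n → ℂ) :
    ∑ I ∈ powersetCard l univ, vdm (scalePt t I x) * ((q ^ (k + 1) - 1) * ∑ i ∈ I, x i ^ (k + 1)) *
        eval (scalePt q I x) (toPoly (Fin n) f) =
      vdm x * eval x (toPoly (Fin n) (comm (levelOp hq ht n l) k f)) := by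
  have h1 := sum_level hq0 ht0 hq ht hf (by omega : d ≤ n) l x
  have h2 := sum_level hq0 ht0 hq ht (isHomog_powerSum_mul hf k) hn l x
  rw [comm_apply, map_sub, map_sub, mul_sub, ← h2,
    map_mul (toPoly (Fin n)) (powerSum k) (levelOp hq ht n l f), map_mul (eval x), mul_left_comm,
    ← h1, mul_sum, ← sum_sub_distrib]
  refine sum_congr rfl fun I _ => ?_
  rw [map_mul, map_mul, eval_toPoly_powerSum, eval_toPoly_powerSum, pointSum_scalePt]
  ring

theorem sum_comm_level_one (hq0 : q ≠ 0) (ht0 : t ≠ 0) {f : SymFun} {d : ℕ} (hf : IsHomog f d)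
    (k : ℕ) (hn : d + (k + 1) ≤ n) (x : Fin n → ℂ) :
    ∑ i, vdm (scalePt t {i} x) * ((q ^ (k + 1) - 1) * x i ^ (k + 1)) *
        eval (scalePt q {i} x) (toPoly (Fin n) f) =
      vdm x * eval x (toPoly (Fin n) (comm (levelOp hq ht n 1) k f)) := by
  rw [← sum_comm_level hq ht hq0 ht0 hf k 1 hn, powersetCard_one, sum_map]
  simp

theorem two_mul_sum_sum {ι M : Type*} [Fintype ι] [DecidableEq ι] [CommRing M] (c : ι → ι → M)
    (h : ∀ i, c i i = 0) :
    2 * ∑ i, ∑ j, c i j = ∑ p ∈ univ.offDiag, (c p.1 p.2 + c p.2 p.1) := by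
  have h1 : ∑ i, ∑ j, c i j = ∑ i, ∑ j, c j i := sum_comm
  have h2 : 2 * ∑ i, ∑ j, c i j = ∑ i, ∑ j, (c i j + c j i) := by
    simp_rw [sum_add_distrib]
    rw [← h1, two_mul]
  rw [h2, ← sum_product']
  symm
  apply sum_subset
  · intro p _
    simp
  · intro p _ hp
    have : p.1 = p.2 := by
      by_contra hc
      exact hp (mem_offDiag.2 ⟨mem_univ _, mem_univ _, hc⟩)
    rw [this, h, add_zero]

/-- The exchange relation between the first two Macdonald operators and `p₁`. -/
theorem exchange (hq0 : q ≠ 0) (ht0 : t ≠ 0) {f : SymFun} {d : ℕ} (hf : IsHomog f d)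
    (hn : d + 1 ≤ n) :
    q • comm (levelOp hq ht n 1) 0 (levelOp hq ht n 1 f) -
        levelOp hq ht n 1 (comm (levelOp hq ht n 1) 0 f) =
      (q - 1) • comm (levelOp hq ht n 2) 0 f := by
  set D := levelOp hq ht n 1 with hD
  have hDh : ∀ f d, IsHomog f d → IsHomog (D f) d := fun f d => isHomog_levelOp hq ht n 1
  have hEh : ∀ f d, IsHomog f d → IsHomog (levelOp hq ht n 2 f) d :=
    fun f d => isHomog_levelOp hq ht n 2
  rw [← sub_eq_zero]
  apply IsHomog.eq_zero (d := d + 1) _ hn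
  · apply eq_zero_of_isGeneric (q := q) (t := t)
    intro x hx
    set A : Fin n → (Fin n → ℂ) → ℂ := fun i y => vdm (scalePt t {i} y) / vdm y with hA
    set F : (Fin n → ℂ) → ℂ := fun y => eval y (toPoly (Fin n) f) with hF
    have eD : ∀ g d, IsHomog g d → d ≤ n → ∀ y, vdm y ≠ 0 → eval y (toPoly (Fin n) (D g)) =
        ∑ i, A i y * eval (scalePt q {i} y) (toPoly (Fin n) g) := by
      intro g d hg hd y hy
      apply mul_left_cancel₀ hy
      rw [← sum_level_one hq0 ht0 hq ht hg hd, mul_sum]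
      refine sum_congr rfl fun i _ => ?_
      rw [hA]
      field_simp
    have eZ : ∀ g d, IsHomog g d → d + 1 ≤ n → ∀ y, vdm y ≠ 0 →
        eval y (toPoly (Fin n) (comm D 0 g)) =
        ∑ i, A i y * ((q - 1) * y i) * eval (scalePt q {i} y) (toPoly (Fin n) g) := by
      intro g d hg hd y hy
      apply mul_left_cancel₀ hy
      rw [← sum_comm_level_one hq ht hq0 ht0 hg 0 hd, mul_sum]
      refine sum_congr rfl fun i _ => ?_
      rw [hA]
      field_simp
      ring
    have eE : 2 * eval x (toPoly (Fin n) (comm (levelOp hq ht n 2) 0 f)) =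
        ∑ p ∈ univ.offDiag, vdm (scalePt t {p.1, p.2} x) / vdm x *
          ((q - 1) * (x p.1 + x p.2)) * F (scalePt q {p.1, p.2} x) := by
      apply mul_left_cancel₀ hx.vdm_ne_zero
      rw [mul_left_comm, ← sum_comm_level hq ht hq0 ht0 hf 0 2 hn, ← sum_powersetCard_two, mul_sum]
      refine sum_congr rfl fun p hp => ?_
      have hv := hx.vdm_ne_zero
      rw [sum_pair (mem_offDiag.1 hp).2.2]
      field_simp
      ring
    have hv := hx.vdm_ne_zero
    -- Both products shift x_i and then x_j. They differ by where the factor (q - 1) x is read: at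
    -- x_i before the shifts, or at the j-th coordinate after the first one.
    have e1 : eval x (toPoly (Fin n) (q • comm D 0 (D f) - D (comm D 0 f))) =
        (q - 1) * ∑ i, ∑ j, A i x * A j (scalePt q {i} x) * (q * x i - scalePt q {i} x j) *
          F (scalePt q {j} (scalePt q {i} x)) := by
      rw [map_sub, map_sub, map_smul, smul_eval, eZ _ d (hDh f d hf) hn x hv,
        eD _ (d + 1) (isHomog_comm hDh 0 hf) hn x hv, mul_sum, mul_sum, ← sum_sub_distrib]
      refine sum_congr rfl fun i _ => ?_
      have hvi := hx.vdm_scalePt_ne_zero i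
      rw [eD f d hf (by omega) _ hvi, eZ f d hf hn _ hvi, mul_sum, mul_sum, mul_sum, mul_sum,
        ← sum_sub_distrib]
      exact sum_congr rfl fun j _ => by ring
    rw [map_sub, map_sub, map_smul, smul_eval, e1, ← mul_sub]
    apply mul_eq_zero_of_right
    rw [sub_eq_zero]
    apply mul_left_cancel₀ (two_ne_zero (α := ℂ))
    rw [two_mul_sum_sum, eE]
    · refine sum_congr rfl fun p hp => ?_
      have hij := (mem_offDiag.1 hp).2.2
      have h1 := pair_identity hx hij
      have e2 : scalePt q {p.1} x p.2 = x p.2 := by simp [scalePt, hij.symm]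
      have e3 : scalePt q {p.2} x p.1 = x p.1 := by simp [scalePt, hij]
      rw [scalePt_scalePt q hij, scalePt_scalePt q hij.symm, pair_comm p.2 p.1, e2, e3]
      simp only [hA]
      linear_combination F (scalePt q {p.1, p.2} x) * h1
    -- After the shift the i-th coordinate is q x_i, so the terms with a double shift vanish. This
    -- is what the factor q in the relation is for: only pairs of distinct indices remain, as in the
    -- second operator.
    · intro i
      have : scalePt q {i} x i = q * x i := by simp [scalePt]
      rw [this]
      ring
  · exact (((isHomog_comm hDh 0 (hDh f d hf)).smul q).sub
      (hDh _ _ (isHomog_comm hDh 0 hf))).sub ((isHomog_comm hEh 0 hf).smul _)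

end Commutators

/-! ### Matrix entries of the exchange relation -/

section Coefficients

theorem repr_diagOp {F : YoungDiagram → SymFun} (hF : IsUnitriangular F) (c : YoungDiagram → ℂ)
    (f : SymFun) (lam : YoungDiagram) :
    hF.basis.repr (diagOp hF c f) lam = c lam * hF.basis.repr f lam := by
  have h : (Finsupp.lapply lam).comp (hF.basis.repr.toLinearMap.comp (diagOp hF c)) =
      c lam • (Finsupp.lapply lam).comp hF.basis.repr.toLinearMap := by
    apply hF.basis.ext
    intro mu
    simp only [LinearMap.comp_apply, LinearMap.smul_apply, hF.basis_apply, diagOp_apply, map_smul,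
      Finsupp.lapply_apply, LinearEquiv.coe_coe, smul_eq_mul]
    rw [← hF.basis_apply mu, Module.Basis.repr_self, Finsupp.single_apply]
    split_ifs with h
    · rw [h]
    · simp
  exact LinearMap.congr_fun h f

theorem form_macP_eq_repr {q t : ℂ} (hq : ‖q‖ < 1) (ht : ‖t‖ < 1) (lam : YoungDiagram)
    (f : SymFun) : form q t (macP q t lam) f =
      (isUnitriangular_macP hq ht).basis.repr f lam * form q t (macP q t lam) (macP q t lam) := by
  set hP := isUnitriangular_macP hq ht
  have h : form q t (macP q t lam) = form q t (macP q t lam) (macP q t lam) •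
      (Finsupp.lapply lam).comp hP.basis.repr.toLinearMap := by
    apply hP.basis.ext
    intro mu
    simp only [LinearMap.comp_apply, LinearMap.smul_apply, Finsupp.lapply_apply,
      LinearEquiv.coe_coe, smul_eq_mul, Module.Basis.repr_self, Finsupp.single_apply]
    rw [hP.basis_apply]
    split_ifs with h
    · rw [h, mul_one]
    · rw [form_macP_of_ne hq ht (Ne.symm h), mul_zero]
  conv_lhs => rw [h]
  rw [mul_comm]
  rfl

/-- In the basis of the P_λ all operators in the relation are diagonal except p_1, so its entry at
(λ, μ) is a scalar times that of p_1. -/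
theorem exchange_coeff {q t : ℂ} (hq : ‖q‖ < 1) (ht : ‖t‖ < 1) (hq0 : q ≠ 0) (ht0 : t ≠ 0)
    {n : ℕ} (lam mu : YoungDiagram) (hn : mu.card + 1 ≤ n) :
    ((q * levelEigen n q t 1 mu - levelEigen n q t 1 lam) *
        (levelEigen n q t 1 lam - levelEigen n q t 1 mu) -
      (q - 1) * (levelEigen n q t 2 lam - levelEigen n q t 2 mu)) *
      form q t (macP q t lam) (powerSum 0 * macP q t mu) = 0 := by
  have hP := isUnitriangular_macP hq ht
  have h := exchange hq ht hq0 ht0 (hP.homog mu) hn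
  have hlev : ∀ k, levelOp hq ht n k (macP q t mu) = levelEigen n q t k mu • macP q t mu :=
    fun k => diagOp_apply _ _ _
  have h1 := congrArg (fun g => hP.basis.repr g lam) h
  simp only [comm_apply, hlev, mul_smul_comm, map_sub, map_smul, Finsupp.sub_apply,
    Finsupp.smul_apply, smul_eq_mul] at h1
  simp only [levelOp, repr_diagOp] at h1
  rw [form_macP_eq_repr hq ht]
  linear_combination form q t (macP q t lam) (macP q t lam) * h1

end Coefficients

end Macdonald

namespace Macdonald

open MvPolynomial Finset

/-! ### When the exchange relation forces a coefficient to vanish -/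

section Separation

/-- The leading coefficient satisfies a^2 = a, so a = 1. With p = X^N + r the equation becomes 2 X^N
r = r(X^2) - r^2; if r ≠ 0 the degrees give N + deg r ≤ 2 deg r, although deg r < N. -/
theorem card_support_le_one_of_mul_self {p : Polynomial ℂ} (h : p * p = Polynomial.expand ℂ 2 p) :
    #p.support ≤ 1 := by
  by_contra! hc
  set r := p.eraseLead with hr
  have hdeg : r.natDegree < p.natDegree := Polynomial.eraseLead_natDegree_lt hc
  have hr0 : r ≠ 0 := Polynomial.eraseLead_ne_zero hc
  have hp0 : p ≠ 0 := by
    rintro rfl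
    simp at hc
  have ha0 : p.leadingCoeff ≠ 0 := Polynomial.leadingCoeff_ne_zero.2 hp0
  have ha : p.leadingCoeff * p.leadingCoeff = p.leadingCoeff := by
    have := congrArg Polynomial.leadingCoeff h
    rwa [Polynomial.leadingCoeff_mul, Polynomial.leadingCoeff_expand two_pos] at this
  have hdec := p.eraseLead_add_C_mul_X_pow
  rw [← hr] at hdec
  have h1 : Polynomial.C (2 * p.leadingCoeff) * Polynomial.X ^ p.natDegree * r =
      Polynomial.expand ℂ 2 r - r * r := by
    have hCa : Polynomial.C p.leadingCoeff * Polynomial.C p.leadingCoeff =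
        Polynomial.C p.leadingCoeff := by rw [← Polynomial.C_mul, ha]
    generalize p.natDegree = N at *
    generalize p.leadingCoeff = a at *
    rw [← hdec, map_add, map_mul, map_pow, Polynomial.expand_C, Polynomial.expand_X] at h
    rw [Polynomial.C_mul, show Polynomial.C (2 : ℂ) = 2 from rfl]
    linear_combination h - Polynomial.X ^ (2 * N) * hCa
  have h2 := congrArg Polynomial.natDegree h1
  rw [Polynomial.natDegree_mul (mul_ne_zero (Polynomial.C_ne_zero.2 (mul_ne_zero two_ne_zero ha0))
    (pow_ne_zero _ Polynomial.X_ne_zero)) hr0, Polynomial.natDegree_C_mul_X_pow _ _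
    (mul_ne_zero two_ne_zero ha0)] at h2
  have h3 : (Polynomial.expand ℂ 2 r - r * r).natDegree ≤ r.natDegree * 2 := by
    refine (Polynomial.natDegree_sub_le _ _).trans (max_le ?_ ?_)
    · rw [Polynomial.natDegree_expand]
    · rw [Polynomial.natDegree_mul hr0 hr0]
      omega
  omega

/-- The generating function of the boxes of a diagram. -/
noncomputable def boxSum (n : ℕ) (q t : ℂ) (lam : YoungDiagram) : ℂ :=
  ∑ c ∈ lam.cells, t ^ (n - 1 - c.1) * q ^ c.2

theorem levelEigen_one (n : ℕ) (q t : ℂ) (lam : YoungDiagram) : levelEigen n q t 1 lam =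
    ∑ i : Fin n, t ^ (n - 1 - i : ℕ) * q ^ lam.rowLen i := by
  rw [levelEigen, powersetCard_one, sum_map]
  simp

theorem two_mul_levelEigen_two (n : ℕ) (q t : ℂ) (lam : YoungDiagram) :
    2 * levelEigen n q t 2 lam =
      levelEigen n q t 1 lam ^ 2 - levelEigen n (q ^ 2) (t ^ 2) 1 lam := by
  classical
  rw [levelEigen_one, levelEigen_one, levelEigen, ← sum_powersetCard_two]
  set y : Fin n → ℂ := fun i => t ^ (n - 1 - i : ℕ) * q ^ lam.rowLen i with hy
  have h1 : ∑ i : Fin n, (t ^ 2) ^ (n - 1 - i : ℕ) * (q ^ 2) ^ lam.rowLen i = ∑ i, y i * y i :=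
    sum_congr rfl fun i _ => by simp only [hy]; ring
  have h2 : ∑ p ∈ (univ : Finset (Fin n)).offDiag, ∏ i ∈ {p.1, p.2}, y i =
      ∑ p ∈ (univ : Finset (Fin n)).offDiag, y p.1 * y p.2 :=
    sum_congr rfl fun p hp => prod_pair (mem_offDiag.1 hp).2.2
  have h3 : (∑ i, y i) ^ 2 = ∑ p ∈ (univ : Finset (Fin n)) ×ˢ univ, y p.1 * y p.2 := by
    rw [sq, sum_mul_sum]
    exact (sum_product' univ univ fun i j => y i * y j).symm
  have h4 : ∑ i, y i * y i = ∑ p ∈ (univ : Finset (Fin n)).diag, y p.1 * y p.2 := by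
    rw [sum_diag]
  rw [h1]
  refine h2.trans ?_
  change _ = (∑ i, y i) ^ 2 - _
  rw [h3, h4, ← diag_union_offDiag, sum_union (disjoint_diag_offDiag _)]
  ring

theorem levelEigen_one_eq_boxSum {n : ℕ} {lam : YoungDiagram} (hn : lam.colLen 0 ≤ n) (q t : ℂ) :
    levelEigen n q t 1 lam =
      ∑ i : Fin n, t ^ (n - 1 - i : ℕ) + (q - 1) * boxSum n q t lam := by
  have h1 : boxSum n q t lam =
      ∑ i ∈ range n, ∑ j ∈ range (lam.rowLen i), t ^ (n - 1 - i) * q ^ j := by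
    rw [boxSum]
    apply sum_finset_product
    rintro ⟨i, j⟩
    simp only [YoungDiagram.mem_cells, mem_range]
    rw [← YoungDiagram.mem_iff_lt_rowLen]
    refine ⟨fun h => ⟨?_, h⟩, fun h => h.2⟩
    have := lam.up_left_mem le_rfl (Nat.zero_le j) h
    rw [YoungDiagram.mem_iff_lt_colLen] at this
    omega
  rw [levelEigen_one, h1, sum_range, mul_sum, ← sum_add_distrib]
  refine sum_congr rfl fun i _ => ?_
  rw [← mul_sum]
  have h2 := mul_geom_sum q (lam.rowLen i)
  linear_combination (-t ^ (n - 1 - i : ℕ)) * h2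

/-- The difference of the box generating functions, specialized to `q = s`, `t = s ^ M`. -/
noncomputable def boxPoly (n M : ℕ) (lam : YoungDiagram) : Polynomial ℂ :=
  ∑ c ∈ lam.cells, Polynomial.X ^ (M * (n - 1 - c.1) + c.2)

theorem eval_boxPoly (n M : ℕ) (lam : YoungDiagram) (s : ℂ) :
    (boxPoly n M lam).eval s = boxSum n s (s ^ M) lam := by
  rw [boxPoly, Polynomial.eval_finsetSum, boxSum]
  refine sum_congr rfl fun c _ => ?_
  rw [Polynomial.eval_pow, Polynomial.eval_X, pow_add, pow_mul]

/-- As M bounds the row lengths, a box is recovered from its exponent M (n - 1 - i) + j by division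
with remainder, so distinct boxes give distinct monomials. -/
theorem coeff_boxPoly {n M : ℕ} {lam : YoungDiagram} (hn : lam.colLen 0 ≤ n)
    (hM : lam.rowLen 0 ≤ M) {c : ℕ × ℕ} (h1 : c.1 < n) (h2 : c.2 < M) :
    (boxPoly n M lam).coeff (M * (n - 1 - c.1) + c.2) = if c ∈ lam then 1 else 0 := by
  rw [boxPoly, Polynomial.finsetSum_coeff]
  simp_rw [Polynomial.coeff_X_pow]
  have key : ∀ e ∈ lam.cells,
      (M * (n - 1 - c.1) + c.2 = M * (n - 1 - e.1) + e.2 ↔ c = e) := by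
    rintro ⟨i, j⟩ he
    rw [YoungDiagram.mem_cells] at he
    have hi : i < n := by
      have := lam.up_left_mem le_rfl (Nat.zero_le j) he
      rw [YoungDiagram.mem_iff_lt_colLen] at this
      omega
    have hj : j < M := by
      have := lam.up_left_mem (Nat.zero_le i) le_rfl he
      rw [YoungDiagram.mem_iff_lt_rowLen] at this
      omega
    constructor
    · intro h
      have hmod := congrArg (· % M) h
      have hdiv := congrArg (· / M) h
      simp only [Nat.mul_add_mod, Nat.mod_eq_of_lt h2, Nat.mod_eq_of_lt hj] at hmod
      have hM0 : 0 < M := by omega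
      simp only [Nat.mul_add_div hM0, Nat.div_eq_of_lt h2, Nat.div_eq_of_lt hj] at hdiv
      ext
      · simp only; omega
      · exact hmod
    · rintro rfl
      rfl
  rw [sum_congr rfl fun e he => by rw [if_congr (key e he) rfl rfl], sum_ite_eq]
  simp [YoungDiagram.mem_cells]

/-- The factor in `exchange_coeff`. -/
noncomputable def exchangeFactor (n : ℕ) (lam mu : YoungDiagram) (p : ℂ × ℂ) : ℂ :=
  (p.1 * levelEigen n p.1 p.2 1 mu - levelEigen n p.1 p.2 1 lam) *
      (levelEigen n p.1 p.2 1 lam - levelEigen n p.1 p.2 1 mu) -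
    (p.1 - 1) * (levelEigen n p.1 p.2 2 lam - levelEigen n p.1 p.2 2 mu)

/-- Use 2 e_2 = e_1^2 - p_2 and e_1 = const + (q - 1) B: the terms quadratic in the first
eigenvalues combine to -(q + 1) (c_λ - c_μ)^2, and p_2 is e_1 at (q^2, t^2). -/
theorem exchangeFactor_eq {n : ℕ} {lam mu : YoungDiagram} (hlam : lam.colLen 0 ≤ n)
    (hmu : mu.colLen 0 ≤ n) (q t : ℂ) : 2 * exchangeFactor n lam mu (q, t) =
      (q - 1) ^ 2 * (q + 1) * ((boxSum n (q ^ 2) (t ^ 2) lam - boxSum n (q ^ 2) (t ^ 2) mu) -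
        (boxSum n q t lam - boxSum n q t mu) ^ 2) := by
  have h1 := two_mul_levelEigen_two n q t lam
  have h2 := two_mul_levelEigen_two n q t mu
  rw [levelEigen_one_eq_boxSum hlam, levelEigen_one_eq_boxSum hlam] at h1
  rw [levelEigen_one_eq_boxSum hmu, levelEigen_one_eq_boxSum hmu] at h2
  rw [exchangeFactor]
  simp only
  rw [levelEigen_one_eq_boxSum hlam, levelEigen_one_eq_boxSum hmu]
  linear_combination (1 - q) * h1 - (1 - q) * h2

/-- On the curve q = s, t = s^M the difference of box sums is a polynomial P with a coefficient 1
from the box c and -1 from the box e. Having two monomials, it cannot satisfy P(s)^2 = P(s^2)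
identically. -/
theorem exists_exchangeFactor_ne_zero {n : ℕ} {lam mu : YoungDiagram} (hlam : lam.colLen 0 ≤ n)
    (hmu : mu.colLen 0 ≤ n) {c e : ℕ × ℕ} (hc : c ∈ lam) (hc' : c ∉ mu) (he : e ∈ mu)
    (he' : e ∉ lam) :
    ∃ p ∈ polydisc, p.1 * p.2 * exchangeFactor n lam mu p ≠ 0 := by
  set M := max (lam.rowLen 0) (mu.rowLen 0) with hM
  have hbd : ∀ {nu : YoungDiagram} {c : ℕ × ℕ}, nu.colLen 0 ≤ n → nu.rowLen 0 ≤ M → c ∈ nu →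
      c.1 < n ∧ c.2 < M := by
    rintro nu ⟨i, j⟩ h1 h2 hcm
    have h3 := nu.up_left_mem le_rfl (Nat.zero_le j) hcm
    have h4 := nu.up_left_mem (Nat.zero_le i) le_rfl hcm
    rw [YoungDiagram.mem_iff_lt_colLen] at h3
    rw [YoungDiagram.mem_iff_lt_rowLen] at h4
    exact ⟨by omega, by omega⟩
  have hc1 := hbd hlam (le_max_left _ _) hc
  have he1 := hbd hmu (le_max_right _ _) he
  set P := boxPoly n M lam - boxPoly n M mu with hP
  have hPc : P.coeff (M * (n - 1 - c.1) + c.2) = 1 := by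
    rw [hP, Polynomial.coeff_sub, coeff_boxPoly hlam (le_max_left _ _) hc1.1 hc1.2,
      coeff_boxPoly hmu (le_max_right _ _) hc1.1 hc1.2, if_pos hc, if_neg hc', sub_zero]
  have hPe : P.coeff (M * (n - 1 - e.1) + e.2) = -1 := by
    rw [hP, Polynomial.coeff_sub, coeff_boxPoly hlam (le_max_left _ _) he1.1 he1.2,
      coeff_boxPoly hmu (le_max_right _ _) he1.1 he1.2, if_pos he, if_neg he', zero_sub]
  have hne : P * P ≠ Polynomial.expand ℂ 2 P := by
    intro h
    have h1 := card_le_one.1 (card_support_le_one_of_mul_self h) _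
      (Polynomial.mem_support_iff.2 (by rw [hPc]; exact one_ne_zero)) _
      (Polynomial.mem_support_iff.2 (by rw [hPe]; norm_num))
    rw [h1, hPe] at hPc
    norm_num at hPc
  set G : Polynomial ℂ := (Polynomial.expand ℂ 2 P - P * P) * Polynomial.X with hG
  have hG0 : G ≠ 0 := mul_ne_zero (sub_ne_zero.2 hne.symm) Polynomial.X_ne_zero
  have hinf : (Metric.ball (0 : ℂ) 1).Infinite :=
    infinite_of_mem_nhds (0 : ℂ) (Metric.ball_mem_nhds 0 one_pos)
  obtain ⟨s, hs, hsG⟩ : ∃ s ∈ Metric.ball (0 : ℂ) 1, G.eval s ≠ 0 := by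
    by_contra! hcon
    exact hG0 (Polynomial.eq_zero_of_infinite_isRoot G (hinf.mono fun s hs => hcon s hs))
  rw [hG, Polynomial.eval_mul, Polynomial.eval_X] at hsG
  have hs0 : s ≠ 0 := right_ne_zero_of_mul hsG
  have hs1 : ‖s‖ < 1 := by simpa using hs
  have hM0 : M ≠ 0 := by omega
  refine ⟨(s, s ^ M), mem_polydisc.2 ⟨hs1, ?_⟩, ?_⟩
  · rw [norm_pow]
    exact pow_lt_one₀ (norm_nonneg _) hs1 hM0
  · refine mul_ne_zero (mul_ne_zero hs0 (pow_ne_zero _ hs0)) fun h0 => ?_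
    have h1 := exchangeFactor_eq hlam hmu s (s ^ M)
    rw [h0, mul_zero, eq_comm] at h1
    have h2 := left_ne_zero_of_mul hsG
    rw [Polynomial.eval_sub, Polynomial.eval_mul, Polynomial.expand_eval, hP, Polynomial.eval_sub,
      Polynomial.eval_sub, eval_boxPoly, eval_boxPoly, eval_boxPoly, eval_boxPoly] at h2
    have h3 : s - 1 ≠ 0 := by
      intro h
      rw [sub_eq_zero.1 h] at hs1
      simp at hs1
    have h4 : s + 1 ≠ 0 := by
      intro h
      rw [eq_neg_of_add_eq_zero_left h] at hs1
      simp at hs1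
    apply h2
    have h5 := (mul_eq_zero.1 h1).resolve_left (mul_ne_zero (pow_ne_zero 2 h3) h4)
    have h6 : (s ^ 2) ^ M = (s ^ M) ^ 2 := pow_right_comm s 2 M
    rw [h6, ← h5]
    ring

end Separation

/-! ### Multiplication by power sums enlarges diagrams -/

section Pieri

theorem differentiable_levelEigen (n k : ℕ) (lam : YoungDiagram) :
    Differentiable ℂ (fun p : ℂ × ℂ => levelEigen n p.1 p.2 k lam) := by
  rw [← differentiableOn_univ]
  unfold levelEigen
  refine DifferentiableOn.fun_sum fun I _ => differentiableOn_prod _ fun i _ => ?_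
  fun_prop

theorem continuousOn_form_macP_mul (lam mu : YoungDiagram) (g : SymFun) :
    ContinuousOn (fun p : ℂ × ℂ => form p.1 p.2 (macP p.1 p.2 lam) (g * macP p.1 p.2 mu))
      polydisc := by
  have h : ContinuousOn (fun p : ℂ × ℂ => ∑ a ∈ ofSize lam.card, ∑ b ∈ ofSize mu.card,
      mCoeff a (macP p.1 p.2 lam) * (mCoeff b (macP p.1 p.2 mu) *
        form p.1 p.2 (mon a) (g * mon b))) polydisc := by
    refine continuousOn_finsetSum _ fun a _ => continuousOn_finsetSum _ fun b _ => ?_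
    exact (continuousOn_mCoeff_macP lam a).mul ((continuousOn_mCoeff_macP mu b).mul
      (differentiableOn_form _ _).continuousOn)
  refine h.congr fun p hp => ?_
  obtain ⟨hq, ht⟩ := mem_polydisc.1 hp
  have hP := isUnitriangular_macP hq ht
  conv_lhs => rw [(hP.homog lam).eq_sum_mon, (hP.homog mu).eq_sum_mon]
  rw [mul_sum, map_sum]
  refine Eq.trans ?_ sum_comm
  refine sum_congr rfl fun b _ => ?_
  rw [map_sum, LinearMap.sum_apply]
  refine sum_congr rfl fun a _ => ?_
  rw [mul_smul_comm, map_smul, map_smul, LinearMap.smul_apply, smul_eq_mul, smul_eq_mul]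
  ring

theorem form_macP_powerSum_mul_of_card {q t : ℂ} (hq : ‖q‖ < 1) (ht : ‖t‖ < 1)
    {lam mu : YoungDiagram} {k : ℕ} (h : lam.card ≠ mu.card + (k + 1)) :
    form q t (macP q t lam) (powerSum k * macP q t mu) = 0 :=
  form_eq_zero_of_ne q t ((isUnitriangular_macP hq ht).homog lam)
    (isHomog_powerSum_mul ((isUnitriangular_macP hq ht).homog mu) k) h

theorem exists_mem_notMem_of_not_le {lam mu : YoungDiagram} (h : ¬ mu ≤ lam) :
    ∃ e, e ∈ mu ∧ e ∉ lam := by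
  by_contra! hc
  exact h fun e he => hc e he

/-- In the only relevant degree |λ| = |μ| + 1, noncontainment gives a box on each side that the
other lacks. Hence the exchange factor is not identically zero, and the coefficient, zero where qt
times that factor is not, vanishes by continuity everywhere. -/
theorem form_macP_powerSum_zero_mul {q t : ℂ} (hq : ‖q‖ < 1) (ht : ‖t‖ < 1)
    {lam mu : YoungDiagram} (h : ¬ mu ≤ lam) :
    form q t (macP q t lam) (powerSum 0 * macP q t mu) = 0 := by
  by_cases hcard : lam.card = mu.card + 1
  · obtain ⟨e, he, he'⟩ := exists_mem_notMem_of_not_le h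
    obtain ⟨c, hc, hc'⟩ : ∃ c, c ∈ lam ∧ c ∉ mu := by
      apply exists_mem_notMem_of_not_le
      intro hle
      have := card_le_card (YoungDiagram.cells_subset_iff.2 hle)
      change lam.card ≤ mu.card at this
      omega
    have hlam : lam.colLen 0 ≤ mu.card + 1 := (colLen_zero_le_card lam).trans hcard.le
    have hmu : mu.colLen 0 ≤ mu.card + 1 := (colLen_zero_le_card mu).trans (Nat.le_succ _)
    obtain ⟨p₁, hp₁, hne⟩ := exists_exchangeFactor_ne_zero hlam hmu hc hc' he he'
    refine eq_zero_of_forall_ne_zero (continuousOn_form_macP_mul lam mu (powerSum 0))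
      (R := fun p => p.1 * p.2 * exchangeFactor (mu.card + 1) lam mu p) ?_ hp₁ hne
      (fun p hp hR => ?_) (p := (q, t)) (mem_polydisc.2 ⟨hq, ht⟩)
    · have h1 := differentiable_levelEigen (mu.card + 1) 1 lam
      have h2 := differentiable_levelEigen (mu.card + 1) 1 mu
      have h3 := differentiable_levelEigen (mu.card + 1) 2 lam
      have h4 := differentiable_levelEigen (mu.card + 1) 2 mu
      unfold exchangeFactor
      fun_prop
    · obtain ⟨hq, ht⟩ := mem_polydisc.1 hp
      have h1 := left_ne_zero_of_mul hR
      exact (mul_eq_zero.1 (exchange_coeff hq ht (left_ne_zero_of_mul h1)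
        (right_ne_zero_of_mul h1) lam mu le_rfl)).resolve_left (right_ne_zero_of_mul hR)
  · exact form_macP_powerSum_mul_of_card hq ht hcard

/-- The operators that map every member of a family to a combination of members with larger
diagrams. -/
def IsRaising {F : YoungDiagram → SymFun} (hF : IsUnitriangular F) (T : SymFun →ₗ[ℂ] SymFun) :
    Prop :=
  ∀ mu lam, ¬ mu ≤ lam → hF.basis.repr (T (F mu)) lam = 0

theorem IsRaising.repr_apply {F : YoungDiagram → SymFun} {hF : IsUnitriangular F}
    {T : SymFun →ₗ[ℂ] SymFun} (hT : IsRaising hF T) {f : SymFun} {lam : YoungDiagram}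
    (h : ∀ nu, nu ≤ lam → hF.basis.repr f nu = 0) : hF.basis.repr (T f) lam = 0 := by
  conv_lhs => rw [← hF.basis.linearCombination_repr f]
  rw [Finsupp.linearCombination_apply, Finsupp.sum, map_sum, map_sum, Finsupp.finsetSum_apply]
  refine sum_eq_zero fun nu _ => ?_
  rw [map_smul, map_smul, Finsupp.smul_apply, hF.basis_apply]
  by_cases hle : nu ≤ lam
  · rw [h nu hle, zero_smul]
  · rw [hT nu lam hle, smul_zero]

theorem IsRaising.comp {F : YoungDiagram → SymFun} {hF : IsUnitriangular F}
    {S T : SymFun →ₗ[ℂ] SymFun} (hS : IsRaising hF S) (hT : IsRaising hF T) :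
    IsRaising hF (S.comp T) := fun mu _ h =>
  hS.repr_apply fun nu hnu => hT mu nu fun hle => h (hle.trans hnu)

theorem IsRaising.sub {F : YoungDiagram → SymFun} {hF : IsUnitriangular F}
    {S T : SymFun →ₗ[ℂ] SymFun} (hS : IsRaising hF S) (hT : IsRaising hF T) :
    IsRaising hF (S - T) := fun mu lam h => by
  rw [LinearMap.sub_apply, map_sub, Finsupp.sub_apply, hS mu lam h, hT mu lam h, sub_zero]

theorem isRaising_diagOp {F : YoungDiagram → SymFun} (hF : IsUnitriangular F)
    (c : YoungDiagram → ℂ) : IsRaising hF (diagOp hF c) := fun mu lam h => by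
  rw [diagOp_apply, ← hF.basis_apply, map_smul, Module.Basis.repr_self, Finsupp.smul_apply,
    Finsupp.single_eq_of_ne (by rintro rfl; exact h le_rfl), smul_zero]

theorem repr_eq_zero_iff_form {q t : ℂ} (hq : ‖q‖ < 1) (ht : ‖t‖ < 1) (lam : YoungDiagram)
    (f : SymFun) : (isUnitriangular_macP hq ht).basis.repr f lam = 0 ↔
      form q t (macP q t lam) f = 0 := by
  rw [form_macP_eq_repr hq ht, mul_eq_zero, or_iff_left (form_macP_self_ne_zero hq ht lam)]

theorem isRaising_powerSum_zero {q t : ℂ} (hq : ‖q‖ < 1) (ht : ‖t‖ < 1) :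
    IsRaising (isUnitriangular_macP hq ht) (LinearMap.mulLeft ℂ (powerSum 0)) := fun _ _ h =>
  (repr_eq_zero_iff_form hq ht _ _).2 (form_macP_powerSum_zero_mul hq ht h)

theorem IsRaising.comm {q t : ℂ} {hq : ‖q‖ < 1} {ht : ‖t‖ < 1} {T : SymFun →ₗ[ℂ] SymFun}
    (hT : IsRaising (isUnitriangular_macP hq ht) T) :
    IsRaising (isUnitriangular_macP hq ht) (comm T 0) :=
  (hT.comp (isRaising_powerSum_zero hq ht)).sub ((isRaising_powerSum_zero hq ht).comp hT)

/-- The iterated commutators of the first Macdonald operator with `p₁`. -/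
noncomputable def iterComm {q t : ℂ} (hq : ‖q‖ < 1) (ht : ‖t‖ < 1) (n : ℕ) :
    ℕ → SymFun →ₗ[ℂ] SymFun
  | 0 => levelOp hq ht n 1
  | k + 1 => comm (iterComm hq ht n k) 0

theorem isRaising_iterComm {q t : ℂ} (hq : ‖q‖ < 1) (ht : ‖t‖ < 1) (n k : ℕ) :
    IsRaising (isUnitriangular_macP hq ht) (iterComm hq ht n k) := by
  induction k with
  | zero => exact isRaising_diagOp _ _
  | succ k ih => exact IsRaising.comm (hq := hq) (ht := ht) ih

theorem isHomog_iterComm {q t : ℂ} (hq : ‖q‖ < 1) (ht : ‖t‖ < 1) (n k : ℕ) {f : SymFun} {d : ℕ}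
    (hf : IsHomog f d) : IsHomog (iterComm hq ht n k f) (d + k) := by
  induction k generalizing f d with
  | zero => exact isHomog_levelOp hq ht n 1 hf
  | succ k ih =>
    have h1 := ih (isHomog_powerSum_mul hf 0)
    have h2 := isHomog_powerSum_mul (ih hf) 0
    rw [zero_add] at h1 h2
    rw [show d + 1 + k = d + (k + 1) by omega] at h1
    rw [add_assoc] at h2
    exact h1.sub h2

theorem sum_iterComm {q t : ℂ} (hq0 : q ≠ 0) (ht0 : t ≠ 0) (hq : ‖q‖ < 1) (ht : ‖t‖ < 1) {n : ℕ}
    (k : ℕ) {f : SymFun} {d : ℕ} (hf : IsHomog f d) (hn : d + k ≤ n) (x : Fin n → ℂ) :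
    ∑ i, vdm (scalePt t {i} x) * ((q - 1) ^ k * x i ^ k) *
        eval (scalePt q {i} x) (toPoly (Fin n) f) =
      vdm x * eval x (toPoly (Fin n) (iterComm hq ht n k f)) := by
  induction k generalizing f d with
  | zero =>
    rw [iterComm, ← sum_level_one hq0 ht0 hq ht hf hn]
    simp
  | succ k ih =>
    have h1 := ih hf (by omega)
    have h2 := ih (isHomog_powerSum_mul hf 0) (by omega)
    rw [iterComm, comm_apply, map_sub, map_sub, mul_sub, ← h2,
      map_mul (toPoly (Fin n)) (powerSum 0) (iterComm hq ht n k f), map_mul (eval x), mul_left_comm,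
      ← h1, mul_sum, ← sum_sub_distrib]
    refine sum_congr rfl fun i _ => ?_
    rw [map_mul, map_mul, eval_toPoly_powerSum, eval_toPoly_powerSum, pointSum_scalePt,
      sum_singleton]
    ring

/-- A shift operator T_i satisfies [T_i, p_k] = (q^k - 1) x_i^k T_i. So commuting the first operator
with p_{k+1} once, or with p_1 a total of k + 1 times, inserts the same factor x_i^(k+1) up to a
constant. -/
theorem smul_comm_eq_iterComm {q t : ℂ} (hq0 : q ≠ 0) (ht0 : t ≠ 0) (hq : ‖q‖ < 1) (ht : ‖t‖ < 1)
    {n : ℕ} (k : ℕ) {f : SymFun} {d : ℕ} (hf : IsHomog f d) (hn : d + (k + 1) ≤ n) :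
    (q - 1) ^ (k + 1) • comm (levelOp hq ht n 1) k f =
      (q ^ (k + 1) - 1) • iterComm hq ht n (k + 1) f := by
  rw [← sub_eq_zero]
  apply IsHomog.eq_zero (d := d + (k + 1)) _ hn
  · apply eq_zero_of_eval_eq_zero
    intro x hx _
    have hv := vdm_ne_zero_iff.2 hx
    rw [map_sub, map_sub, map_smul (toPoly (Fin n)), map_smul (toPoly (Fin n)), smul_eval,
      smul_eval, sub_eq_zero]
    apply mul_left_cancel₀ hv
    rw [mul_left_comm, ← sum_comm_level_one hq ht hq0 ht0 hf k hn, mul_left_comm (vdm x),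
      ← sum_iterComm hq0 ht0 hq ht (k + 1) hf hn, mul_sum, mul_sum]
    exact sum_congr rfl fun i _ => by ring
  · exact ((isHomog_comm (fun f d => isHomog_levelOp hq ht n 1) k hf).smul _).sub
      ((isHomog_iterComm hq ht n (k + 1) hf).smul _)

theorem exists_levelEigen_ne {n : ℕ} {lam mu : YoungDiagram} (hlam : lam.colLen 0 ≤ n)
    (hmu : mu.colLen 0 ≤ n) (hne : lam ≠ mu) :
    ∃ p ∈ polydisc, p.1 * p.2 * (levelEigen n p.1 p.2 1 lam - levelEigen n p.1 p.2 1 mu) ≠ 0 := by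
  set M := max (lam.rowLen 0) (mu.rowLen 0) with hM
  obtain ⟨c, hc⟩ : ∃ c, ¬ (c ∈ lam ↔ c ∈ mu) := by
    by_contra! hcon
    exact hne (YoungDiagram.ext (Finset.ext fun c => hcon c))
  have hbd : c.1 < n ∧ c.2 < M := by
    obtain ⟨i, j⟩ := c
    have h1 : (i, j) ∈ lam ∨ (i, j) ∈ mu := by tauto
    rcases h1 with h | h
    all_goals
      have h3 := YoungDiagram.up_left_mem _ le_rfl (Nat.zero_le j) h
      have h4 := YoungDiagram.up_left_mem _ (Nat.zero_le i) le_rfl h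
      rw [YoungDiagram.mem_iff_lt_colLen] at h3
      rw [YoungDiagram.mem_iff_lt_rowLen] at h4
      exact ⟨by omega, by omega⟩
  set P := boxPoly n M lam - boxPoly n M mu with hP
  have hP0 : P ≠ 0 := by
    intro h0
    have h1 := congrArg (Polynomial.coeff · (M * (n - 1 - c.1) + c.2)) h0
    simp only [hP, Polynomial.coeff_sub, Polynomial.coeff_zero] at h1
    rw [coeff_boxPoly hlam (le_max_left _ _) hbd.1 hbd.2,
      coeff_boxPoly hmu (le_max_right _ _) hbd.1 hbd.2] at h1
    by_cases h2 : c ∈ lam <;> by_cases h3 : c ∈ mu <;> simp_all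
  have hinf : (Metric.ball (0 : ℂ) 1).Infinite :=
    infinite_of_mem_nhds (0 : ℂ) (Metric.ball_mem_nhds 0 one_pos)
  obtain ⟨s, hs, hsG⟩ : ∃ s ∈ Metric.ball (0 : ℂ) 1, (P * Polynomial.X).eval s ≠ 0 := by
    by_contra! hcon
    exact mul_ne_zero hP0 Polynomial.X_ne_zero
      (Polynomial.eq_zero_of_infinite_isRoot _ (hinf.mono fun s hs => hcon s hs))
  rw [Polynomial.eval_mul, Polynomial.eval_X] at hsG
  have hs0 : s ≠ 0 := right_ne_zero_of_mul hsG
  have hs1 : ‖s‖ < 1 := by simpa using hs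
  refine ⟨(s, s ^ M), mem_polydisc.2 ⟨hs1, ?_⟩, ?_⟩
  · rw [norm_pow]
    exact pow_lt_one₀ (norm_nonneg _) hs1 (by omega)
  · refine mul_ne_zero (mul_ne_zero hs0 (pow_ne_zero _ hs0)) fun h0 => ?_
    rw [levelEigen_one_eq_boxSum hlam, levelEigen_one_eq_boxSum hmu, add_sub_add_left_eq_sub,
      ← mul_sub] at h0
    have h3 : s - 1 ≠ 0 := by
      intro h
      rw [sub_eq_zero.1 h] at hs1
      simp at hs1
    apply left_ne_zero_of_mul hsG
    rw [hP, Polynomial.eval_sub, eval_boxPoly, eval_boxPoly]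
    exact (mul_eq_zero.1 h0).resolve_left h3

/-- Multiplication by a power sum enlarges diagrams. -/
theorem form_macP_powerSum_mul {q t : ℂ} (hq : ‖q‖ < 1) (ht : ‖t‖ < 1)
    {lam mu : YoungDiagram} (h : ¬ mu ≤ lam) (k : ℕ) :
    form q t (macP q t lam) (powerSum k * macP q t mu) = 0 := by
  by_cases hcard : lam.card = mu.card + (k + 1)
  · set n := mu.card + (k + 1) with hn
    have hlam : lam.colLen 0 ≤ n := (colLen_zero_le_card lam).trans hcard.le
    have hmu : mu.colLen 0 ≤ n := (colLen_zero_le_card mu).trans (by omega)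
    obtain ⟨p₁, hp₁, hne⟩ := exists_levelEigen_ne hlam hmu (by rintro rfl; exact h le_rfl)
    refine eq_zero_of_forall_ne_zero (continuousOn_form_macP_mul lam mu (powerSum k))
      (R := fun p => p.1 * p.2 * (levelEigen n p.1 p.2 1 lam - levelEigen n p.1 p.2 1 mu)) ?_ hp₁
      hne (fun p hp hR => ?_) (p := (q, t)) (mem_polydisc.2 ⟨hq, ht⟩)
    · have h1 := differentiable_levelEigen n 1 lam
      have h2 := differentiable_levelEigen n 1 mu
      fun_prop
    · obtain ⟨hq, ht⟩ := mem_polydisc.1 hp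
      have hP := isUnitriangular_macP hq ht
      have hq0 := left_ne_zero_of_mul (left_ne_zero_of_mul hR)
      have ht0 := right_ne_zero_of_mul (left_ne_zero_of_mul hR)
      -- At the entry (λ, μ) the iterated commutator is raising and contributes zero, while the left
      -- side is (q - 1)^(k+1) (c_λ - c_μ) times the wanted coefficient.
      have h1 := smul_comm_eq_iterComm hq0 ht0 hq ht k (hP.homog mu) hn.ge
      have h2 := congrArg (fun g => hP.basis.repr g lam) h1
      have hlev : levelOp hq ht n 1 (macP p.1 p.2 mu) =
          levelEigen n p.1 p.2 1 mu • macP p.1 p.2 mu := diagOp_apply _ _ _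
      simp only [map_smul, Finsupp.smul_apply, comm_apply, hlev, mul_smul_comm, map_sub,
        Finsupp.sub_apply, smul_eq_mul] at h2
      rw [isRaising_iterComm hq ht n (k + 1) mu lam h, mul_zero, levelOp, repr_diagOp, ← sub_mul]
        at h2
      have h3 : p.1 - 1 ≠ 0 := by
        have := one_sub_pow_ne_zero hq one_ne_zero
        rw [pow_one] at this
        rw [← neg_sub]
        exact neg_ne_zero.2 this
      rw [← repr_eq_zero_iff_form hq ht]
      exact (mul_eq_zero.1 ((mul_eq_zero.1 h2).resolve_left (pow_ne_zero _ h3))).resolve_left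
        (right_ne_zero_of_mul hR)
  · exact form_macP_powerSum_mul_of_card hq ht hcard

end Pieri

end Macdonald

namespace Macdonald

open MvPolynomial Finset TensorProduct

/-! ### Skew functions as coefficients of translations -/

section Skew

/-- The comultiplication of `Λ`, `p_k ↦ p_k ⊗ 1 + 1 ⊗ p_k`. -/
noncomputable def comul : SymFun →ₐ[ℂ] SymFun ⊗[ℂ] SymFun :=
  aeval fun k => X k ⊗ₜ 1 + 1 ⊗ₜ X k

/-- The coefficients of the comultiplication with respect to a basis of the second factor. -/
noncomputable def skewCoeff (b : Module.Basis YoungDiagram ℂ SymFun) (f : SymFun) :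
    YoungDiagram →₀ SymFun :=
  TensorProduct.equivFinsuppOfBasisRight b (comul f)

theorem comul_eq_sum (b : Module.Basis YoungDiagram ℂ SymFun) (f : SymFun) :
    comul f = ∑ mu ∈ (skewCoeff b f).support, skewCoeff b f mu ⊗ₜ[ℂ] b mu := by
  rw [← (TensorProduct.equivFinsuppOfBasisRight b).symm_apply_apply (comul f),
    TensorProduct.equivFinsuppOfBasisRight_symm_apply]
  rfl

theorem toPoly_sum_eq (n k : ℕ) : toPoly (Fin n ⊕ Fin k) =
    (Algebra.TensorProduct.lift ((rename Sum.inr).comp (toPoly (Fin k)))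
      ((rename Sum.inl).comp (toPoly (Fin n))) fun _ _ => Commute.all _ _).comp comul := by
  ext j : 1
  rw [AlgHom.comp_apply, comul, aeval_X, map_add, Algebra.TensorProduct.lift_tmul,
    Algebra.TensorProduct.lift_tmul, map_one, map_one, mul_one, one_mul, AlgHom.comp_apply,
    AlgHom.comp_apply, toPoly_X, toPoly_X, toPoly_X]
  simp only [psum, Fintype.sum_sum_type, map_sum, map_pow, rename_X]
  exact add_comm _ _

/-- Adding variables is the comultiplication. Truncating to ℓ(μ) ≤ n loses nothing, since the other
F_μ vanish in n variables. -/
theorem isSkew_skewCoeff {F : YoungDiagram → SymFun} {b : Module.Basis YoungDiagram ℂ SymFun}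
    (hb : ∀ mu, b mu = F mu) (hF : ∀ n mu, n < mu.colLen 0 → toPoly (Fin n) (F mu) = 0)
    (lam : YoungDiagram) : IsSkew F lam (skewCoeff b (F lam)) := by
  intro n k
  rw [toPoly_sum_eq, AlgHom.comp_apply, comul_eq_sum b, map_sum, sum_filter]
  refine sum_congr rfl fun mu _ => ?_
  rw [Algebra.TensorProduct.lift_tmul, AlgHom.comp_apply, AlgHom.comp_apply, hb]
  split_ifs with h
  · rfl
  · rw [hF n mu (not_le.1 h), map_zero, mul_zero]

/-- The branching rule determines its coefficients: with y specialized to numbers and n at least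
every length that occurs, it is a relation among linearly independent F_ν with scalar coefficients.
This identifies the function chosen in `skew`. -/
theorem IsSkew.eq {F : YoungDiagram → SymFun} {b : Module.Basis YoungDiagram ℂ SymFun}
    (hb : ∀ mu, b mu = F mu) {lam : YoungDiagram} {S T : YoungDiagram →₀ SymFun}
    (hS : IsSkew F lam S) (hT : IsSkew F lam T) : S = T := by
  classical
  ext1 mu
  set U := S.support ∪ T.support with hU
  by_cases hmu : mu ∈ U
  swap
  · rw [hU, mem_union, not_or, Finsupp.notMem_support_iff, Finsupp.notMem_support_iff] at hmu
    rw [hmu.1, hmu.2]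
  rw [← sub_eq_zero]
  refine toPoly_injective (N := 0) fun k _ => MvPolynomial.funext fun y => ?_
  rw [map_zero]
  have key : ∑ nu ∈ U, eval y (toPoly (Fin k) (S nu - T nu)) • F nu = 0 := by
    refine toPoly_injective (N := U.sup fun nu => nu.colLen 0) fun n hn => ?_
    set φ : MvPolynomial (Fin n ⊕ Fin k) ℂ →ₐ[ℂ] MvPolynomial (Fin n) ℂ :=
      aeval (Sum.elim X fun j => C (y j)) with hφ
    have hl : ∀ f : MvPolynomial (Fin n) ℂ, φ (rename Sum.inl f) = f := fun f => by
      rw [hφ, aeval_rename, Sum.elim_comp_inl, aeval_X_left_apply]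
    have hr : ∀ f : MvPolynomial (Fin k) ℂ, φ (rename Sum.inr f) = C (eval y f) := fun f => by
      rw [hφ, aeval_rename, Sum.elim_comp_inr]
      induction f using MvPolynomial.induction_on with
      | C a => rw [algHom_C, eval_C]; rfl
      | add f g hf hg => rw [map_add, hf, hg, map_add, C_add]
      | mul_X f k hf => rw [map_mul, hf, aeval_X, map_mul, eval_X, C_mul]
    have hsum : ∀ R : YoungDiagram →₀ SymFun, R.support ⊆ U → IsSkew F lam R →
        φ (toPoly (Fin n ⊕ Fin k) (F lam)) =
          ∑ nu ∈ U, eval y (toPoly (Fin k) (R nu)) • toPoly (Fin n) (F nu) := by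
      intro R hRU hR
      rw [hR n k, filter_true_of_mem fun nu hnu =>
        (le_sup (f := fun nu : YoungDiagram => nu.colLen 0) (hRU hnu)).trans hn, map_sum]
      refine (sum_congr rfl fun nu _ => ?_).trans (sum_subset hRU fun nu _ hnu => ?_)
      · rw [map_mul, hl, hr, C_mul']
      · rw [Finsupp.notMem_support_iff.1 hnu, map_zero, map_zero, zero_smul]
    rw [map_sum, ← sub_self (φ (toPoly (Fin n ⊕ Fin k) (F lam)))]
    conv_rhs =>
      congr
      · rw [hsum S subset_union_left hS]
      · rw [hsum T subset_union_right hT]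
    rw [← sum_sub_distrib]
    refine sum_congr rfl fun nu _ => ?_
    rw [map_smul, map_sub, map_sub, sub_smul]
  refine linearIndependent_iff'.1 b.linearIndependent U
    (fun nu => eval y (toPoly (Fin k) (S nu - T nu))) ?_ mu hmu
  rw [← key]
  exact sum_congr rfl fun nu _ => by rw [hb]

/-- The translation `p_k ↦ p_k + ρ_k`. -/
noncomputable def shift (ρ : ℕ+ → ℂ) : SymFun →ₐ[ℂ] SymFun := aeval fun k => X k + C (ρ k)

theorem shift_eq_sum (b : Module.Basis YoungDiagram ℂ SymFun) (ρ : ℕ+ → ℂ) (f : SymFun) :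
    shift ρ f = ∑ mu ∈ (skewCoeff b f).support, aeval ρ (skewCoeff b f mu) • b mu := by
  have h : shift ρ = (Algebra.TensorProduct.lift ((Algebra.ofId ℂ SymFun).comp (aeval ρ))
      (AlgHom.id ℂ SymFun) fun _ _ => Commute.all _ _).comp comul := by
    ext j : 1
    rw [AlgHom.comp_apply, comul, shift, aeval_X, aeval_X, map_add,
      Algebra.TensorProduct.lift_tmul, Algebra.TensorProduct.lift_tmul, map_one, map_one, mul_one,
      one_mul, AlgHom.comp_apply, aeval_X, AlgHom.id_apply, add_comm]
    rfl
  rw [h, AlgHom.comp_apply, comul_eq_sum b, map_sum]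
  refine sum_congr rfl fun mu _ => ?_
  rw [Algebra.TensorProduct.lift_tmul, AlgHom.comp_apply, AlgHom.id_apply, Algebra.smul_def]
  rfl

theorem repr_shift (b : Module.Basis YoungDiagram ℂ SymFun) (ρ : ℕ+ → ℂ) (f : SymFun)
    (mu : YoungDiagram) : b.repr (shift ρ f) mu = aeval ρ (skewCoeff b f mu) := by
  rw [shift_eq_sum b, map_sum, Finsupp.finsetSum_apply]
  simp_rw [map_smul, b.repr_self, Finsupp.smul_apply, Finsupp.single_apply, smul_eq_mul,
    mul_ite, mul_one, mul_zero]
  rw [sum_ite_eq']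
  split_ifs with h
  · rfl
  · rw [Finsupp.notMem_support_iff.1 h, map_zero]

/-- The specializations of skew functions are the coefficients of translations. -/
theorem aeval_skew {F : YoungDiagram → SymFun} {b : Module.Basis YoungDiagram ℂ SymFun}
    (hb : ∀ mu, b mu = F mu) (hF : ∀ n mu, n < mu.colLen 0 → toPoly (Fin n) (F mu) = 0)
    (ρ : ℕ+ → ℂ) (lam mu : YoungDiagram) :
    aeval ρ (skew F lam mu) = b.repr (shift ρ (F lam)) mu := by
  have h := isSkew_skewCoeff hb hF lam
  rw [repr_shift, skew, (Classical.epsilon_spec ⟨_, h⟩ : IsSkew F lam _).eq hb h]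

theorem shift_neg_shift (ρ : ℕ+ → ℂ) (f : SymFun) : shift (-ρ) (shift ρ f) = f := by
  have h : (shift (-ρ)).comp (shift ρ) = AlgHom.id ℂ SymFun := by
    ext k : 1
    rw [AlgHom.comp_apply, shift, shift, aeval_X, map_add, aeval_X, algHom_C, Pi.neg_apply,
      AlgHom.id_apply]
    simp [MvPolynomial.algebraMap_eq]
  exact DFunLike.congr_fun h f

theorem shift_omega {q t : ℂ} {ρ σ : ℕ+ → ℂ}
    (h : ∀ k : ℕ+, (-1) ^ ((k : ℕ) - 1) * ratio q t k * σ k = ρ k) (f : SymFun) :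
    shift σ (omega q t f) = omega q t (shift ρ f) := by
  have h : (shift σ).comp (omega q t) = (omega q t).comp (shift ρ) := by
    ext k : 1
    rw [AlgHom.comp_apply, AlgHom.comp_apply, shift, omega, shift, aeval_X, aeval_X, map_add,
      aeval_X, map_smul, aeval_X, algHom_C, ← h k, smul_add]
    rw [MvPolynomial.algebraMap_eq, C_mul, C_mul']
  exact DFunLike.congr_fun h f

/-- Subspaces that are stable under the partial derivatives are stable under translations. -/
theorem shift_mem {W : Submodule ℂ SymFun} (hW : ∀ k, ∀ f ∈ W, pderiv k f ∈ W) (ρ : ℕ+ → ℂ)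
    {f : SymFun} (hf : f ∈ W) : shift ρ f ∈ W := by
  classical
  set D : Derivation ℂ SymFun SymFun := mkDerivation ℂ fun k => C (ρ k) with hD
  have hsum : ∀ (s : Finset ℕ+) (g : SymFun),
      (∑ k ∈ s, ρ k • pderiv k : Derivation ℂ SymFun SymFun) g = ∑ k ∈ s, ρ k • pderiv k g := by
    intro s g
    induction s using Finset.induction_on with
    | empty => rfl
    | insert k s hk ih => rw [sum_insert hk, sum_insert hk, Derivation.add_apply, ih]; rfl
  have hDW : ∀ f ∈ W, D f ∈ W := by
    intro f hf
    -- D is formally an infinite sum of partial derivatives; on f only those in its finitely many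
    -- variables act.
    have h1 : D f = (∑ k ∈ f.vars, ρ k • pderiv k : Derivation ℂ SymFun SymFun) f := by
      apply derivation_eq_of_forall_mem_vars
      intro i hi
      rw [hD, mkDerivation_X, hsum]
      simp only [pderiv_X, Pi.single_apply, smul_ite, smul_zero]
      rw [Finset.sum_ite_eq f.vars i, if_pos hi, MvPolynomial.smul_eq_C_mul, mul_one]
    rw [h1, hsum]
    exact W.sum_mem fun k _ => W.smul_mem _ (hW k f hf)
  -- V is the translation by s ρ with s a formal variable. Since dV/ds = V ∘ D, the coefficient of
  -- s^m in V f is D^m f / m!, and s = 1 recovers the translation.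
  set V : SymFun →ₐ[ℂ] Polynomial SymFun :=
    aeval fun k => Polynomial.C (X k) + Polynomial.X * Polynomial.C (C (ρ k)) with hV
  have hV0 : ∀ f, (V f).coeff 0 = f := by
    intro f
    induction f using MvPolynomial.induction_on with
    | C a => rw [algHom_C, Polynomial.algebraMap_apply, Polynomial.coeff_C_zero]; rfl
    | add f g hf hg => rw [map_add, Polynomial.coeff_add, hf, hg]
    | mul_X f k hf => rw [map_mul, Polynomial.mul_coeff_zero, hf, hV, aeval_X]; simp
  have hV1 : ∀ f, (V f).eval 1 = shift ρ f := by
    intro f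
    induction f using MvPolynomial.induction_on with
    | C a => rw [algHom_C, algHom_C, Polynomial.algebraMap_apply, Polynomial.eval_C]
    | add f g hf hg => rw [map_add, Polynomial.eval_add, hf, hg, map_add]
    | mul_X f k hf => rw [map_mul, Polynomial.eval_mul, hf, hV, aeval_X, map_mul, shift, aeval_X]; simp
  have hVD : ∀ f, Polynomial.derivative (V f) = V (D f) := by
    intro f
    induction f using MvPolynomial.induction_on with
    | C a => rw [algHom_C, Polynomial.algebraMap_apply, Polynomial.derivative_C,
        derivation_C, map_zero]
    | add f g hf hg => rw [map_add, Polynomial.derivative_add, hf, hg, map_add, map_add]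
    | mul_X f k hf =>
      have h1 : V (X k) = Polynomial.C (X k) + Polynomial.X * Polynomial.C (C (ρ k)) := aeval_X _ _
      have h2 : Polynomial.derivative (V (X k)) = V (D (X k)) := by
        rw [h1, hD, mkDerivation_X, algHom_C, Polynomial.algebraMap_apply]
        simp [MvPolynomial.algebraMap_eq]
      rw [map_mul, Polynomial.derivative_mul, hf, h2, Derivation.leibniz, map_add, smul_eq_mul,
        smul_eq_mul, map_mul, map_mul]
      ring
  have hcoeff : ∀ m, ∀ f ∈ W, (V f).coeff m ∈ W := by
    intro m
    induction m with
    | zero => intro f hf; rwa [hV0]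
    | succ m ih =>
      intro f hf
      have h1 := congrArg (Polynomial.coeff · m) (hVD f)
      simp only [Polynomial.coeff_derivative] at h1
      have h2 : (V f).coeff (m + 1) = ((m : ℂ) + 1)⁻¹ • (V (D f)).coeff m := by
        rw [← h1, eq_inv_smul_iff₀ (by exact_mod_cast m.succ_ne_zero), MvPolynomial.smul_eq_C_mul,
          mul_comm]
        simp
      rw [h2]
      exact W.smul_mem _ (ih _ (hDW f hf))
  rw [← hV1, Polynomial.eval_eq_sum, Polynomial.sum]
  exact W.sum_mem fun m _ => by rw [one_pow, mul_one]; exact hcoeff m f hf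

end Skew

/-! ### The skew identity -/

section Main

/-- A monomial m_ν occurring in P_μ has ν dominated by μ, so its first n parts sum to at most μ_1 +
⋯ + μ_n < |μ|. Hence ν has more than n parts. -/
theorem toPoly_macP_eq_zero {q t : ℂ} (hq : ‖q‖ < 1) (ht : ‖t‖ < 1) (n : ℕ) (mu : YoungDiagram)
    (h : n < mu.colLen 0) : toPoly (Fin n) (macP q t mu) = 0 := by
  refine isSymmetric_ext (isSymmetric_toPoly _ _) IsSymmetric.zero fun nu hnu => ?_
  rw [coeff_zero, ← mCoeff_eq_coeff hnu]
  by_contra hne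
  have h1 := domLE_of_mCoeff_macP_ne_zero hq ht hne n
  have h2 : nu.card = mu.card := by
    by_contra hc
    exact hne (mCoeff_eq_zero ((isUnitriangular_macP hq ht).homog mu) hc)
  have h3 := sum_range_rowLen_lt h
  rw [sum_range_rowLen hnu] at h1
  omega

/-- The basis of Macdonald symmetric functions `Q_λ`. -/
noncomputable def dualBasis {q t : ℂ} (hq : ‖q‖ < 1) (ht : ‖t‖ < 1) :
    Module.Basis YoungDiagram ℂ SymFun :=
  (isUnitriangular_macP hq ht).basis.isUnitSMul
    (w := fun mu => (form q t (macP q t mu) (macP q t mu))⁻¹)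
    fun mu => (inv_ne_zero (form_macP_self_ne_zero hq ht mu)).isUnit

theorem dualBasis_apply {q t : ℂ} (hq : ‖q‖ < 1) (ht : ‖t‖ < 1) (mu : YoungDiagram) :
    dualBasis hq ht mu = macQ q t mu := by
  rw [dualBasis, Module.Basis.isUnitSMul_apply, IsUnitriangular.basis_apply, macQ, form_apply]

theorem repr_dualBasis_omega {q t : ℂ} (hq : ‖q‖ < 1) (ht : ‖t‖ < 1) (f : SymFun)
    (mu : YoungDiagram) : (dualBasis ht hq).repr (omega q t f) mu.transpose =
      (isUnitriangular_macP hq ht).basis.repr f mu := by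
  have h : ((Finsupp.lapply mu.transpose).comp (dualBasis ht hq).repr.toLinearMap).comp
      (omega q t).toLinearMap =
        (Finsupp.lapply mu).comp (isUnitriangular_macP hq ht).basis.repr.toLinearMap := by
    apply (isUnitriangular_macP hq ht).basis.ext
    intro nu
    have h1 : omega q t ((isUnitriangular_macP hq ht).basis nu) =
        dualBasis ht hq nu.transpose := by
      rw [IsUnitriangular.basis_apply, omega_macP hq ht, dualBasis_apply]
    simp only [LinearMap.comp_apply, AlgHom.toLinearMap_apply, LinearEquiv.coe_coe, h1,
      Module.Basis.repr_self, Finsupp.lapply_apply, Finsupp.single_apply,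
      YoungDiagram.transpose_eq_iff]
  exact LinearMap.congr_fun h f

/-- Translations shrink diagrams. -/
theorem repr_shift_macP {q t : ℂ} (hq : ‖q‖ < 1) (ht : ‖t‖ < 1) (ρ : ℕ+ → ℂ)
    {lam mu : YoungDiagram} (h : ¬ mu ≤ lam) :
    (isUnitriangular_macP hq ht).basis.repr (shift ρ (macP q t lam)) mu = 0 := by
  set hP := isUnitriangular_macP hq ht
  -- W is the span of the P_ν with ν ⊂ λ, given by equations. Its stability under the partial
  -- derivatives is the adjoint form of the enlarging property of multiplication by p_k.
  let W : Submodule ℂ SymFun := ⨅ nu ∈ {nu | ¬ nu ≤ lam},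
    LinearMap.ker ((Finsupp.lapply nu).comp hP.basis.repr.toLinearMap)
  have hW : ∀ f, f ∈ W ↔ ∀ nu, ¬ nu ≤ lam → hP.basis.repr f nu = 0 := fun f => by
    simp [W, Submodule.mem_iInf]
  have hself : macP q t lam ∈ W := (hW _).2 fun nu hnu => by
    rw [← hP.basis_apply, Module.Basis.repr_self, Finsupp.single_apply,
      if_neg fun h => hnu h.ge]
  refine (hW _).1 (shift_mem (W := W) (fun k f hf => (hW _).2 fun nu hnu => ?_) ρ hself) mu h
  rw [repr_eq_zero_iff_form hq ht]
  have h1 := form_X_mul q t k (macP q t nu) f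
  have h2 : form q t (X k * macP q t nu) f = 0 := by
    rw [form_comm]
    conv_lhs => rw [← hP.basis.linearCombination_repr f]
    rw [Finsupp.linearCombination_apply, Finsupp.sum, map_sum, LinearMap.sum_apply]
    refine sum_eq_zero fun kap _ => ?_
    rw [map_smul, LinearMap.smul_apply, hP.basis_apply]
    by_cases hk : kap ≤ lam
    · have h3 := form_macP_powerSum_mul hq ht (lam := kap) (mu := nu)
        (fun hle => hnu (hle.trans hk)) k.natPred
      rw [powerSum, PNat.succPNat_natPred] at h3
      rw [h3, smul_zero]
    · rw [(hW f).1 hf kap hk, zero_smul]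
  rw [h2] at h1
  refine (mul_eq_zero.1 h1.symm).resolve_left (mul_ne_zero (div_ne_zero ?_ ?_) ?_)
  · exact one_sub_pow_ne_zero hq k.ne_zero
  · exact one_sub_pow_ne_zero ht k.ne_zero
  · exact_mod_cast k.ne_zero

theorem tsum_geometric_pow {u t : ℂ} (ht : ‖t‖ < 1) {k : ℕ} (hk : k ≠ 0) :
    ∑' i, (u * t ^ i) ^ k = u ^ k / (1 - t ^ k) := by
  have h1 : ‖t ^ k‖ < 1 := by
    rw [norm_pow]
    exact pow_lt_one₀ (norm_nonneg _) ht hk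
  simp_rw [mul_pow, ← pow_mul, mul_comm _ k, pow_mul]
  rw [tsum_mul_left, tsum_geometric_of_norm_lt_one h1, div_eq_mul_inv]

/-- The skew Cauchy identity for the specializations `α(u, ut, …)` and `α(-u, -uq, …)`. -/
theorem sum_specAlpha_skewP_mul_skewQ {q t : ℂ} (hq : ‖q‖ < 1) (ht : ‖t‖ < 1) (u : ℂ)
    (lam mu : YoungDiagram) :
    ∑ nu ∈ Icc mu lam, specAlpha (fun i => u * t ^ i) (skewP q t lam nu) *
      specAlpha (fun i => -(u * q ^ i)) (skewQ t q nu.transpose mu.transpose) =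
        (isUnitriangular_macP hq ht).basis.repr (macP q t lam) mu := by
  set b := (isUnitriangular_macP hq ht).basis with hb
  set ρ : ℕ+ → ℂ := fun k => u ^ (k : ℕ) / (1 - t ^ (k : ℕ)) with hρ
  set σ : ℕ+ → ℂ := fun k => (-u) ^ (k : ℕ) / (1 - q ^ (k : ℕ)) with hσ
  have h1 : specAlpha (fun i => u * t ^ i) = aeval ρ := by
    rw [specAlpha]
    congr 1
    exact funext fun k => tsum_geometric_pow ht k.ne_zero
  have h2 : specAlpha (fun i => -(u * q ^ i)) = aeval σ := by
    rw [specAlpha]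
    congr 1
    simp_rw [← neg_mul]
    exact funext fun k => tsum_geometric_pow hq k.ne_zero
  have h3 : ∀ nu, specAlpha (fun i => u * t ^ i) (skewP q t lam nu) =
      b.repr (shift ρ (macP q t lam)) nu := fun nu => by
    rw [h1, skewP]
    exact aeval_skew (fun mu => IsUnitriangular.basis_apply _ mu) (toPoly_macP_eq_zero hq ht) _ _ _
  -- The specialization α(-u, -uq, …) is the one that ω matches with the opposite of α(u, ut, …):
  -- the factor 1 - q^k cancels and the signs combine to -1.
  have h4 : ∀ k : ℕ+, (-1) ^ ((k : ℕ) - 1) * ratio q t k * σ k = (-ρ) k := fun k => by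
    obtain ⟨m, hm⟩ : ∃ m, (k : ℕ) = m + 1 := ⟨(k : ℕ) - 1, by have := k.pos; omega⟩
    have h5 := one_sub_pow_ne_zero hq k.ne_zero
    have h6 := one_sub_pow_ne_zero ht k.ne_zero
    have h7 : (-1 : ℂ) ^ ((k : ℕ) - 1) * (-u) ^ (k : ℕ) = -u ^ (k : ℕ) := by
      rw [hm, Nat.add_sub_cancel, neg_pow u, pow_succ (-1 : ℂ) m]
      have h8 : (-1 : ℂ) ^ (m * 2) = 1 := Even.neg_one_pow (even_two.mul_left m)
      linear_combination (-u ^ (m + 1)) * h8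
    rw [Pi.neg_apply, hσ, hρ, ratio]
    simp only
    field_simp
    exact h7
  -- By duality the coefficient of Q_{μ'}(t,q) in the translate of Q_{ν'}(t,q) is that of P_μ(q,t)
  -- in the translate of P_ν(q,t) by -ρ.
  have h5 : ∀ nu, specAlpha (fun i => -(u * q ^ i)) (skewQ t q nu.transpose mu.transpose) =
      b.repr (shift (-ρ) (macP q t nu)) mu := fun nu => by
    rw [h2, skewQ, aeval_skew (dualBasis_apply ht hq) (fun n mu h => by
      rw [macQ, map_smul, toPoly_macP_eq_zero ht hq n mu h, smul_zero]), ← omega_macP hq ht,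
      shift_omega h4, repr_dualBasis_omega hq ht]
  simp_rw [h3, h5]
  have h6 : b.repr (macP q t lam) mu = ∑ nu ∈ (b.repr (shift ρ (macP q t lam))).support,
      b.repr (shift ρ (macP q t lam)) nu * b.repr (shift (-ρ) (macP q t nu)) mu := by
    conv_lhs => rw [← shift_neg_shift ρ (macP q t lam),
      ← b.linearCombination_repr (shift ρ (macP q t lam))]
    rw [Finsupp.linearCombination_apply, Finsupp.sum, map_sum, map_sum, Finsupp.finsetSum_apply]
    refine sum_congr rfl fun nu _ => ?_
    rw [map_smul, map_smul, Finsupp.smul_apply, smul_eq_mul, hb, IsUnitriangular.basis_apply]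
  rw [h6]
  -- Neither index set need contain the other: terms outside the support vanish trivially, and terms
  -- outside the interval vanish because translations shrink diagrams.
  refine sum_congr_of_eq_on_inter (fun nu _ hnu => ?_) (fun nu _ hnu => ?_) fun _ _ _ => rfl
  · rw [Finsupp.notMem_support_iff.1 hnu, zero_mul]
  · rw [mem_Icc, not_and_or] at hnu
    rcases hnu with h | h
    · rw [repr_shift_macP hq ht (-ρ) h, mul_zero]
    · rw [repr_shift_macP hq ht ρ h, zero_mul]

end Main

end Macdonald

open Classical in
theorem mainTheorem2 (q t : ℂ) (hq : ‖q‖ < 1) (ht : ‖t‖ < 1) (u : ℂ) (lam mu : YoungDiagram) :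
    ∑ nu ∈ Finset.Icc mu lam,
      Macdonald.specAlpha (fun i => u * t ^ i) (Macdonald.skewP q t lam nu) *
        Macdonald.specAlpha (fun i => -(u * q ^ i))
          (Macdonald.skewQ t q nu.transpose mu.transpose) =
      if lam = mu then 1 else 0 := by
  rw [Macdonald.sum_specAlpha_skewP_mul_skewQ hq ht, ← Macdonald.IsUnitriangular.basis_apply
    (Macdonald.isUnitriangular_macP hq ht), Module.Basis.repr_self, Finsupp.single_apply]
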